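/- Let $\mathcal V$ be a category with pullbacks that is cartesian closed, with terminal object $*$ and internal hom $[-,-]$, and extensive: it has all small coproducts, and for every set $I$ and every family $(X_i)_{i\in I}$ of objects the functor $\coprod\colon \prod_{i\in I}\mathcal V_{/X_i}\to \mathcal V_{/\coprod_{i\in I} X_i}$ is an equivalence. Let $\mathcal I,\mathcal C$ be $\mathcal V$-categories (each with a set of objects), let $G\colon\mathcal I\to\mathcal C$ be a $\mathcal V$-functor, $L\in\mathcal C$ an object, and $\lambda\colon\Delta L\Rightarrow G$ a $\mathcal V$-natural transformation from the constant $\mathcal V$-functor $\Delta L\colon\mathcal I\to\mathcal C$ at $L$. Then the following are equivalent: (i) $(L,\lambda)$ is a (conical) $\mathcal V$-limit of $G$: the $\mathcal V$-functor $\mathcal C^{\mathcal I}(\Delta(-),G)\colon\mathcal C^{\mathrm{op}}\to\mathcal V$ is represented by $(L,\lambda)$, i.e. the $\mathcal V$-natural transformation $\mathcal C(-,L)\Rightarrow\mathcal C^{\mathcal I}(\Delta(-),G)$ that corresponds to the element $\lambda\colon *\to\mathcal C^{\mathcal I}(\Delta L,G)$ under the Yoneda lemma is a $\mathcal V$-natural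 isomorphism. Here, for $\mathcal V$-functors $F,H\colon\mathcal I\to\mathcal C$, $\mathcal C^{\mathcal I}(F,H)$ is the equalizer of the two canonical maps $\prod_{i}\mathcal C(Fi,Hi)\rightrightarrows\prod_{i,j}[\mathcal I(i,j),\mathcal C(Fi,Hj)]$. (ii) $(L,\lambda)$ is an internal limit of the internal functor $\mathrm{Int}\,G\colon\mathrm{Int}\,\mathcal I\to\mathrm{Int}\,\mathcal C$: the element $*\to\Delta\downarrow\mathrm{Int}\,G$ determined by $L$ and the internalization of $\lambda$ is an internal terminal object. Here $\mathrm{Int}\,\mathcal C$ is the category internal to $\mathcal V$ with object of objects $\coprod_{A\in\mathcal C}*$, object of morphisms $\coprod_{A,B\in\mathcal C}\mathcal C(A,B)$, and structure induced by that of $\mathcal C$. For an internal category $\mathbb A$, write $[\![\mathbb I,\mathbb A]\!]$ for the internal hom in the cartesian closed category of categories internal to $\mathcal V$, and $\mathbb 2$ for the internal category given by the free-living arrow. For an internal functor $H\colon\mathbb A\to\mathbb B$ and an element $b\colon *\to\mathbb B$, the comma internal category $H\downarrow b$ is the pullback of $(s,t)\colon[\![\mathbb 2,\mathbb B]\!]\to\mathbb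 B\times\mathbb B$ along $H\times b\colon\mathbb A\cong\mathbb A\times *\to\mathbb B\times\mathbb B$. The internal category of cones over $K\colon\mathbb I\to\mathbb A$ is $\Delta\downarrow K$, for the diagonal $\Delta\colon\mathbb A\to[\![\mathbb I,\mathbb A]\!]$ and the element $K\colon *\to[\![\mathbb I,\mathbb A]\!]$. An element $T\colon *\to\mathbb A$ is an internal terminal object if the projection $\mathbb A_{/T}=\mathrm{id}_{\mathbb A}\downarrow T\to\mathbb A$ is an isomorphism of internal categories; an internal limit of $K$ is an internal terminal object of $\Delta\downarrow K$. -/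

import Mathlib

open CategoryTheory Limits MonoidalCategory CartesianMonoidalCategory

universe w w₂ v u

namespace EnrichedInternal

noncomputable section

attribute [local simp] pullback.lift_fst pullback.lift_snd pullback.lift_fst_assoc
  pullback.lift_snd_assoc

/-! ### Internal categories -/

/-- An internal category in a category `V` with pullbacks. The two components of
`pullback tgt src` are written in the order of composition, so that `comp` sends a composable pair
`a ⟶ b ⟶ c` to its composite. Associativity is stated on generalized elements. -/
structure InternalCat (V : Type u) [Category.{v} V] [HasPullbacks V] where
  obj : V
  mor : V
  src : mor ⟶ obj
  tgt : mor ⟶ obj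
  comp : pullback tgt src ⟶ mor
  one : obj ⟶ mor
  one_src : one ≫ src = 𝟙 obj
  one_tgt : one ≫ tgt = 𝟙 obj
  comp_src : comp ≫ src = pullback.fst tgt src ≫ src
  comp_tgt : comp ≫ tgt = pullback.snd tgt src ≫ tgt
  one_comp : pullback.lift (f := tgt) (g := src) (src ≫ one) (𝟙 mor)
    (by rw [Category.assoc, one_tgt, Category.comp_id, Category.id_comp]) ≫ comp = 𝟙 mor
  comp_one : pullback.lift (f := tgt) (g := src) (𝟙 mor) (tgt ≫ one)
    (by rw [Category.assoc, one_src, Category.comp_id, Category.id_comp]) ≫ comp = 𝟙 mor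
  assoc : ∀ {X : V} (f g h : X ⟶ mor) (hfg : f ≫ tgt = g ≫ src) (hgh : g ≫ tgt = h ≫ src),
    pullback.lift (f := tgt) (g := src) (pullback.lift f g hfg ≫ comp) h
        (by rw [Category.assoc, comp_tgt, pullback.lift_snd_assoc, hgh]) ≫ comp =
      pullback.lift (f := tgt) (g := src) f (pullback.lift g h hgh ≫ comp)
        (by rw [Category.assoc, comp_src, pullback.lift_fst_assoc, hfg]) ≫ comp

namespace InternalCat

variable {V : Type u} [Category.{v} V] [HasPullbacks V]

/-- Composition of composable generalized morphisms `X ⟶ A.mor`. -/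
def mul (A : InternalCat V) {X : V} (f g : X ⟶ A.mor) (h : f ≫ A.tgt = g ≫ A.src) : X ⟶ A.mor :=
  pullback.lift f g h ≫ A.comp

section
variable (A : InternalCat V) {X Y : V}

@[simp] lemma mul_src (f g : X ⟶ A.mor) (h : f ≫ A.tgt = g ≫ A.src) :
    A.mul f g h ≫ A.src = f ≫ A.src := by simp [mul, A.comp_src]

@[simp] lemma mul_tgt (f g : X ⟶ A.mor) (h : f ≫ A.tgt = g ≫ A.src) :
    A.mul f g h ≫ A.tgt = g ≫ A.tgt := by simp [mul, A.comp_tgt]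

lemma whisker_mul (k : Y ⟶ X) (f g : X ⟶ A.mor) (h : f ≫ A.tgt = g ≫ A.src) :
    k ≫ A.mul f g h = A.mul (k ≫ f) (k ≫ g) (by simp only [Category.assoc, h]) := by
  simp only [mul, ← Category.assoc]
  congr 1
  apply pullback.hom_ext <;> simp

lemma one_mul (f : X ⟶ A.mor) (e : X ⟶ A.mor) (he : e = f ≫ A.src ≫ A.one)
    (h : e ≫ A.tgt = f ≫ A.src) : A.mul e f h = f := by
  subst he
  have := A.one_comp
  have h₂ := congrArg (fun t => f ≫ t) this
  simp only [Category.comp_id] at h₂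
  rw [← Category.assoc] at h₂
  refine Eq.trans ?_ h₂
  rw [mul]
  congr 1
  apply pullback.hom_ext <;> simp

lemma mul_one (f : X ⟶ A.mor) (e : X ⟶ A.mor) (he : e = f ≫ A.tgt ≫ A.one)
    (h : f ≫ A.tgt = e ≫ A.src) : A.mul f e h = f := by
  subst he
  have := A.comp_one
  have h₂ := congrArg (fun t => f ≫ t) this
  simp only [Category.comp_id] at h₂
  rw [← Category.assoc] at h₂
  refine Eq.trans ?_ h₂
  rw [mul]
  congr 1
  apply pullback.hom_ext <;> simp

lemma mul_assoc (f g h : X ⟶ A.mor) (hfg : f ≫ A.tgt = g ≫ A.src) (hgh : g ≫ A.tgt = h ≫ A.src)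
    (h₁ : A.mul f g hfg ≫ A.tgt = h ≫ A.src) (h₂ : f ≫ A.tgt = A.mul g h hgh ≫ A.src) :
    A.mul (A.mul f g hfg) h h₁ = A.mul f (A.mul g h hgh) h₂ :=
  A.assoc f g h hfg hgh

lemma mul_congr {f g f' g' : X ⟶ A.mor} (hf : f = f') (hg : g = g')
    (h : f ≫ A.tgt = g ≫ A.src) :
    A.mul f g h = A.mul f' g' (by rw [← hf, ← hg, h]) := by
  subst hf hg; rfl

lemma comp_eq_mul : A.comp = A.mul (pullback.fst A.tgt A.src) (pullback.snd A.tgt A.src)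
    pullback.condition := by
  rw [mul]
  convert (Category.id_comp _).symm
  apply pullback.hom_ext <;> simp

lemma mul_eq (m : ∀ {X : V} (f g : X ⟶ A.mor), f ≫ A.tgt = g ≫ A.src → (X ⟶ A.mor))
    (m_nat : ∀ {X Y : V} (k : Y ⟶ X) (f g : X ⟶ A.mor) (h : f ≫ A.tgt = g ≫ A.src),
      k ≫ m f g h = m (k ≫ f) (k ≫ g) (by simp only [Category.assoc, h]))
    (hm : A.comp = m (pullback.fst A.tgt A.src) (pullback.snd A.tgt A.src) pullback.condition)
    (f g : X ⟶ A.mor) (h : f ≫ A.tgt = g ≫ A.src) : A.mul f g h = m f g h := by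
  rw [mul, hm, m_nat]
  simp only [pullback.lift_fst, pullback.lift_snd]

end

/-- Build an internal category from a composition of generalized morphisms that is natural in the
stage of definition. -/
abbrev ofMul (obj mor : V) (src tgt : mor ⟶ obj) (one : obj ⟶ mor)
    (m : ∀ {X : V} (f g : X ⟶ mor), f ≫ tgt = g ≫ src → (X ⟶ mor))
    (m_nat : ∀ {X Y : V} (k : Y ⟶ X) (f g : X ⟶ mor) (h : f ≫ tgt = g ≫ src),
      k ≫ m f g h = m (k ≫ f) (k ≫ g) (by simp only [Category.assoc, h]))
    (one_src : one ≫ src = 𝟙 obj) (one_tgt : one ≫ tgt = 𝟙 obj)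
    (m_src : ∀ {X : V} (f g : X ⟶ mor) (h : f ≫ tgt = g ≫ src), m f g h ≫ src = f ≫ src)
    (m_tgt : ∀ {X : V} (f g : X ⟶ mor) (h : f ≫ tgt = g ≫ src), m f g h ≫ tgt = g ≫ tgt)
    (one_m : ∀ {X : V} (f : X ⟶ mor), m (f ≫ src ≫ one) f
      (by rw [Category.assoc, Category.assoc, one_tgt, Category.comp_id]) = f)
    (m_one : ∀ {X : V} (f : X ⟶ mor), m f (f ≫ tgt ≫ one)
      (by rw [Category.assoc, Category.assoc, one_src, Category.comp_id]) = f)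
    (m_assoc : ∀ {X : V} (f g h : X ⟶ mor) (hfg : f ≫ tgt = g ≫ src) (hgh : g ≫ tgt = h ≫ src),
      m (m f g hfg) h (by rw [m_tgt, hgh]) = m f (m g h hgh) (by rw [m_src, hfg])) :
    InternalCat V where
  obj := obj
  mor := mor
  src := src
  tgt := tgt
  one := one
  comp := m (pullback.fst tgt src) (pullback.snd tgt src) pullback.condition
  one_src := one_src
  one_tgt := one_tgt
  comp_src := m_src _ _ _
  comp_tgt := m_tgt _ _ _
  one_comp := by
    rw [m_nat]
    simp only [pullback.lift_fst, pullback.lift_snd]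
    simpa using one_m (𝟙 mor)
  comp_one := by
    rw [m_nat]
    simp only [pullback.lift_fst, pullback.lift_snd]
    simpa using m_one (𝟙 mor)
  assoc f g h hfg hgh := by
    simp only [m_nat, pullback.lift_fst, pullback.lift_snd]
    exact m_assoc f g h hfg hgh

/-- An internal functor. -/
@[ext]
structure Hom (A B : InternalCat V) where
  obj : A.obj ⟶ B.obj
  mor : A.mor ⟶ B.mor
  mor_src : mor ≫ B.src = A.src ≫ obj
  mor_tgt : mor ≫ B.tgt = A.tgt ≫ obj
  one_mor : A.one ≫ mor = obj ≫ B.one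
  comp_mor : A.comp ≫ mor =
    pullback.lift (f := B.tgt) (g := B.src) (pullback.fst A.tgt A.src ≫ mor)
      (pullback.snd A.tgt A.src ≫ mor)
      (by rw [Category.assoc, Category.assoc, mor_src, mor_tgt, pullback.condition_assoc]) ≫ B.comp

namespace Hom

lemma mul_compat {A B : InternalCat V} (F : Hom A B) {X : V} {f g : X ⟶ A.mor}
    (h : f ≫ A.tgt = g ≫ A.src) : (f ≫ F.mor) ≫ B.tgt = (g ≫ F.mor) ≫ B.src := by
  rw [Category.assoc, Category.assoc, F.mor_src, F.mor_tgt, reassoc_of% h]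

lemma mul_mor {A B : InternalCat V} (F : Hom A B) {X : V} (f g : X ⟶ A.mor)
    (h : f ≫ A.tgt = g ≫ A.src) :
    A.mul f g h ≫ F.mor = B.mul (f ≫ F.mor) (g ≫ F.mor) (F.mul_compat h) := by
  rw [mul, mul, Category.assoc, F.comp_mor, ← Category.assoc]
  congr 1
  apply pullback.hom_ext <;> simp

/-- Build an internal functor from compatibility with composition on generalized morphisms. -/
def ofMul {A B : InternalCat V} (obj : A.obj ⟶ B.obj) (mor : A.mor ⟶ B.mor)
    (mor_src : mor ≫ B.src = A.src ≫ obj) (mor_tgt : mor ≫ B.tgt = A.tgt ≫ obj)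
    (one_mor : A.one ≫ mor = obj ≫ B.one)
    (mul_mor : ∀ {X : V} (f g : X ⟶ A.mor) (h : f ≫ A.tgt = g ≫ A.src),
      A.mul f g h ≫ mor = B.mul (f ≫ mor) (g ≫ mor)
        (by rw [Category.assoc, Category.assoc, mor_src, mor_tgt, reassoc_of% h])) : Hom A B where
  obj := obj
  mor := mor
  mor_src := mor_src
  mor_tgt := mor_tgt
  one_mor := one_mor
  comp_mor := by
    rw [A.comp_eq_mul]
    exact mul_mor _ _ _

end Hom

/-- The category of internal categories to `V` and internal functors. -/
instance : Category (InternalCat V) where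
  Hom := Hom
  id A := Hom.ofMul (𝟙 _) (𝟙 _) (by simp) (by simp) (by simp)
    (fun f g h => by
      rw [Category.comp_id]
      exact A.mul_congr (Category.comp_id f).symm (Category.comp_id g).symm h)
  comp {A B C} F G := Hom.ofMul (F.obj ≫ G.obj) (F.mor ≫ G.mor)
    (by rw [Category.assoc, G.mor_src, ← Category.assoc, F.mor_src, Category.assoc])
    (by rw [Category.assoc, G.mor_tgt, ← Category.assoc, F.mor_tgt, Category.assoc])
    (by rw [← Category.assoc, F.one_mor, Category.assoc, G.one_mor, Category.assoc])
    (fun f g h => by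
      rw [← Category.assoc, F.mul_mor, G.mul_mor]
      exact C.mul_congr (Category.assoc _ _ _) (Category.assoc _ _ _) _)
  id_comp F := Hom.ext (Category.id_comp _) (Category.id_comp _)
  comp_id F := Hom.ext (Category.comp_id _) (Category.comp_id _)
  assoc F G H := Hom.ext (Category.assoc _ _ _) (Category.assoc _ _ _)

section
variable {A B C : InternalCat V}

@[simp] lemma id_obj : Hom.obj (𝟙 A) = 𝟙 A.obj := rfl
@[simp] lemma id_mor : Hom.mor (𝟙 A) = 𝟙 A.mor := rfl
@[simp] lemma comp_obj (F : A ⟶ B) (G : B ⟶ C) : Hom.obj (F ≫ G) = F.obj ≫ G.obj := rfl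
@[simp] lemma comp_mor (F : A ⟶ B) (G : B ⟶ C) : Hom.mor (F ≫ G) = F.mor ≫ G.mor := rfl

lemma obj_w {D : InternalCat V} {F : A ⟶ B} {G : B ⟶ D} {H : A ⟶ C} {K : C ⟶ D}
    (h : F ≫ G = H ≫ K) : F.obj ≫ G.obj = H.obj ≫ K.obj := congrArg Hom.obj h

lemma mor_w {D : InternalCat V} {F : A ⟶ B} {G : B ⟶ D} {H : A ⟶ C} {K : C ⟶ D}
    (h : F ≫ G = H ≫ K) : F.mor ≫ G.mor = H.mor ≫ K.mor := congrArg Hom.mor h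

lemma hom_ext {F G : A ⟶ B} (h₀ : F.obj = G.obj) (h₁ : F.mor = G.mor) : F = G := Hom.ext h₀ h₁

end

/-- The constant internal category at an object of `V`. -/
abbrev cst (X : V) : InternalCat V :=
  ofMul X X (𝟙 X) (𝟙 X) (𝟙 X) (fun f _ _ => f) (by simp) (by simp) (by simp) (by simp)
    (fun f g h => by simpa using h) (by simp) (by simp) (by simp)

/-- The internal functor `cst X ⟶ A` corresponding to a map `X ⟶ A.obj`. -/
def ofPoint (A : InternalCat V) {X : V} (a : X ⟶ A.obj) : cst X ⟶ A :=
  Hom.ofMul (A := cst X) a (a ≫ A.one) (by simp [cst, ofMul, A.one_src])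
    (by simp [cst, ofMul, A.one_tgt]) (by simp [cst, ofMul])
    (fun f g h => by
      have hm : (cst X).mul f g h = f := pullback.lift_fst _ _ _
      have hfg : f = g := (Category.comp_id f).symm.trans (h.trans (Category.comp_id g))
      subst hfg
      rw [hm]
      refine (A.mul_one _ _ ?_ _).symm
      have h₁ : (a ≫ A.one) ≫ A.tgt ≫ A.one = a ≫ A.one := by simp [reassoc_of% A.one_tgt]
      exact (congrArg (fun t => f ≫ t) h₁).symm.trans (Category.assoc _ _ _).symm)

/-- The constant internal functor at a map of `V`. -/
def cstMap {X Y : V} (k : X ⟶ Y) : cst X ⟶ cst Y := (cst Y).ofPoint k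

@[simp] lemma cstMap_obj {X Y : V} (k : X ⟶ Y) : (cstMap k).obj = k := rfl
@[simp] lemma cstMap_mor {X Y : V} (k : X ⟶ Y) : (cstMap k).mor = k := Category.comp_id k

/-! #### Pullbacks of internal categories -/

section
variable {A B C : InternalCat V} (F : A ⟶ C) (G : B ⟶ C)

/-- The pullback of internal categories, computed levelwise. -/
abbrev pb : InternalCat V :=
  ofMul (pullback F.obj G.obj) (pullback F.mor G.mor)
    (pullback.lift (pullback.fst _ _ ≫ A.src) (pullback.snd _ _ ≫ B.src) (by
      rw [Category.assoc, Category.assoc, ← F.mor_src, ← G.mor_src, pullback.condition_assoc]))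
    (pullback.lift (pullback.fst _ _ ≫ A.tgt) (pullback.snd _ _ ≫ B.tgt) (by
      rw [Category.assoc, Category.assoc, ← F.mor_tgt, ← G.mor_tgt, pullback.condition_assoc]))
    (pullback.lift (pullback.fst _ _ ≫ A.one) (pullback.snd _ _ ≫ B.one) (by
      rw [Category.assoc, Category.assoc, F.one_mor, G.one_mor, pullback.condition_assoc]))
    (fun f g h => pullback.lift
      (A.mul (f ≫ pullback.fst _ _) (g ≫ pullback.fst _ _)
        (by simpa using h =≫ pullback.fst _ _))
      (B.mul (f ≫ pullback.snd _ _) (g ≫ pullback.snd _ _)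
        (by simpa using h =≫ pullback.snd _ _))
      (by
        rw [F.mul_mor, G.mul_mor]
        apply C.mul_congr <;> simp [pullback.condition]))
    (fun k f g h => by
      apply pullback.hom_ext <;> simp [whisker_mul])
    (by apply pullback.hom_ext <;> simp [one_src])
    (by apply pullback.hom_ext <;> simp [one_tgt])
    (fun f g h => by apply pullback.hom_ext <;> simp)
    (fun f g h => by apply pullback.hom_ext <;> simp)
    (fun f => by
      apply pullback.hom_ext
      · rw [pullback.lift_fst]; apply one_mul; simp
      · rw [pullback.lift_snd]; apply one_mul; simp)
    (fun f => by
      apply pullback.hom_ext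
      · rw [pullback.lift_fst]; apply mul_one; simp
      · rw [pullback.lift_snd]; apply mul_one; simp)
    (fun f g h hfg hgh => by
      apply pullback.hom_ext
      · simp only [pullback.lift_fst]; apply mul_assoc
      · simp only [pullback.lift_snd]; apply mul_assoc)

/-- The first projection from the pullback. -/
def pbFst : pb F G ⟶ A where
  obj := pullback.fst F.obj G.obj
  mor := pullback.fst F.mor G.mor
  mor_src := (pullback.lift_fst _ _ _).symm
  mor_tgt := (pullback.lift_fst _ _ _).symm
  one_mor := pullback.lift_fst _ _ _
  comp_mor := pullback.lift_fst _ _ _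

/-- The second projection from the pullback. -/
def pbSnd : pb F G ⟶ B where
  obj := pullback.snd F.obj G.obj
  mor := pullback.snd F.mor G.mor
  mor_src := (pullback.lift_snd _ _ _).symm
  mor_tgt := (pullback.lift_snd _ _ _).symm
  one_mor := pullback.lift_snd _ _ _
  comp_mor := pullback.lift_snd _ _ _

variable {F G}

/-- Generalized objects of the pullback. -/
def pbObj {X : V} (a : X ⟶ A.obj) (b : X ⟶ B.obj) (h : a ≫ F.obj = b ≫ G.obj) :
    X ⟶ (pb F G).obj := pullback.lift a b h

/-- Generalized morphisms of the pullback. -/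
def pbMor {X : V} (a : X ⟶ A.mor) (b : X ⟶ B.mor) (h : a ≫ F.mor = b ≫ G.mor) :
    X ⟶ (pb F G).mor := pullback.lift a b h

@[simp] lemma pbObj_fst {X : V} (a : X ⟶ A.obj) (b : X ⟶ B.obj) (h : a ≫ F.obj = b ≫ G.obj) :
    pbObj a b h ≫ (pbFst F G).obj = a := pullback.lift_fst _ _ _
@[simp] lemma pbObj_snd {X : V} (a : X ⟶ A.obj) (b : X ⟶ B.obj) (h : a ≫ F.obj = b ≫ G.obj) :
    pbObj a b h ≫ (pbSnd F G).obj = b := pullback.lift_snd _ _ _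
@[simp] lemma pbMor_fst {X : V} (a : X ⟶ A.mor) (b : X ⟶ B.mor) (h : a ≫ F.mor = b ≫ G.mor) :
    pbMor a b h ≫ (pbFst F G).mor = a := pullback.lift_fst _ _ _
@[simp] lemma pbMor_snd {X : V} (a : X ⟶ A.mor) (b : X ⟶ B.mor) (h : a ≫ F.mor = b ≫ G.mor) :
    pbMor a b h ≫ (pbSnd F G).mor = b := pullback.lift_snd _ _ _

lemma pbObj_ext {X : V} {k l : X ⟶ (pb F G).obj} (h₁ : k ≫ (pbFst F G).obj = l ≫ (pbFst F G).obj)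
    (h₂ : k ≫ (pbSnd F G).obj = l ≫ (pbSnd F G).obj) : k = l := pullback.hom_ext h₁ h₂

lemma pbMor_ext {X : V} {k l : X ⟶ (pb F G).mor} (h₁ : k ≫ (pbFst F G).mor = l ≫ (pbFst F G).mor)
    (h₂ : k ≫ (pbSnd F G).mor = l ≫ (pbSnd F G).mor) : k = l := pullback.hom_ext h₁ h₂

/-- The internal functor into the pullback induced by a commutative square. -/
def pbLift {D : InternalCat V} (H : D ⟶ A) (K : D ⟶ B) (h : H ≫ F = K ≫ G) : D ⟶ pb F G :=
  Hom.ofMul (pbObj H.obj K.obj (obj_w h)) (pbMor H.mor K.mor (mor_w h))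
    (by
      apply pbObj_ext
      · rw [Category.assoc, ← (pbFst F G).mor_src, ← Category.assoc, pbMor_fst, Category.assoc,
          pbObj_fst, H.mor_src]
      · rw [Category.assoc, ← (pbSnd F G).mor_src, ← Category.assoc, pbMor_snd, Category.assoc,
          pbObj_snd, K.mor_src])
    (by
      apply pbObj_ext
      · rw [Category.assoc, ← (pbFst F G).mor_tgt, ← Category.assoc, pbMor_fst, Category.assoc,
          pbObj_fst, H.mor_tgt]
      · rw [Category.assoc, ← (pbSnd F G).mor_tgt, ← Category.assoc, pbMor_snd, Category.assoc,
          pbObj_snd, K.mor_tgt])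
    (by
      apply pbMor_ext
      · rw [Category.assoc, pbMor_fst, Category.assoc, (pbFst F G).one_mor, ← Category.assoc,
          pbObj_fst, H.one_mor]
      · rw [Category.assoc, pbMor_snd, Category.assoc, (pbSnd F G).one_mor, ← Category.assoc,
          pbObj_snd, K.one_mor])
    (fun f g h => by
      apply pbMor_ext
      · refine Eq.trans ?_ (Hom.mul_mor _ _ _ _).symm
        simp only [Category.assoc, pbMor_fst]
        exact H.mul_mor f g h
      · refine Eq.trans ?_ (Hom.mul_mor _ _ _ _).symm
        simp only [Category.assoc, pbMor_snd]
        exact K.mul_mor f g h)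

/-- The levelwise pullback is the pullback in the category of internal categories. -/
theorem pb_isPullback : IsPullback (pbFst F G) (pbSnd F G) F G where
  w := hom_ext pullback.condition pullback.condition
  isLimit' := ⟨PullbackCone.IsLimit.mk _ (fun s => pbLift s.fst s.snd s.condition)
    (fun _ => hom_ext (pbObj_fst _ _ _) (pbMor_fst _ _ _))
    (fun _ => hom_ext (pbObj_snd _ _ _) (pbMor_snd _ _ _))
    (fun _ _ h₁ h₂ => hom_ext
      (pbObj_ext ((congrArg Hom.obj h₁).trans (pbObj_fst _ _ _).symm)
        ((congrArg Hom.obj h₂).trans (pbObj_snd _ _ _).symm))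
      (pbMor_ext ((congrArg Hom.mor h₁).trans (pbMor_fst _ _ _).symm)
        ((congrArg Hom.mor h₂).trans (pbMor_snd _ _ _).symm)))⟩

end

/-! #### Finite products of internal categories -/

section
variable [CartesianMonoidalCategory V]

/-- The unique internal functor to the terminal internal category. -/
def toTerminal (A : InternalCat V) : A ⟶ cst (𝟙_ V) :=
  Hom.ofMul (B := cst (𝟙_ V)) (toUnit _) (toUnit _) (toUnit_unique _ _) (toUnit_unique _ _)
    (toUnit_unique _ _) (fun _ _ _ => toUnit_unique _ _)

/-- The product of internal categories, computed levelwise. -/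
abbrev prod (A B : InternalCat V) : InternalCat V :=
  ofMul (A.obj ⊗ B.obj) (A.mor ⊗ B.mor)
    (lift (fst _ _ ≫ A.src) (snd _ _ ≫ B.src)) (lift (fst _ _ ≫ A.tgt) (snd _ _ ≫ B.tgt))
    (lift (fst _ _ ≫ A.one) (snd _ _ ≫ B.one))
    (fun f g h => lift
      (A.mul (f ≫ fst _ _) (g ≫ fst _ _) (by simpa using h =≫ fst _ _))
      (B.mul (f ≫ snd _ _) (g ≫ snd _ _) (by simpa using h =≫ snd _ _)))
    (fun k f g h => by
      apply CartesianMonoidalCategory.hom_ext <;> simp [whisker_mul])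
    (by apply CartesianMonoidalCategory.hom_ext <;> simp [one_src])
    (by apply CartesianMonoidalCategory.hom_ext <;> simp [one_tgt])
    (fun f g h => by apply CartesianMonoidalCategory.hom_ext <;> simp)
    (fun f g h => by apply CartesianMonoidalCategory.hom_ext <;> simp)
    (fun f => by
      apply CartesianMonoidalCategory.hom_ext
      · rw [lift_fst]; apply one_mul; simp
      · rw [lift_snd]; apply one_mul; simp)
    (fun f => by
      apply CartesianMonoidalCategory.hom_ext
      · rw [lift_fst]; apply mul_one; simp
      · rw [lift_snd]; apply mul_one; simp)
    (fun f g h hfg hgh => by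
      apply CartesianMonoidalCategory.hom_ext
      · simp only [lift_fst]; apply mul_assoc
      · simp only [lift_snd]; apply mul_assoc)

/-- The first projection from the product. -/
def prodFst (A B : InternalCat V) : prod A B ⟶ A where
  obj := fst A.obj B.obj
  mor := fst A.mor B.mor
  mor_src := (lift_fst _ _).symm
  mor_tgt := (lift_fst _ _).symm
  one_mor := lift_fst _ _
  comp_mor := lift_fst _ _

/-- The second projection from the product. -/
def prodSnd (A B : InternalCat V) : prod A B ⟶ B where
  obj := snd A.obj B.obj
  mor := snd A.mor B.mor
  mor_src := (lift_snd _ _).symm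
  mor_tgt := (lift_snd _ _).symm
  one_mor := lift_snd _ _
  comp_mor := lift_snd _ _

section
variable {A B : InternalCat V}

/-- Generalized objects of the product. -/
def prodObj {X : V} (a : X ⟶ A.obj) (b : X ⟶ B.obj) : X ⟶ (prod A B).obj := lift a b

/-- Generalized morphisms of the product. -/
def prodMor {X : V} (a : X ⟶ A.mor) (b : X ⟶ B.mor) : X ⟶ (prod A B).mor := lift a b

@[simp] lemma prodObj_fst {X : V} (a : X ⟶ A.obj) (b : X ⟶ B.obj) :
    prodObj a b ≫ (prodFst A B).obj = a := lift_fst _ _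
@[simp] lemma prodObj_snd {X : V} (a : X ⟶ A.obj) (b : X ⟶ B.obj) :
    prodObj a b ≫ (prodSnd A B).obj = b := lift_snd _ _
@[simp] lemma prodMor_fst {X : V} (a : X ⟶ A.mor) (b : X ⟶ B.mor) :
    prodMor a b ≫ (prodFst A B).mor = a := lift_fst _ _
@[simp] lemma prodMor_snd {X : V} (a : X ⟶ A.mor) (b : X ⟶ B.mor) :
    prodMor a b ≫ (prodSnd A B).mor = b := lift_snd _ _

lemma prodObj_ext {X : V} {k l : X ⟶ (prod A B).obj}
    (h₁ : k ≫ (prodFst A B).obj = l ≫ (prodFst A B).obj)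
    (h₂ : k ≫ (prodSnd A B).obj = l ≫ (prodSnd A B).obj) : k = l :=
  CartesianMonoidalCategory.hom_ext _ _ h₁ h₂

lemma prodMor_ext {X : V} {k l : X ⟶ (prod A B).mor}
    (h₁ : k ≫ (prodFst A B).mor = l ≫ (prodFst A B).mor)
    (h₂ : k ≫ (prodSnd A B).mor = l ≫ (prodSnd A B).mor) : k = l :=
  CartesianMonoidalCategory.hom_ext _ _ h₁ h₂

/-- The internal functor into a product with given components. -/
def prodLift {D : InternalCat V} (H : D ⟶ A) (K : D ⟶ B) : D ⟶ prod A B :=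
  Hom.ofMul (prodObj H.obj K.obj) (prodMor H.mor K.mor)
    (by
      apply prodObj_ext
      · rw [Category.assoc, ← (prodFst A B).mor_src, ← Category.assoc, prodMor_fst, Category.assoc,
          prodObj_fst, H.mor_src]
      · rw [Category.assoc, ← (prodSnd A B).mor_src, ← Category.assoc, prodMor_snd, Category.assoc,
          prodObj_snd, K.mor_src])
    (by
      apply prodObj_ext
      · rw [Category.assoc, ← (prodFst A B).mor_tgt, ← Category.assoc, prodMor_fst, Category.assoc,
          prodObj_fst, H.mor_tgt]
      · rw [Category.assoc, ← (prodSnd A B).mor_tgt, ← Category.assoc, prodMor_snd, Category.assoc,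
          prodObj_snd, K.mor_tgt])
    (by
      apply prodMor_ext
      · rw [Category.assoc, prodMor_fst, Category.assoc, (prodFst A B).one_mor, ← Category.assoc,
          prodObj_fst, H.one_mor]
      · rw [Category.assoc, prodMor_snd, Category.assoc, (prodSnd A B).one_mor, ← Category.assoc,
          prodObj_snd, K.one_mor])
    (fun f g h => by
      apply prodMor_ext
      · refine Eq.trans ?_ (Hom.mul_mor _ _ _ _).symm
        simp only [Category.assoc, prodMor_fst]
        exact H.mul_mor f g h
      · refine Eq.trans ?_ (Hom.mul_mor _ _ _ _).symm
        simp only [Category.assoc, prodMor_snd]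
        exact K.mul_mor f g h)

lemma prodLift_obj {D : InternalCat V} (H : D ⟶ A) (K : D ⟶ B) :
    (prodLift H K).obj = prodObj H.obj K.obj := rfl
lemma prodLift_mor {D : InternalCat V} (H : D ⟶ A) (K : D ⟶ B) :
    (prodLift H K).mor = prodMor H.mor K.mor := rfl

@[simp] lemma prodLift_fst {D : InternalCat V} (H : D ⟶ A) (K : D ⟶ B) :
    prodLift H K ≫ prodFst A B = H := hom_ext (prodObj_fst _ _) (prodMor_fst _ _)
@[simp] lemma prodLift_snd {D : InternalCat V} (H : D ⟶ A) (K : D ⟶ B) :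
    prodLift H K ≫ prodSnd A B = K := hom_ext (prodObj_snd _ _) (prodMor_snd _ _)

lemma prod_hom_ext {D : InternalCat V} {H K : D ⟶ prod A B}
    (h₁ : H ≫ prodFst A B = K ≫ prodFst A B) (h₂ : H ≫ prodSnd A B = K ≫ prodSnd A B) : H = K :=
  hom_ext (prodObj_ext (obj_w h₁) (obj_w h₂)) (prodMor_ext (mor_w h₁) (mor_w h₂))

end

end

/-! #### The internal category of arrows -/

section Arr
variable (A : InternalCat V)

/-- The object of commutative squares in `A`. A commutative square
```
a  --p--> b
|u        |v
a' --q--> b'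
```
is a pair of composable pairs `((u, q), (p, v))` with equal composites. -/
abbrev sq : V := pullback A.comp A.comp

def sqU : A.sq ⟶ A.mor := pullback.fst A.comp A.comp ≫ pullback.fst A.tgt A.src
def sqQ : A.sq ⟶ A.mor := pullback.fst A.comp A.comp ≫ pullback.snd A.tgt A.src
def sqP : A.sq ⟶ A.mor := pullback.snd A.comp A.comp ≫ pullback.fst A.tgt A.src
def sqV : A.sq ⟶ A.mor := pullback.snd A.comp A.comp ≫ pullback.snd A.tgt A.src

lemma sq_uq : A.sqU ≫ A.tgt = A.sqQ ≫ A.src := by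
  simp only [sqU, sqQ, Category.assoc, pullback.condition]
lemma sq_pv : A.sqP ≫ A.tgt = A.sqV ≫ A.src := by
  simp only [sqP, sqV, Category.assoc, pullback.condition]
lemma sq_comm : A.mul A.sqU A.sqQ A.sq_uq = A.mul A.sqP A.sqV A.sq_pv := by
  have h₁ : A.mul A.sqU A.sqQ A.sq_uq = pullback.fst A.comp A.comp ≫ A.comp := by
    rw [mul]; congr 1; apply pullback.hom_ext <;> simp [sqU, sqQ]
  have h₂ : A.mul A.sqP A.sqV A.sq_pv = pullback.snd A.comp A.comp ≫ A.comp := by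
    rw [mul]; congr 1; apply pullback.hom_ext <;> simp [sqP, sqV]
  rw [h₁, h₂, pullback.condition]

variable {A}

/-- Generalized commutative squares. -/
def mkSq {X : V} (u q p v : X ⟶ A.mor) (h₁ : u ≫ A.tgt = q ≫ A.src) (h₂ : p ≫ A.tgt = v ≫ A.src)
    (h : A.mul u q h₁ = A.mul p v h₂) : X ⟶ A.sq :=
  pullback.lift (pullback.lift u q h₁) (pullback.lift p v h₂) h

section
variable {X : V} (u q p v : X ⟶ A.mor) (h₁ : u ≫ A.tgt = q ≫ A.src) (h₂ : p ≫ A.tgt = v ≫ A.src)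
    (h : A.mul u q h₁ = A.mul p v h₂)

@[simp] lemma mkSq_u : mkSq u q p v h₁ h₂ h ≫ A.sqU = u :=
  (Category.assoc _ _ _).symm.trans ((congrArg (fun t => t ≫ pullback.fst A.tgt A.src)
    (pullback.lift_fst _ _ h)).trans (pullback.lift_fst _ _ _))
@[simp] lemma mkSq_q : mkSq u q p v h₁ h₂ h ≫ A.sqQ = q :=
  (Category.assoc _ _ _).symm.trans ((congrArg (fun t => t ≫ pullback.snd A.tgt A.src)
    (pullback.lift_fst _ _ h)).trans (pullback.lift_snd _ _ _))
@[simp] lemma mkSq_p : mkSq u q p v h₁ h₂ h ≫ A.sqP = p :=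
  (Category.assoc _ _ _).symm.trans ((congrArg (fun t => t ≫ pullback.fst A.tgt A.src)
    (pullback.lift_snd _ _ h)).trans (pullback.lift_fst _ _ _))
@[simp] lemma mkSq_v : mkSq u q p v h₁ h₂ h ≫ A.sqV = v :=
  (Category.assoc _ _ _).symm.trans ((congrArg (fun t => t ≫ pullback.snd A.tgt A.src)
    (pullback.lift_snd _ _ h)).trans (pullback.lift_snd _ _ _))
end

lemma sq_ext {X : V} {k l : X ⟶ A.sq} (hu : k ≫ A.sqU = l ≫ A.sqU) (hq : k ≫ A.sqQ = l ≫ A.sqQ)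
    (hp : k ≫ A.sqP = l ≫ A.sqP) (hv : k ≫ A.sqV = l ≫ A.sqV) : k = l := by
  apply pullback.hom_ext <;> apply pullback.hom_ext <;> simpa

lemma sq_uq' {X : V} (k : X ⟶ A.sq) : (k ≫ A.sqU) ≫ A.tgt = (k ≫ A.sqQ) ≫ A.src := by
  simp [sq_uq]
lemma sq_pv' {X : V} (k : X ⟶ A.sq) : (k ≫ A.sqP) ≫ A.tgt = (k ≫ A.sqV) ≫ A.src := by
  simp [sq_pv]
lemma sq_comm' {X : V} (k : X ⟶ A.sq) :
    A.mul (k ≫ A.sqU) (k ≫ A.sqQ) (sq_uq' k) = A.mul (k ≫ A.sqP) (k ≫ A.sqV) (sq_pv' k) := by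
  rw [← A.whisker_mul k _ _ A.sq_uq, ← A.whisker_mul k _ _ A.sq_pv, A.sq_comm]

lemma sq_us {X : V} (k : X ⟶ A.sq) : (k ≫ A.sqU) ≫ A.src = (k ≫ A.sqP) ≫ A.src := by
  simpa using sq_comm' k =≫ A.src
lemma sq_qt {X : V} (k : X ⟶ A.sq) : (k ≫ A.sqQ) ≫ A.tgt = (k ≫ A.sqV) ≫ A.tgt := by
  simpa using sq_comm' k =≫ A.tgt

lemma paste {X : V} {u₁ q₁ p₁ v₁ u₂ q₂ v₂ : X ⟶ A.mor}
    (huq₁ : u₁ ≫ A.tgt = q₁ ≫ A.src) (hpv₁ : p₁ ≫ A.tgt = v₁ ≫ A.src)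
    (huq₂ : u₂ ≫ A.tgt = q₂ ≫ A.src) (hpv₂ : q₁ ≫ A.tgt = v₂ ≫ A.src)
    (h₁ : A.mul u₁ q₁ huq₁ = A.mul p₁ v₁ hpv₁) (h₂ : A.mul u₂ q₂ huq₂ = A.mul q₁ v₂ hpv₂)
    (hu : u₁ ≫ A.tgt = u₂ ≫ A.src) (hv : v₁ ≫ A.tgt = v₂ ≫ A.src) :
    A.mul (A.mul u₁ u₂ hu) q₂ (by rw [mul_tgt, huq₂]) =
      A.mul p₁ (A.mul v₁ v₂ hv) (by rw [mul_src, hpv₁]) := by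
  have e₁ := A.mul_assoc u₁ u₂ q₂ hu huq₂ (by rw [mul_tgt, huq₂]) (by rw [mul_src, hu])
  have e₂ := A.mul_congr (rfl : u₁ = u₁) h₂ (by rw [mul_src, hu])
  have e₃ := A.mul_assoc u₁ q₁ v₂ huq₁ hpv₂ (by rw [mul_tgt, hpv₂]) (by rw [mul_src, huq₁])
  have e₄ := A.mul_congr h₁ (rfl : v₂ = v₂) (by rw [mul_tgt, hpv₂])
  have e₅ := A.mul_assoc p₁ v₁ v₂ hpv₁ hv (by rw [mul_tgt, hv]) (by rw [mul_src, hpv₁])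
  rw [e₁, e₂, ← e₃, e₄, e₅]

variable (A)

/-- The internal category of arrows of `A`: its objects are the morphisms of `A`, and its morphisms
`p ⟶ q` are the commutative squares from `p` to `q`. It is the internal hom from the free-living
arrow to `A`. -/
abbrev arr : InternalCat V :=
  ofMul A.mor A.sq A.sqP A.sqQ
    (mkSq (A.src ≫ A.one) (𝟙 _) (𝟙 _) (A.tgt ≫ A.one)
      (by simp [A.one_tgt]) (by simp [A.one_src])
      (by rw [A.one_mul _ _ (by simp), A.mul_one _ _ (by simp)]))
    (fun f g h => mkSq
      (A.mul (f ≫ A.sqU) (g ≫ A.sqU) (by rw [sq_uq', h, sq_us]))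
      (g ≫ A.sqQ) (f ≫ A.sqP)
      (A.mul (f ≫ A.sqV) (g ≫ A.sqV) (by rw [← sq_qt, h, sq_pv']))
      (by rw [mul_tgt, sq_uq']) (by rw [mul_src, sq_pv'])
      (paste (sq_uq' f) (sq_pv' f) (sq_uq' g) (by rw [h, sq_pv']) (sq_comm' f)
        (by rw [sq_comm' g]; exact A.mul_congr h.symm rfl _) _ _))
    (fun k f g h => by apply sq_ext <;> simp [whisker_mul])
    (by simp)
    (by simp)
    (fun f g h => by simp)
    (fun f g h => by simp)
    (fun f => by
      apply sq_ext
      · rw [mkSq_u]; apply one_mul; simpa using (sq_us f =≫ A.one).symm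
      · simp
      · simp
      · rw [mkSq_v]; apply one_mul; simpa using (sq_pv' f =≫ A.one))
    (fun f => by
      apply sq_ext
      · rw [mkSq_u]; apply mul_one; simpa using (sq_uq' f =≫ A.one).symm
      · simp
      · simp
      · rw [mkSq_v]; apply mul_one; simpa using (sq_qt f =≫ A.one))
    (fun f g h hfg hgh => by
      apply sq_ext
      · simp only [mkSq_u]; apply mul_assoc
      · simp
      · simp
      · simp only [mkSq_v]; apply mul_assoc)

lemma arr_mul {X : V} (f g : X ⟶ A.arr.mor) (h : f ≫ A.arr.tgt = g ≫ A.arr.src) :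
    A.arr.mul f g h = mkSq
      (A.mul (f ≫ A.sqU) (g ≫ A.sqU) (by rw [sq_uq', sq_us]; exact h =≫ A.src))
      (g ≫ A.sqQ) (f ≫ A.sqP)
      (A.mul (f ≫ A.sqV) (g ≫ A.sqV) (by rw [← sq_qt, ← sq_pv']; exact h =≫ A.tgt))
      (by rw [mul_tgt, sq_uq']) (by rw [mul_src, sq_pv'])
      (paste (sq_uq' f) (sq_pv' f) (sq_uq' g)
        (by rw [← sq_pv']; exact h =≫ A.tgt) (sq_comm' f)
        (by rw [sq_comm' g]; exact A.mul_congr h.symm rfl _) _ _) :=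
  A.arr.mul_eq (fun f g h => mkSq
      (A.mul (f ≫ A.sqU) (g ≫ A.sqU) (by rw [sq_uq', sq_us]; exact h =≫ A.src))
      (g ≫ A.sqQ) (f ≫ A.sqP)
      (A.mul (f ≫ A.sqV) (g ≫ A.sqV) (by rw [← sq_qt, ← sq_pv']; exact h =≫ A.tgt))
      (by rw [mul_tgt, sq_uq']) (by rw [mul_src, sq_pv'])
      (paste (sq_uq' f) (sq_pv' f) (sq_uq' g)
        (by rw [← sq_pv']; exact h =≫ A.tgt) (sq_comm' f)
        (by rw [sq_comm' g]; exact A.mul_congr h.symm rfl _) _ _))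
    (fun k f g h => by apply sq_ext <;> simp [whisker_mul]) rfl f g h

end Arr

/-! #### Internal natural transformations -/

section
variable (A : InternalCat V)

/-- The domain functor. -/
def arrDom : A.arr ⟶ A :=
  Hom.ofMul (A := A.arr) A.src A.sqU (by simpa using sq_us (𝟙 A.sq)) A.sq_uq (mkSq_u _ _ _ _ _ _ _)
    (fun f g h => by rw [arr_mul]; exact mkSq_u _ _ _ _ _ _ _)

/-- The codomain functor. -/
def arrCod : A.arr ⟶ A :=
  Hom.ofMul (A := A.arr) A.tgt A.sqV A.sq_pv.symm (by simpa using (sq_qt (𝟙 A.sq)).symm)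
    (mkSq_v _ _ _ _ _ _ _)
    (fun f g h => by rw [arr_mul]; exact mkSq_v _ _ _ _ _ _ _)

variable {A} {J : InternalCat V}

/-- The internal functor to the category of arrows given by an internal natural transformation
with component map `t`. -/
def mkArr (H K : J ⟶ A) (t : J.obj ⟶ A.mor) (hs : t ≫ A.src = H.obj) (ht : t ≫ A.tgt = K.obj)
    (nat : A.mul H.mor (J.tgt ≫ t) (by rw [Category.assoc, hs, H.mor_tgt]) =
      A.mul (J.src ≫ t) K.mor (by rw [Category.assoc, ht, K.mor_src])) : J ⟶ A.arr :=
  Hom.ofMul (B := A.arr) t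
    (mkSq H.mor (J.tgt ≫ t) (J.src ≫ t) K.mor (by rw [Category.assoc, hs, H.mor_tgt])
      (by rw [Category.assoc, ht, K.mor_src]) nat)
    (mkSq_p _ _ _ _ _ _ _) (mkSq_q _ _ _ _ _ _ _)
    (by
      apply sq_ext
      · simp [H.one_mor, ← hs]
      · simp [reassoc_of% J.one_tgt]
      · simp [reassoc_of% J.one_src]
      · simp [K.one_mor, ← ht])
    (fun f g h => by
      rw [arr_mul]
      apply sq_ext
      · simp [Hom.mul_mor]
      · simp only [Category.assoc, mkSq_q, ← Category.assoc (J.mul f g h), mul_tgt]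
      · simp only [Category.assoc, mkSq_p, ← Category.assoc (J.mul f g h), mul_src]
      · simp [Hom.mul_mor])

section
variable (H K : J ⟶ A) (t : J.obj ⟶ A.mor) (hs : t ≫ A.src = H.obj) (ht : t ≫ A.tgt = K.obj)
    (nat : A.mul H.mor (J.tgt ≫ t) (by rw [Category.assoc, hs, H.mor_tgt]) =
      A.mul (J.src ≫ t) K.mor (by rw [Category.assoc, ht, K.mor_src]))

lemma mkArr_obj : (mkArr H K t hs ht nat).obj = t := rfl
lemma mkArr_dom : mkArr H K t hs ht nat ≫ A.arrDom = H := hom_ext hs (mkSq_u _ _ _ _ _ _ _)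
lemma mkArr_cod : mkArr H K t hs ht nat ≫ A.arrCod = K := hom_ext ht (mkSq_v _ _ _ _ _ _ _)
end

lemma arr_ext {S T : J ⟶ A.arr} (h₀ : S.obj = T.obj) (hd : S ≫ A.arrDom = T ≫ A.arrDom)
    (hc : S ≫ A.arrCod = T ≫ A.arrCod) : S = T := by
  apply hom_ext h₀
  apply sq_ext
  · exact mor_w hd
  · exact S.mor_tgt.trans ((congrArg (fun t => J.tgt ≫ t) h₀).trans T.mor_tgt.symm)
  · exact S.mor_src.trans ((congrArg (fun t => J.src ≫ t) h₀).trans T.mor_src.symm)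
  · exact mor_w hc

lemma arr_nat (S : J ⟶ A.arr) {a b : J.mor ⟶ A.mor} (ha : J.tgt ≫ S.obj = a)
    (hb : J.src ≫ S.obj = b) (h₁ : (S ≫ A.arrDom).mor ≫ A.tgt = a ≫ A.src)
    (h₂ : b ≫ A.tgt = (S ≫ A.arrCod).mor ≫ A.src) :
    A.mul (S ≫ A.arrDom).mor a h₁ = A.mul b (S ≫ A.arrCod).mor h₂ := by
  have e₁ : S.mor ≫ A.sqQ = a := S.mor_tgt.trans ha
  have e₂ : S.mor ≫ A.sqP = b := S.mor_src.trans hb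
  subst e₁ e₂
  exact sq_comm' S.mor

variable (A) in
/-- The identity natural transformation of the identity functor. -/
def arrRefl : A ⟶ A.arr :=
  mkArr (𝟙 A) (𝟙 A) A.one A.one_src A.one_tgt
    ((A.mul_one _ _ (by simp) _).trans (A.one_mul _ _ (by simp) _).symm)

@[simp] lemma arrRefl_dom : A.arrRefl ≫ A.arrDom = 𝟙 A := mkArr_dom _ _ _ _ _ _
@[simp] lemma arrRefl_cod : A.arrRefl ≫ A.arrCod = 𝟙 A := mkArr_cod _ _ _ _ _ _

lemma vcomp_compat {S T : J ⟶ A.arr} (h : S ≫ A.arrCod = T ≫ A.arrDom) :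
    S.obj ≫ A.tgt = T.obj ≫ A.src := obj_w h

/-- The vertical composite of two internal natural transformations. -/
def vcomp (S T : J ⟶ A.arr) (h : S ≫ A.arrCod = T ≫ A.arrDom) : J ⟶ A.arr :=
  mkArr (S ≫ A.arrDom) (T ≫ A.arrCod) (A.mul S.obj T.obj (vcomp_compat h))
    (A.mul_src _ _ _) (A.mul_tgt _ _ _) (by
      have hS := arr_nat S rfl rfl
        (by rw [(S ≫ A.arrDom).mor_tgt]; exact (Category.assoc _ _ _).symm)
        (by rw [(S ≫ A.arrCod).mor_src]; exact (Category.assoc _ _ _))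
      have hT := arr_nat T rfl rfl
        (by rw [(T ≫ A.arrDom).mor_tgt]; exact (Category.assoc _ _ _).symm)
        (by rw [(T ≫ A.arrCod).mor_src]; exact (Category.assoc _ _ _))
      have c : S.obj ≫ A.tgt = T.obj ≫ A.src := vcomp_compat h
      have w₁ := A.whisker_mul J.tgt S.obj T.obj c
      have w₂ := A.whisker_mul J.src S.obj T.obj c
      refine (A.mul_congr rfl w₁ _).trans (Eq.trans ?_ (A.mul_congr w₂ rfl _).symm)
      rw [← A.mul_assoc (S ≫ A.arrDom).mor (J.tgt ≫ S.obj) (J.tgt ≫ T.obj)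
        (by rw [(S ≫ A.arrDom).mor_tgt]; exact (Category.assoc _ _ _).symm)
        (by simp only [Category.assoc, c])]
      · rw [A.mul_congr hS rfl, A.mul_assoc _ _ _ _ (by
            rw [h, (T ≫ A.arrDom).mor_tgt]; exact (Category.assoc _ _ _).symm)]
        · rw [A.mul_congr rfl ((A.mul_congr (congrArg Hom.mor h) rfl _).trans hT)]
          symm
          apply A.mul_assoc
        · rw [mul_src, (S ≫ A.arrCod).mor_src]; exact Category.assoc _ _ _
      · simp [c])

section
variable {S T : J ⟶ A.arr} (h : S ≫ A.arrCod = T ≫ A.arrDom)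

lemma vcomp_obj : (vcomp S T h).obj = A.mul S.obj T.obj (vcomp_compat h) := rfl
@[simp] lemma vcomp_dom : vcomp S T h ≫ A.arrDom = S ≫ A.arrDom := mkArr_dom _ _ _ _ _ _
@[simp] lemma vcomp_cod : vcomp S T h ≫ A.arrCod = T ≫ A.arrCod := mkArr_cod _ _ _ _ _ _

lemma whisker_vcomp {K : InternalCat V} (P : K ⟶ J) :
    P ≫ vcomp S T h = vcomp (P ≫ S) (P ≫ T) (by simp only [Category.assoc, h]) :=
  arr_ext (A.whisker_mul _ _ _ _) (by simp) (by simp)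

end

lemma vcomp_congr {S T S' T' : J ⟶ A.arr} (hS : S = S') (hT : T = T')
    (h : S ≫ A.arrCod = T ≫ A.arrDom) :
    vcomp S T h = vcomp S' T' (by rw [← hS, ← hT, h]) := by
  subst hS hT; rfl

lemma refl_vcomp (E T : J ⟶ A.arr) (hE : E = (T ≫ A.arrDom) ≫ A.arrRefl)
    (h : E ≫ A.arrCod = T ≫ A.arrDom) : vcomp E T h = T := by
  subst hE
  exact arr_ext (A.one_mul _ _ (Category.assoc _ _ _) _) (by simp) (by simp)

lemma vcomp_refl (S E : J ⟶ A.arr) (hE : E = (S ≫ A.arrCod) ≫ A.arrRefl)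
    (h : S ≫ A.arrCod = E ≫ A.arrDom) : vcomp S E h = S := by
  subst hE
  exact arr_ext (A.mul_one _ _ (Category.assoc _ _ _) _) (by simp) (by simp)

lemma vcomp_assoc (S T U : J ⟶ A.arr) (hST : S ≫ A.arrCod = T ≫ A.arrDom)
    (hTU : T ≫ A.arrCod = U ≫ A.arrDom) :
    vcomp (vcomp S T hST) U (by rw [vcomp_cod, hTU]) =
      vcomp S (vcomp T U hTU) (by rw [vcomp_dom, hST]) :=
  arr_ext (A.mul_assoc _ _ _ (vcomp_compat hST) (vcomp_compat hTU) _ _) (by simp) (by simp)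

end

/-! #### The internal hom -/

lemma cst_mul {X Y : V} (f g : Y ⟶ X) (h : f ≫ (cst X).tgt = g ≫ (cst X).src) :
    (cst X).mul f g h = f :=
  (cst X).mul_eq (fun f _ _ => f) (fun _ _ _ _ => rfl) rfl f g h

section
variable [CartesianMonoidalCategory V]

lemma prod_mul (A B : InternalCat V) {X : V} (f g : X ⟶ (prod A B).mor)
    (h : f ≫ (prod A B).tgt = g ≫ (prod A B).src) :
    (prod A B).mul f g h = lift
      (A.mul (f ≫ fst _ _) (g ≫ fst _ _) (by simpa using h =≫ fst _ _))
      (B.mul (f ≫ snd _ _) (g ≫ snd _ _) (by simpa using h =≫ snd _ _)) :=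
  (prod A B).mul_eq (fun f g h => lift
      (A.mul (f ≫ fst _ _) (g ≫ fst _ _) (by simpa using h =≫ fst _ _))
      (B.mul (f ≫ snd _ _) (g ≫ snd _ _) (by simpa using h =≫ snd _ _)))
    (fun k f g h => by apply CartesianMonoidalCategory.hom_ext <;> simp [whisker_mul]) rfl f g h

/-- Change of parameters for families of internal functors. -/
def baseMap (I : InternalCat V) {X Y : V} (k : X ⟶ Y) : prod I (cst X) ⟶ prod I (cst Y) :=
  prodLift (prodFst _ _) (prodSnd _ _ ≫ cstMap k)

variable (I : InternalCat V) {X Y Z : V}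

lemma baseMap_obj (k : X ⟶ Y) : (baseMap I k).obj = I.obj ◁ k := by
  apply CartesianMonoidalCategory.hom_ext
  · rw [whiskerLeft_fst]; exact lift_fst _ _
  · rw [whiskerLeft_snd]; exact lift_snd _ _

lemma baseMap_mor (k : X ⟶ Y) : (baseMap I k).mor = I.mor ◁ k := by
  apply CartesianMonoidalCategory.hom_ext
  · rw [whiskerLeft_fst]; exact lift_fst _ _
  · rw [whiskerLeft_snd]
    refine (lift_snd _ _).trans ?_
    exact congrArg (fun t => snd I.mor X ≫ t) (cstMap_mor k)

@[simp] lemma baseMap_fst (k : X ⟶ Y) : baseMap I k ≫ prodFst _ _ = prodFst _ _ :=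
  prodLift_fst _ _

lemma baseMap_comp (k : X ⟶ Y) (l : Y ⟶ Z) : baseMap I (k ≫ l) = baseMap I k ≫ baseMap I l := by
  apply hom_ext
  · rw [comp_obj, baseMap_obj, baseMap_obj, baseMap_obj, MonoidalCategory.whiskerLeft_comp]
  · rw [comp_mor, baseMap_mor, baseMap_mor, baseMap_mor, MonoidalCategory.whiskerLeft_comp]

variable {I} {A : InternalCat V}

lemma prod_cst_src : (prod I (cst X)).src = I.src ▷ X := by
  apply CartesianMonoidalCategory.hom_ext
  · rw [whiskerRight_fst]; exact lift_fst _ _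
  · rw [whiskerRight_snd]; exact (lift_snd _ _).trans (Category.comp_id _)

lemma prod_cst_tgt : (prod I (cst X)).tgt = I.tgt ▷ X := by
  apply CartesianMonoidalCategory.hom_ext
  · rw [whiskerRight_fst]; exact lift_fst _ _
  · rw [whiskerRight_snd]; exact (lift_snd _ _).trans (Category.comp_id _)

lemma prod_cst_one : (prod I (cst X)).one = I.one ▷ X := by
  apply CartesianMonoidalCategory.hom_ext
  · rw [whiskerRight_fst]; exact lift_fst _ _
  · rw [whiskerRight_snd]; exact (lift_snd _ _).trans (Category.comp_id _)

lemma fam_compat {h₀ : I.obj ⊗ X ⟶ A.obj} {h₁ : I.mor ⊗ X ⟶ A.mor}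
    (hs : h₁ ≫ A.src = I.src ▷ X ≫ h₀) (ht : h₁ ≫ A.tgt = I.tgt ▷ X ≫ h₀) :
    (pullback.fst I.tgt I.src ▷ X ≫ h₁) ≫ A.tgt = (pullback.snd I.tgt I.src ▷ X ≫ h₁) ≫ A.src := by
  rw [Category.assoc, Category.assoc, hs, ht, ← comp_whiskerRight_assoc, pullback.condition,
    comp_whiskerRight_assoc]

lemma prod_cst_mul {Y : V} (f g : Y ⟶ (prod I (cst X)).mor)
    (h : f ≫ (prod I (cst X)).tgt = g ≫ (prod I (cst X)).src) :
    ∃ p : Y ⟶ pullback I.tgt I.src ⊗ X, f = p ≫ pullback.fst I.tgt I.src ▷ X ∧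
      g = p ≫ pullback.snd I.tgt I.src ▷ X ∧ (prod I (cst X)).mul f g h = p ≫ I.comp ▷ X := by
  have e₁ : (f ≫ fst _ _) ≫ I.tgt = (g ≫ fst _ _) ≫ I.src := by simpa using h =≫ fst _ _
  have e₂ : f ≫ snd _ _ = g ≫ snd _ _ := by simpa using h =≫ snd _ _
  refine ⟨lift (pullback.lift _ _ e₁) (f ≫ snd _ _), ?_, ?_, ?_⟩
  · apply CartesianMonoidalCategory.hom_ext <;> simp
  · apply CartesianMonoidalCategory.hom_ext <;> simp [e₂]
  · rw [prod_mul]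
    apply CartesianMonoidalCategory.hom_ext
    · simp [mul]
    · simp only [lift_snd, lift_whiskerRight]
      exact cst_mul _ _ _

/-- Families of internal functors from their underlying maps. -/
def famMk (h₀ : I.obj ⊗ X ⟶ A.obj) (h₁ : I.mor ⊗ X ⟶ A.mor)
    (hs : h₁ ≫ A.src = I.src ▷ X ≫ h₀) (ht : h₁ ≫ A.tgt = I.tgt ▷ X ≫ h₀)
    (ho : I.one ▷ X ≫ h₁ = h₀ ≫ A.one)
    (hm : I.comp ▷ X ≫ h₁ = A.mul (pullback.fst I.tgt I.src ▷ X ≫ h₁)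
      (pullback.snd I.tgt I.src ▷ X ≫ h₁) (fam_compat hs ht)) : prod I (cst X) ⟶ A :=
  Hom.ofMul (A := prod I (cst X)) h₀ h₁ (by rw [prod_cst_src, hs]) (by rw [prod_cst_tgt, ht])
    (by rw [prod_cst_one, ho]) (fun f g h => by
      obtain ⟨p, hf, hg, hp⟩ := prod_cst_mul f g h
      refine (congrArg (fun t => t ≫ h₁) hp).trans ?_
      rw [Category.assoc, hm, whisker_mul]
      exact A.mul_congr (by rw [hf, Category.assoc]) (by rw [hg, Category.assoc]) _)

lemma fam_src (H : prod I (cst X) ⟶ A) : H.mor ≫ A.src = I.src ▷ X ≫ H.obj := by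
  rw [H.mor_src, prod_cst_src]
lemma fam_tgt (H : prod I (cst X) ⟶ A) : H.mor ≫ A.tgt = I.tgt ▷ X ≫ H.obj := by
  rw [H.mor_tgt, prod_cst_tgt]
lemma fam_one (H : prod I (cst X) ⟶ A) : I.one ▷ X ≫ H.mor = H.obj ≫ A.one := by
  rw [← H.one_mor, prod_cst_one]
lemma fam_comp (H : prod I (cst X) ⟶ A) : I.comp ▷ X ≫ H.mor =
    A.mul (pullback.fst I.tgt I.src ▷ X ≫ H.mor) (pullback.snd I.tgt I.src ▷ X ≫ H.mor)
      (fam_compat (fam_src H) (fam_tgt H)) := by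
  have h : (pullback.fst I.tgt I.src ▷ X) ≫ (prod I (cst X)).tgt =
      (pullback.snd I.tgt I.src ▷ X) ≫ (prod I (cst X)).src := by
    rw [prod_cst_src, prod_cst_tgt, ← comp_whiskerRight, pullback.condition, comp_whiskerRight]
  have e := H.mul_mor _ _ h
  rw [← e, prod_mul]
  congr 1
  apply CartesianMonoidalCategory.hom_ext
  · rw [whiskerRight_fst, lift_fst, mul]
    congr 1
    apply pullback.hom_ext <;> simp
  · rw [whiskerRight_snd, lift_snd, cst_mul, whiskerRight_snd]

variable (V) in
lemma hasEqualizers : HasEqualizers V := hasEqualizers_of_hasPullbacks_and_binary_products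

variable [MonoidalClosed V]

lemma exists_locus {B P Z : V} (f g : B ⊗ P ⟶ Z) : ∃ (E : V) (e : E ⟶ P),
    Mono e ∧ B ◁ e ≫ f = B ◁ e ≫ g ∧
      ∀ {X : V} (k : X ⟶ P), B ◁ k ≫ f = B ◁ k ≫ g → ∃ l, l ≫ e = k := by
  have := hasEqualizers V
  refine ⟨equalizer (MonoidalClosed.curry f) (MonoidalClosed.curry g), equalizer.ι _ _,
    inferInstance, ?_, fun k hk => ⟨equalizer.lift k ?_, equalizer.lift_ι _ _⟩⟩
  · apply MonoidalClosed.curry_injective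
    rw [MonoidalClosed.curry_natural_left, MonoidalClosed.curry_natural_left, equalizer.condition]
  · rw [← MonoidalClosed.curry_natural_left, ← MonoidalClosed.curry_natural_left, hk]

variable (I A) in
/-- The functor sending `X` to the set of families of internal functors `I ⟶ A` indexed by `X` is
representable. -/
theorem exists_funObj : ∃ (R : V) (U : prod I (cst R) ⟶ A),
    ∀ {X : V} (H : prod I (cst X) ⟶ A), ∃! k : X ⟶ R, baseMap I k ≫ U = H := by
  let P : V := (I.obj ⟶[V] A.obj) ⊗ (I.mor ⟶[V] A.mor)
  let p₀ : I.obj ⊗ P ⟶ A.obj := MonoidalClosed.uncurry (fst _ _)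
  let p₁ : I.mor ⊗ P ⟶ A.mor := MonoidalClosed.uncurry (snd _ _)
  have hP {X : V} (h₀ : I.obj ⊗ X ⟶ A.obj) (h₁ : I.mor ⊗ X ⟶ A.mor) :
      ∃ k : X ⟶ P, I.obj ◁ k ≫ p₀ = h₀ ∧ I.mor ◁ k ≫ p₁ = h₁ := by
    refine ⟨lift (MonoidalClosed.curry h₀) (MonoidalClosed.curry h₁), ?_, ?_⟩
    · rw [← MonoidalClosed.uncurry_natural_left, lift_fst, MonoidalClosed.uncurry_curry]
    · rw [← MonoidalClosed.uncurry_natural_left, lift_snd, MonoidalClosed.uncurry_curry]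
  have hP' {X : V} (k l : X ⟶ P) (e₀ : I.obj ◁ k ≫ p₀ = I.obj ◁ l ≫ p₀)
      (e₁ : I.mor ◁ k ≫ p₁ = I.mor ◁ l ≫ p₁) : k = l := by
    rw [← MonoidalClosed.uncurry_natural_left, ← MonoidalClosed.uncurry_natural_left] at e₀ e₁
    exact CartesianMonoidalCategory.hom_ext _ _ (MonoidalClosed.uncurry_injective e₀)
      (MonoidalClosed.uncurry_injective e₁)
  obtain ⟨E₁, e₁, m₁, h₁, u₁⟩ := exists_locus (p₁ ≫ A.src) (I.src ▷ P ≫ p₀)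
  obtain ⟨E₂, e₂, m₂, h₂, u₂⟩ := exists_locus (I.mor ◁ e₁ ≫ p₁ ≫ A.tgt)
    (I.mor ◁ e₁ ≫ I.tgt ▷ P ≫ p₀)
  obtain ⟨E₃, e₃, m₃, h₃, u₃⟩ := exists_locus (I.obj ◁ (e₂ ≫ e₁) ≫ I.one ▷ P ≫ p₁)
    (I.obj ◁ (e₂ ≫ e₁) ≫ p₀ ≫ A.one)
  let i : E₃ ⟶ P := e₃ ≫ e₂ ≫ e₁
  have hs : (I.mor ◁ i ≫ p₁) ≫ A.src = I.src ▷ E₃ ≫ I.obj ◁ i ≫ p₀ := by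
    simp only [← whisker_exchange_assoc, i, MonoidalCategory.whiskerLeft_comp, Category.assoc, h₁]
  have ht : (I.mor ◁ i ≫ p₁) ≫ A.tgt = I.tgt ▷ E₃ ≫ I.obj ◁ i ≫ p₀ := by
    simp only [← whisker_exchange_assoc, i, MonoidalCategory.whiskerLeft_comp, Category.assoc, h₂]
  have ho : I.one ▷ E₃ ≫ I.mor ◁ i ≫ p₁ = (I.obj ◁ i ≫ p₀) ≫ A.one := by
    rw [← whisker_exchange_assoc]
    simpa [i] using h₃
  obtain ⟨E₄, e₄, m₄, h₄, u₄⟩ := exists_locus (I.comp ▷ E₃ ≫ I.mor ◁ i ≫ p₁)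
    (A.mul (pullback.fst I.tgt I.src ▷ E₃ ≫ I.mor ◁ i ≫ p₁)
      (pullback.snd I.tgt I.src ▷ E₃ ≫ I.mor ◁ i ≫ p₁) (fam_compat hs ht))
  refine ⟨E₄, famMk (I.obj ◁ e₄ ≫ I.obj ◁ i ≫ p₀) (I.mor ◁ e₄ ≫ I.mor ◁ i ≫ p₁) ?_ ?_ ?_ ?_,
    fun {X} H => ?_⟩
  · rw [Category.assoc, hs, whisker_exchange_assoc]
  · rw [Category.assoc, ht, whisker_exchange_assoc]
  · rw [← whisker_exchange_assoc, ho]; simp only [Category.assoc]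
  · rw [← whisker_exchange_assoc, h₄, whisker_mul]
    apply A.mul_congr <;> rw [whisker_exchange_assoc]
  · obtain ⟨k, hk₀, hk₁⟩ := hP H.obj H.mor
    obtain ⟨k₁, rfl⟩ := u₁ k (by
      rw [← Category.assoc, hk₁, fam_src, whisker_exchange_assoc, hk₀])
    obtain ⟨k₂, rfl⟩ := u₂ k₁ (by
      simp only [← MonoidalCategory.whiskerLeft_comp_assoc]
      rw [← Category.assoc, hk₁, fam_tgt, whisker_exchange_assoc, hk₀])
    obtain ⟨k₃, rfl⟩ := u₃ k₂ (by
      rw [Category.assoc] at hk₀ hk₁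
      rw [← MonoidalCategory.whiskerLeft_comp_assoc, ← MonoidalCategory.whiskerLeft_comp_assoc,
        whisker_exchange_assoc, hk₁, fam_one, ← hk₀, Category.assoc])
    have hk₀' : I.obj ◁ k₃ ≫ I.obj ◁ i ≫ p₀ = H.obj := by
      simpa [i] using hk₀
    have hk₁' : I.mor ◁ k₃ ≫ I.mor ◁ i ≫ p₁ = H.mor := by
      simpa [i] using hk₁
    obtain ⟨k₄, rfl⟩ := u₄ k₃ (by
      rw [whisker_exchange_assoc, hk₁', fam_comp, whisker_mul]
      apply A.mul_congr <;> rw [whisker_exchange_assoc, hk₁'])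
    refine ⟨k₄, hom_ext ?_ ?_, fun l hl => ?_⟩
    · rw [comp_obj, baseMap_obj]
      simpa [famMk, Hom.ofMul] using hk₀'
    · rw [comp_mor, baseMap_mor]
      simpa [famMk, Hom.ofMul] using hk₁'
    · have : Mono i := mono_comp _ _
      rw [← cancel_mono e₄, ← cancel_mono i]
      apply hP'
      · have e := congrArg Hom.obj hl
        rw [comp_obj, baseMap_obj] at e
        have e' : I.obj ◁ l ≫ I.obj ◁ e₄ ≫ I.obj ◁ i ≫ p₀ = H.obj := e
        rw [← hk₀'] at e'
        simpa only [MonoidalCategory.whiskerLeft_comp, Category.assoc] using e'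
      · have e := congrArg Hom.mor hl
        rw [comp_mor, baseMap_mor] at e
        have e' : I.mor ◁ l ≫ I.mor ◁ e₄ ≫ I.mor ◁ i ≫ p₁ = H.mor := e
        rw [← hk₁'] at e'
        simpa only [MonoidalCategory.whiskerLeft_comp, Category.assoc] using e'
end

section
variable {A B : InternalCat V} {X Y : V}

lemma ofPoint_ext {F G : cst X ⟶ A} (h : F.obj = G.obj) : F = G := by
  apply hom_ext h
  have hF : (cst X).one ≫ F.mor = F.obj ≫ A.one := F.one_mor
  have hG : (cst X).one ≫ G.mor = G.obj ≫ A.one := G.one_mor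
  exact (Category.id_comp _).symm.trans (hF.trans ((congrArg (fun t => t ≫ A.one) h).trans
    (hG.symm.trans (Category.id_comp _))))

lemma ofPoint_obj (a : X ⟶ A.obj) : (A.ofPoint a).obj = a := rfl

lemma ofPoint_comp (a : X ⟶ A.obj) (F : A ⟶ B) : A.ofPoint a ≫ F = B.ofPoint (a ≫ F.obj) :=
  ofPoint_ext rfl

lemma cstMap_ofPoint (k : Y ⟶ X) (a : X ⟶ A.obj) : cstMap k ≫ A.ofPoint a = A.ofPoint (k ≫ a) :=
  ofPoint_ext rfl

end

section
variable [CartesianMonoidalCategory V] {I A B : InternalCat V} {X Y : V}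

/-- The family of constant internal functors at the generalized object `a`. -/
def constFam (I : InternalCat V) (a : X ⟶ A.obj) : prod I (cst X) ⟶ A :=
  prodSnd I (cst X) ≫ A.ofPoint a

lemma toTerminal_unique (F G : A ⟶ cst (𝟙_ V)) : F = G :=
  hom_ext (toUnit_unique _ _) (toUnit_unique _ _)

lemma constFam_obj (a : X ⟶ A.obj) : (constFam I a).obj = snd I.obj X ≫ a := rfl

lemma constFam_comp (a : X ⟶ A.obj) (F : A ⟶ B) :
    constFam I a ≫ F = constFam I (a ≫ F.obj) := by
  rw [constFam, Category.assoc, ofPoint_comp, constFam]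

lemma baseMap_constFam (k : Y ⟶ X) (a : X ⟶ A.obj) :
    baseMap I k ≫ constFam I a = constFam I (k ≫ a) := by
  rw [constFam, baseMap, ← Category.assoc, prodLift_snd, Category.assoc, cstMap_ofPoint, constFam]

end

section
variable [CartesianMonoidalCategory V] [MonoidalClosed V] (I : InternalCat V) (A : InternalCat V)

/-- The object of internal functors `I ⟶ A`. -/
def funObj : V := (exists_funObj I A).choose

/-- The universal family of internal functors `I ⟶ A`. -/
def evalFun : prod I (cst (funObj I A)) ⟶ A := (exists_funObj I A).choose_spec.choose

variable {I A} {B : InternalCat V} {X Y : V}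

/-- The family of internal functors classified by a map to the object of internal functors. -/
def untr (k : X ⟶ funObj I A) : prod I (cst X) ⟶ A := baseMap I k ≫ evalFun I A

/-- The map classifying a family of internal functors. -/
def transpose (H : prod I (cst X) ⟶ A) : X ⟶ funObj I A :=
  ((exists_funObj I A).choose_spec.choose_spec H).exists.choose

@[simp] lemma untr_transpose (H : prod I (cst X) ⟶ A) : untr (transpose H) = H :=
  ((exists_funObj I A).choose_spec.choose_spec H).exists.choose_spec

lemma untr_injective {k l : X ⟶ funObj I A} (h : untr k = untr l) : k = l :=
  ((exists_funObj I A).choose_spec.choose_spec (untr l)).unique h rfl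

lemma untr_comp (k : Y ⟶ X) (f : X ⟶ funObj I A) : untr (k ≫ f) = baseMap I k ≫ untr f := by
  rw [untr, baseMap_comp, Category.assoc, untr]

variable (I) in
/-- Postcomposition with an internal functor. -/
def post (F : A ⟶ B) : funObj I A ⟶ funObj I B := transpose (evalFun I A ≫ F)

@[simp] lemma untr_post (k : X ⟶ funObj I A) (F : A ⟶ B) :
    untr (k ≫ post I F) = untr k ≫ F := by
  rw [untr_comp, post, untr_transpose, ← Category.assoc, untr]

lemma untr_compat {F G : A ⟶ B} {f g : X ⟶ funObj I A} (h : f ≫ post I F = g ≫ post I G) :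
    untr f ≫ F = untr g ≫ G := by
  rw [← untr_post, ← untr_post, h]

variable (I A) in
/-- The internal category of internal functors `I ⟶ A` and internal natural transformations. -/
abbrev internalHom : InternalCat V :=
  ofMul (funObj I A) (funObj I A.arr) (post I A.arrDom) (post I A.arrCod) (post I A.arrRefl)
    (fun f g h => transpose (vcomp (untr f) (untr g) (untr_compat h)))
    (fun k f g h => untr_injective (by
      rw [untr_comp, untr_transpose, untr_transpose, whisker_vcomp]
      exact vcomp_congr (untr_comp k f).symm (untr_comp k g).symm _))
    (untr_injective (by
      rw [← Category.id_comp (post I A.arrRefl), Category.assoc, ← Category.assoc, untr_post,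
        untr_post, Category.assoc, arrRefl_dom, Category.comp_id]))
    (untr_injective (by
      rw [← Category.id_comp (post I A.arrRefl), Category.assoc, ← Category.assoc, untr_post,
        untr_post, Category.assoc, arrRefl_cod, Category.comp_id]))
    (fun f g h => untr_injective (by simp))
    (fun f g h => untr_injective (by simp))
    (fun f => untr_injective (by
      rw [untr_transpose]
      apply refl_vcomp
      rw [← Category.assoc, untr_post, untr_post]))
    (fun f => untr_injective (by
      rw [untr_transpose]
      apply vcomp_refl
      rw [← Category.assoc, untr_post, untr_post]))
    (fun f g h hfg hgh => untr_injective (by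
      have e := vcomp_assoc (untr f) (untr g) (untr h) (untr_compat hfg) (untr_compat hgh)
      refine (untr_transpose _).trans (Eq.trans ?_ (e.trans (Eq.trans ?_ (untr_transpose _).symm)))
      · exact vcomp_congr (untr_transpose _) rfl _
      · exact vcomp_congr rfl (untr_transpose _).symm _))

lemma internalHom_mul (f g : X ⟶ (internalHom I A).mor)
    (h : f ≫ (internalHom I A).tgt = g ≫ (internalHom I A).src) :
    (internalHom I A).mul f g h = transpose (vcomp (untr f) (untr g) (untr_compat h)) :=
  (internalHom I A).mul_eq (fun f g h => transpose (vcomp (untr f) (untr g) (untr_compat h)))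
    (fun k f g h => untr_injective (by
      rw [untr_comp, untr_transpose, untr_transpose, whisker_vcomp]
      exact vcomp_congr (untr_comp k f).symm (untr_comp k g).symm _)) rfl f g h

variable (I A) in
/-- The diagonal internal functor. -/
def diag : A ⟶ internalHom I A :=
  Hom.ofMul (B := internalHom I A) (transpose (constFam I (𝟙 A.obj)))
    (transpose (constFam (A := A.arr) I (𝟙 A.mor)))
    (untr_injective (by
      refine (untr_post _ _).trans ?_
      rw [untr_transpose, constFam_comp, untr_comp, untr_transpose, baseMap_constFam]
      exact congrArg (constFam I) ((Category.id_comp _).trans (Category.comp_id _).symm)))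
    (untr_injective (by
      refine (untr_post _ _).trans ?_
      rw [untr_transpose, constFam_comp, untr_comp, untr_transpose, baseMap_constFam]
      exact congrArg (constFam I) ((Category.id_comp _).trans (Category.comp_id _).symm)))
    (untr_injective (by
      refine Eq.trans ?_ (untr_post _ _).symm
      rw [untr_transpose, constFam_comp, untr_comp, untr_transpose, baseMap_constFam]
      exact congrArg (constFam (A := A.arr) I)
        ((Category.comp_id _).trans (Category.id_comp _).symm)))
    (fun f g h => by
      rw [internalHom_mul]
      apply untr_injective
      have e {X : V} (f : X ⟶ A.mor) :
          untr (f ≫ transpose (constFam (A := A.arr) I (𝟙 A.mor))) =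
            constFam (A := A.arr) I f := by
        rw [untr_comp, untr_transpose, baseMap_constFam]
        exact congrArg (constFam (A := A.arr) I) (Category.comp_id _)
      refine (e _).trans (Eq.trans ?_ ((untr_transpose _).trans (vcomp_congr (e f) (e g) _)).symm)
      apply arr_ext
      · rw [vcomp_obj]
        rw [constFam_obj]
        exact A.whisker_mul _ _ _ h
      · rw [vcomp_dom, constFam_comp, constFam_comp]
        refine congrArg (constFam I) ?_
        exact A.mul_src f g h
      · rw [vcomp_cod, constFam_comp, constFam_comp]
        refine congrArg (constFam I) ?_
        exact A.mul_tgt f g h)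

/-- The point of the object of internal functors given by an internal functor. -/
def nameObj (G : I ⟶ A) : 𝟙_ V ⟶ funObj I A := transpose (prodFst I (cst (𝟙_ V)) ≫ G)

/-- The element of the internal hom given by an internal functor. -/
def name (G : I ⟶ A) : cst (𝟙_ V) ⟶ internalHom I A := (internalHom I A).ofPoint (nameObj G)

end

/-! #### Comma categories, slices, internal terminal objects and internal limits -/

section
variable [CartesianMonoidalCategory V] {A B : InternalCat V}

/-- The internal functor `(s, t)` from the internal category of arrows to the square. -/
def arrEnds (B : InternalCat V) : B.arr ⟶ prod B B := prodLift B.arrDom B.arrCod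

/-- The comma category of an internal functor `H` over an element `b`: the pullback of the internal
category of arrows of `B` along `H × b : A × 1 ≅ A ⟶ B × B`. -/
abbrev comma (H : A ⟶ B) (b : cst (𝟙_ V) ⟶ B) : InternalCat V :=
  pb (prodLift H (toTerminal A ≫ b)) (arrEnds B)

/-- The projection of the comma category. -/
def commaProj (H : A ⟶ B) (b : cst (𝟙_ V) ⟶ B) : comma H b ⟶ A := pbFst _ _

/-- The slice of `A` over an element `T`. -/
abbrev slice (A : InternalCat V) (T : cst (𝟙_ V) ⟶ A) : InternalCat V := comma (𝟙 A) T

/-- The projection from the slice. -/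
def sliceProj (A : InternalCat V) (T : cst (𝟙_ V) ⟶ A) : slice A T ⟶ A := commaProj (𝟙 A) T

/-- An element `T` of `A` is internally terminal if the projection from the slice over `T` is an
isomorphism of internal categories. -/
def IsInternalTerminal (A : InternalCat V) (T : cst (𝟙_ V) ⟶ A) : Prop := IsIso (sliceProj A T)

variable [MonoidalClosed V]

/-- The internal category of cones over an internal functor. -/
abbrev cones (G : A ⟶ B) : InternalCat V := comma (diag A B) (name G)

/-- An element of the internal category of cones over `G` is an internal limit of `G` if it is
internally terminal. -/
def IsInternalLimit (G : A ⟶ B) (e : cst (𝟙_ V) ⟶ cones G) : Prop :=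
  IsInternalTerminal (cones G) e

/-- The element of the internal category of cones over `G` given by an element `l` of `B` and an
internal natural transformation from the constant internal functor at `l` to `G`. -/
def coneElem (G : A ⟶ B) (l : 𝟙_ V ⟶ B.obj) (t : A ⟶ B.arr)
    (hd : t ≫ B.arrDom = toTerminal A ≫ B.ofPoint l) (hc : t ≫ B.arrCod = G) :
    cst (𝟙_ V) ⟶ cones G :=
  pbLift (B.ofPoint l)
    ((internalHom A B).arr.ofPoint (transpose (X := 𝟙_ V) (prodFst A (cst (𝟙_ V)) ≫ t))) (by
      apply prod_hom_ext
      · rw [arrEnds, Category.assoc, Category.assoc, prodLift_fst, prodLift_fst, ofPoint_comp,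
          ofPoint_comp]
        apply ofPoint_ext
        apply untr_injective
        refine Eq.trans ?_ (untr_post _ _).symm
        refine (untr_comp _ _).trans ?_
        refine (congrArg (fun t => baseMap A l ≫ t) (untr_transpose _)).trans ?_
        rw [baseMap_constFam, untr_transpose, Category.assoc, hd, ← Category.assoc,
          toTerminal_unique (prodFst A (cst (𝟙_ V)) ≫ toTerminal A) (prodSnd A (cst (𝟙_ V))),
          Category.comp_id, constFam]
      · rw [arrEnds, Category.assoc, Category.assoc, prodLift_snd, prodLift_snd,
          ← Category.assoc, toTerminal_unique (B.ofPoint l ≫ toTerminal B) (𝟙 _),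
          Category.id_comp, name, ofPoint_comp]
        apply ofPoint_ext
        apply untr_injective
        refine Eq.trans ?_ (untr_post _ _).symm
        rw [untr_transpose, Category.assoc, hc]
        exact untr_transpose _)

end

end InternalCat

/-! ### Extensive categories -/

section
variable {V : Type u} [Category.{v} V] [HasCoproducts.{w} V]

/-- The coproduct functor from the product of the slices over `X i` to the slice over `∐ X`. -/
@[simps]
def sigmaOver {I : Type w} (X : I → V) : (∀ i, Over (X i)) ⥤ Over (∐ X) where
  obj Z := Over.mk (Limits.Sigma.map fun i => (Z i).hom)
  map f := Over.homMk (Limits.Sigma.map fun i => (f i).left) (by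
    apply Limits.Sigma.hom_ext
    intro i
    simp)
  map_id Z := by
    ext
    simp
  map_comp f g := by
    ext
    refine Limits.Sigma.hom_ext _ _ fun i => ?_
    simp

variable (V) in
/-- Infinitary extensivity: the coproduct functors on slices are equivalences. -/
class IsExtensive : Prop where
  isEquivalence : ∀ {I : Type w} (X : I → V), (sigmaOver X).IsEquivalence

namespace IsExtensive

variable [IsExtensive.{w} V] {I : Type w} {X : I → V}

lemma exists_map {F Z : ∀ i, Over (X i)}
    (β : (∐ fun i => (F i).left) ⟶ ∐ fun i => (Z i).left)
    (h : β ≫ Limits.Sigma.map (fun i => (Z i).hom) = Limits.Sigma.map (fun i => (F i).hom)) :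
    ∃ φ : ∀ i, F i ⟶ Z i, Limits.Sigma.map (fun i => (φ i).left) = β := by
  have := isEquivalence X
  let β' : (sigmaOver X).obj F ⟶ (sigmaOver X).obj Z := Over.homMk β h
  obtain ⟨φ, hφ⟩ := (sigmaOver X).map_surjective β'
  exact ⟨φ, congrArg (fun t => CommaMorphism.left t) hφ⟩

lemma exists_decomp {Y : V} (g : Y ⟶ ∐ X) : ∃ (Z : ∀ i, Over (X i))
    (e : (∐ fun i => (Z i).left) ⟶ Y) (e' : Y ⟶ ∐ fun i => (Z i).left),
    e ≫ g = Limits.Sigma.map (fun i => (Z i).hom) ∧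
      e' ≫ Limits.Sigma.map (fun i => (Z i).hom) = g ∧ e' ≫ e = 𝟙 _ ∧ e ≫ e' = 𝟙 _ := by
  have := isEquivalence X
  let e := (sigmaOver X).objObjPreimageIso (Over.mk g)
  exact ⟨(sigmaOver X).objPreimage (Over.mk g), e.hom.left, e.inv.left, Over.w e.hom, Over.w e.inv,
    congrArg (fun t => CommaMorphism.left t) e.inv_hom_id,
    congrArg (fun t => CommaMorphism.left t) e.hom_inv_id⟩

lemma exists_factor (Z : ∀ i, Over (X i)) (k : I) {T : V} (b : T ⟶ ∐ fun i => (Z i).left)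
    (f : T ⟶ X k) (h : b ≫ Limits.Sigma.map (fun i => (Z i).hom) = f ≫ Limits.Sigma.ι X k) :
    ∃ c : T ⟶ (Z k).left, c ≫ (Z k).hom = f ∧ c ≫ Limits.Sigma.ι (fun i => (Z i).left) k = b := by
  let F : ∀ i, Over (X i) := fun i =>
    Over.mk (Limits.Sigma.desc fun p : ULift.{w} (PLift (k = i)) => f ≫ eqToHom (by rw [p.down.down]))
  have hF (i : I) (p : ULift.{w} (PLift (k = i))) :
      Limits.Sigma.ι (fun _ : ULift.{w} (PLift (k = i)) => T) p ≫ (F i).hom =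
        f ≫ eqToHom (by rw [p.down.down]) := Limits.Sigma.ι_desc _ _
  obtain ⟨φ, hφ⟩ := exists_map (F := F) (Z := Z) (Limits.Sigma.desc fun i =>
      Limits.Sigma.desc fun _ : ULift.{w} (PLift (k = i)) => b) (by
        apply Limits.Sigma.hom_ext
        intro i
        apply Limits.Sigma.hom_ext
        rintro ⟨⟨rfl⟩⟩
        simp only [Limits.Sigma.ι_desc_assoc, h, Limits.Sigma.ι_map]
        rw [reassoc_of% hF]
        simp)
  have e := congrArg (fun t => Limits.Sigma.ι (fun _ : ULift.{w} (PLift (k = k)) => T) ⟨⟨rfl⟩⟩ ≫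
    Limits.Sigma.ι (fun i => (F i).left) k ≫ t) hφ
  refine ⟨Limits.Sigma.ι (fun _ : ULift.{w} (PLift (k = k)) => T) ⟨⟨rfl⟩⟩ ≫ (φ k).left, ?_, ?_⟩
  · rw [Category.assoc, Over.w, hF]
    simp
  · simp only [Limits.Sigma.ι_map, Limits.Sigma.ι_desc] at e
    rw [Category.assoc, e]

lemma ι_injective {k : I} {T : V} {f f' : T ⟶ X k}
    (h : f ≫ Limits.Sigma.ι X k = f' ≫ Limits.Sigma.ι X k) : f = f' := by
  let F : ∀ i, Over (X i) := fun i =>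
    Over.mk (Limits.Sigma.desc fun p : ULift.{w} (PLift (k = i)) => f' ≫ eqToHom (by rw [p.down.down]))
  have hF (i : I) (p : ULift.{w} (PLift (k = i))) :
      Limits.Sigma.ι (fun _ : ULift.{w} (PLift (k = i)) => T) p ≫ (F i).hom =
        f' ≫ eqToHom (by rw [p.down.down]) := Limits.Sigma.ι_desc _ _
  let j : T ⟶ (F k).left := Limits.Sigma.ι (fun _ : ULift.{w} (PLift (k = k)) => T) ⟨⟨rfl⟩⟩
  let r (i : I) : (F i).left ⟶ T := Limits.Sigma.desc fun _ : ULift.{w} (PLift (k = i)) => 𝟙 T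
  have hr : r k ≫ f' = (F k).hom := by
    apply Limits.Sigma.hom_ext
    intro p
    rw [hF]
    simp [r]
  obtain ⟨c, hc, hc'⟩ := exists_factor F k (j ≫ Limits.Sigma.ι (fun i => (F i).left) k) f (by
    rw [h, Category.assoc, Limits.Sigma.ι_map, ← Category.assoc, hF]
    simp)
  have e := hc' =≫ Limits.Sigma.desc r
  simp only [Category.assoc, Limits.Sigma.ι_desc] at e
  have e' : j ≫ r k = 𝟙 T := Limits.Sigma.ι_desc _ _
  rw [e'] at e
  rw [← hc, ← hr, reassoc_of% e]

lemma exists_isInitial {i j : I} (hij : i ≠ j) {T : V} {f : T ⟶ X i} {f' : T ⟶ X j}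
    (h : f ≫ Limits.Sigma.ι X i = f' ≫ Limits.Sigma.ι X j) :
    ∃ (E : V) (_ : IsInitial E), Nonempty (T ⟶ E) := by
  let F : ∀ i, Over (X i) := fun i =>
    Over.mk (Limits.Sigma.desc fun p : ULift.{w} (PLift (j = i)) => f' ≫ eqToHom (by rw [p.down.down]))
  have hF (i : I) (p : ULift.{w} (PLift (j = i))) :
      Limits.Sigma.ι (fun _ : ULift.{w} (PLift (j = i)) => T) p ≫ (F i).hom =
        f' ≫ eqToHom (by rw [p.down.down]) := Limits.Sigma.ι_desc _ _
  let k : T ⟶ (F j).left := Limits.Sigma.ι (fun _ : ULift.{w} (PLift (j = j)) => T) ⟨⟨rfl⟩⟩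
  obtain ⟨c, -, -⟩ := exists_factor F i (k ≫ Limits.Sigma.ι (fun i => (F i).left) j) f (by
    rw [h, Category.assoc, Limits.Sigma.ι_map, ← Category.assoc, hF]
    simp)
  have hE : IsEmpty (ULift.{w} (PLift (j = i))) := ⟨fun p => hij p.down.down.symm⟩
  exact ⟨(F i).left, IsInitial.ofUniqueHom (fun W => Limits.Sigma.desc fun p => hE.elim p)
    (fun W m => Limits.Sigma.hom_ext _ _ fun p => hE.elim p), ⟨c⟩⟩

variable {Y W : V} (g : Y ⟶ ∐ X)

lemma hom_ext {m m' : Y ⟶ W} (h : ∀ (i : I) {T : V} (t : T ⟶ Y) (a : T ⟶ X i),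
    t ≫ g = a ≫ Limits.Sigma.ι X i → t ≫ m = t ≫ m') : m = m' := by
  obtain ⟨Z, e, e', he, he', hi, hi'⟩ := exists_decomp g
  rw [← Category.id_comp m, ← Category.id_comp m', ← hi, Category.assoc, Category.assoc]
  congr 1
  apply Limits.Sigma.hom_ext
  intro i
  have := h i (Limits.Sigma.ι (fun i => (Z i).left) i ≫ e) (Z i).hom (by
    rw [Category.assoc, he, Limits.Sigma.ι_map])
  simpa only [Category.assoc] using this

lemma exists_glue (s : ∀ (i : I) {T : V} (t : T ⟶ Y) (a : T ⟶ X i),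
      t ≫ g = a ≫ Limits.Sigma.ι X i → (T ⟶ W))
    (nat : ∀ (i : I) {T T' : V} (k : T' ⟶ T) (t : T ⟶ Y) (a : T ⟶ X i)
      (h : t ≫ g = a ≫ Limits.Sigma.ι X i), k ≫ s i t a h = s i (k ≫ t) (k ≫ a)
        (by rw [Category.assoc, h, Category.assoc])) :
    ∃ m : Y ⟶ W, ∀ (i : I) {T : V} (t : T ⟶ Y) (a : T ⟶ X i)
      (h : t ≫ g = a ≫ Limits.Sigma.ι X i), t ≫ m = s i t a h := by
  obtain ⟨Z, e, e', he, he', hi, hi'⟩ := exists_decomp g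
  refine ⟨e' ≫ Limits.Sigma.desc fun i =>
    s i (Limits.Sigma.ι (fun i => (Z i).left) i ≫ e) (Z i).hom (by
      rw [Category.assoc, he, Limits.Sigma.ι_map]), fun i T t a h => ?_⟩
  obtain ⟨c, hc, hc'⟩ := exists_factor Z i (t ≫ e') a (by rw [Category.assoc, he', h])
  rw [← Category.assoc, ← hc', Category.assoc, Limits.Sigma.ι_desc, nat]
  congr 1
  rw [← Category.assoc, hc', Category.assoc, hi, Category.comp_id]

end IsExtensive

end

section
variable {V : Type u} [Category.{v} V] [CartesianMonoidalCategory V] [MonoidalClosed V]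
  [HasCoproducts.{w} V] [IsExtensive.{w} V]

namespace IsExtensive

lemma exists_initial {I : Type w} {X : I → V} {i j : I} (hij : i ≠ j) {T : V} {f : T ⟶ X i}
    {f' : T ⟶ X j} (h : f ≫ Limits.Sigma.ι X i = f' ≫ Limits.Sigma.ι X j) :
    Nonempty (IsInitial T) := by
  obtain ⟨E, hE, ⟨c⟩⟩ := exists_isInitial hij h
  have := strict_initial hE c
  exact ⟨hE.ofIso (asIso c).symm⟩

variable (V) [HasPullbacks V] in
/-- A cartesian closed extensive category with pullbacks has products: a product of the objects
`Y i` is an object of sections of `∐ Y ⟶ ∐ 1`. -/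
theorem hasProducts : HasProducts.{w} V := by
  suffices h : ∀ {I : Type w} (Y : I → V), HasProduct Y from fun I =>
    ⟨fun F => have := h (fun i => F.obj ⟨i⟩)
      hasLimit_of_iso (Discrete.natIsoFunctor (F := F)).symm⟩
  intro I Y
  let D : V := ∐ fun _ : I => 𝟙_ V
  let q : (∐ Y) ⟶ D := Limits.Sigma.map fun i => toUnit (Y i)
  obtain ⟨R, e, he, hRU, hR⟩ := InternalCat.exists_locus
    (MonoidalClosed.uncurry (𝟙 (D ⟶[V] ∐ Y)) ≫ q) (fst D (D ⟶[V] ∐ Y))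
  let U : D ⊗ R ⟶ ∐ Y := MonoidalClosed.uncurry e
  have hU (T : V) (l : T ⟶ R) : D ◁ l ≫ U = MonoidalClosed.uncurry (l ≫ e) :=
    (MonoidalClosed.uncurry_natural_left _ _).symm
  have hUq : U ≫ q = fst D R := by
    rw [← Category.assoc, ← MonoidalClosed.uncurry_natural_left, Category.comp_id,
      whiskerLeft_fst] at hRU
    exact hRU
  let pt (i : I) (T : V) : T ⟶ D ⊗ T :=
    lift (toUnit T ≫ Limits.Sigma.ι (fun _ : I => 𝟙_ V) i) (𝟙 T)
  have pt_fst (i : I) (T : V) : pt i T ≫ fst D T =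
      toUnit T ≫ Limits.Sigma.ι (fun _ : I => 𝟙_ V) i := lift_fst _ _
  have hp (i : I) : ∃ p : R ⟶ Y i, p ≫ Limits.Sigma.ι Y i = pt i R ≫ U := by
    obtain ⟨c, -, hc⟩ := IsExtensive.exists_factor (X := fun _ : I => 𝟙_ V)
      (fun i => Over.mk (toUnit (Y i))) i (pt i R ≫ U) (toUnit R) (by
        refine (Category.assoc _ _ _).trans ((congrArg (fun t => pt i R ≫ t) hUq).trans ?_)
        simp [pt])
    exact ⟨c, hc⟩
  choose p hp using hp
  have key {T : V} (i : I) (t : T ⟶ R) {S : V} (k : S ⟶ D ⊗ T)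
      (hk : k ≫ fst D T = toUnit S ≫ Limits.Sigma.ι (fun _ : I => 𝟙_ V) i) :
      k ≫ D ◁ t ≫ U = k ≫ snd D T ≫ t ≫ p i ≫ Limits.Sigma.ι Y i := by
    rw [hp, ← Category.assoc, ← Category.assoc t, ← Category.assoc (snd D T),
      ← Category.assoc k]
    congr 1
    apply CartesianMonoidalCategory.hom_ext
    · simp only [Category.assoc, whiskerLeft_fst, hk, pt, comp_lift, lift_fst]
      rw [← Category.assoc, ← Category.assoc, ← Category.assoc]
      congr 1
      exact toUnit_unique _ _
    · simp [pt]
  have hex {T : V} (y : ∀ i, T ⟶ Y i) : ∃ l : T ⟶ R, ∀ i, l ≫ p i = y i := by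
    obtain ⟨m, hm⟩ := IsExtensive.exists_glue (X := fun _ : I => 𝟙_ V) (fst D T)
      (fun i {S} t _ _ => t ≫ snd D T ≫ y i ≫ Limits.Sigma.ι Y i)
      (fun i {S S'} k t a h => (Category.assoc _ _ _).symm)
    have hmq : m ≫ q = fst D T := by
      apply IsExtensive.hom_ext (X := fun _ : I => 𝟙_ V) (fst D T)
      intro i S t a h
      rw [← Category.assoc, hm i t a h, h]
      simp only [Category.assoc, q, Limits.Sigma.ι_map]
      simp only [← Category.assoc]
      congr 1
      exact toUnit_unique _ _
    obtain ⟨l, hl⟩ := hR (MonoidalClosed.curry m) (by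
      rw [← Category.assoc, ← MonoidalClosed.uncurry_natural_left, Category.comp_id,
        MonoidalClosed.uncurry_curry, hmq, whiskerLeft_fst])
    have hlm : D ◁ l ≫ U = m := by rw [hU, hl, MonoidalClosed.uncurry_curry]
    refine ⟨l, fun i => IsExtensive.ι_injective ?_⟩
    have h₁ := key i l (pt i T) (pt_fst i T)
    rw [hlm, hm i (pt i T) (toUnit T) (pt_fst i T)] at h₁
    simpa [pt] using h₁.symm
  have huniq {T : V} (l l' : T ⟶ R) (h : ∀ i, l ≫ p i = l' ≫ p i) : l = l' := by
    rw [← cancel_mono e]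
    apply MonoidalClosed.uncurry_injective
    rw [← hU, ← hU]
    apply IsExtensive.hom_ext (X := fun _ : I => 𝟙_ V) (fst D T)
    intro i S k a hk
    have hk' : k ≫ fst D T = toUnit S ≫ Limits.Sigma.ι (fun _ : I => 𝟙_ V) i := by
      rw [hk, toUnit_unique a (toUnit S)]
    rw [key i l k hk', key i l' k hk', reassoc_of% (h i)]
  choose lft hlft using @hex
  exact ⟨⟨⟨Fan.mk R p, Fan.IsLimit.mk _ (fun s => lft s.proj) (fun s j => hlft s.proj j)
    (fun s m hm => huniq _ _ fun i => (hm i).trans (hlft s.proj i).symm)⟩⟩⟩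

end IsExtensive
end

/-! ### Generalized elements of hom-objects of enriched categories -/

section
variable {V : Type u} [Category.{v} V] [CartesianMonoidalCategory V]
variable {C : Type w} [EnrichedCategory V C]

/-- Composition of generalized elements of hom-objects. -/
def el {A B D : C} {T : V} (f : T ⟶ (A ⟶[V] B)) (g : T ⟶ (B ⟶[V] D)) : T ⟶ (A ⟶[V] D) :=
  lift f g ≫ eComp V A B D

lemma comp_el {A B D : C} {S T : V} (k : S ⟶ T) (f : T ⟶ (A ⟶[V] B)) (g : T ⟶ (B ⟶[V] D)) :
    k ≫ el f g = el (k ≫ f) (k ≫ g) := by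
  rw [el, el, ← Category.assoc, comp_lift]

lemma el_id_left {A B : C} {T : V} (e : T ⟶ 𝟙_ V) (f : T ⟶ (A ⟶[V] B)) :
    el (e ≫ eId V A) f = f := by
  have h := f ≫= e_id_comp V A B
  rw [Category.comp_id] at h
  refine Eq.trans ?_ h
  rw [el, ← Category.assoc, ← Category.assoc]
  congr 1
  apply CartesianMonoidalCategory.hom_ext
  · simp only [lift_fst, Category.assoc, whiskerRight_fst, leftUnitor_inv_fst_assoc]
    simp only [← Category.assoc]
    congr 1
    exact toUnit_unique _ _
  · simp

lemma el_id_right {A B : C} {T : V} (f : T ⟶ (A ⟶[V] B)) (e : T ⟶ 𝟙_ V) :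
    el f (e ≫ eId V B) = f := by
  have h := f ≫= e_comp_id V A B
  rw [Category.comp_id] at h
  refine Eq.trans ?_ h
  rw [el, ← Category.assoc, ← Category.assoc]
  congr 1
  apply CartesianMonoidalCategory.hom_ext
  · simp
  · simp only [lift_snd, Category.assoc, whiskerLeft_snd, rightUnitor_inv_snd_assoc]
    simp only [← Category.assoc]
    congr 1
    exact toUnit_unique _ _

lemma el_assoc {A B D E : C} {T : V} (f : T ⟶ (A ⟶[V] B)) (g : T ⟶ (B ⟶[V] D))
    (h : T ⟶ (D ⟶[V] E)) : el (el f g) h = el f (el g h) := by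
  have e := lift f (lift g h) ≫= e_assoc V A B D E
  simp only [lift_whiskerLeft_assoc, lift_lift_associator_inv_assoc, lift_whiskerRight_assoc] at e
  exact e

lemma el_map {D : Type w₂} [EnrichedCategory V D] (G : EnrichedFunctor V C D) {X Y Z : C} {T : V}
    (f : T ⟶ (X ⟶[V] Y)) (g : T ⟶ (Y ⟶[V] Z)) :
    el f g ≫ G.map X Z = el (f ≫ G.map X Y) (g ≫ G.map Y Z) := by
  rw [el, el, Category.assoc, G.map_comp, lift_map_assoc]

end

/-! ### The internalization of an enriched category -/

section
variable {V : Type u} [Category.{v} V] [CartesianMonoidalCategory V]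
  [HasCoproducts.{w} V]
variable {C : Type w} [EnrichedCategory V C]

variable (V C) in
/-- The object of objects. -/
abbrev intObj : V := ∐ fun _ : C => 𝟙_ V

variable (V C) in
/-- The object of morphisms. -/
abbrev intMor : V := ∐ fun p : C × C => (p.1 ⟶[V] p.2)

variable (V) in
def inO (A : C) : 𝟙_ V ⟶ intObj V C := Limits.Sigma.ι (fun _ : C => 𝟙_ V) A

variable (V) in
def inM (A B : C) : (A ⟶[V] B) ⟶ intMor V C :=
  Limits.Sigma.ι (fun p : C × C => (p.1 ⟶[V] p.2)) (A, B)

variable (V C) in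
def intSrc : intMor V C ⟶ intObj V C := Limits.Sigma.desc fun p => toUnit _ ≫ inO V p.1

variable (V C) in
def intTgt : intMor V C ⟶ intObj V C := Limits.Sigma.desc fun p => toUnit _ ≫ inO V p.2

variable (V C) in
def intOne : intObj V C ⟶ intMor V C := Limits.Sigma.desc fun A => eId V A ≫ inM V A A

lemma inM_src (A B : C) {T : V} (a : T ⟶ (A ⟶[V] B)) :
    (a ≫ inM V A B) ≫ intSrc V C = toUnit T ≫ inO V A := by
  have e : inM V A B ≫ intSrc V C = toUnit _ ≫ inO V A := Limits.Sigma.ι_desc _ _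
  rw [Category.assoc, e, ← Category.assoc, toUnit_unique (a ≫ toUnit _) (toUnit T)]

lemma inM_tgt (A B : C) {T : V} (a : T ⟶ (A ⟶[V] B)) :
    (a ≫ inM V A B) ≫ intTgt V C = toUnit T ≫ inO V B := by
  have e : inM V A B ≫ intTgt V C = toUnit _ ≫ inO V B := Limits.Sigma.ι_desc _ _
  rw [Category.assoc, e, ← Category.assoc, toUnit_unique (a ≫ toUnit _) (toUnit T)]

lemma inO_one (A : C) {T : V} (e : T ⟶ 𝟙_ V) :
    (e ≫ inO V A) ≫ intOne V C = (e ≫ eId V A) ≫ inM V A A := by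
  rw [Category.assoc, Category.assoc]
  congr 1
  exact Limits.Sigma.ι_desc _ _

section
variable {I : Type w} [EnrichedCategory V I] (G : EnrichedFunctor V I C)

/-- The action of the internalization of a `V`-functor on objects. -/
def intMapObj : intObj V I ⟶ intObj V C := Limits.Sigma.desc fun i => inO V (G.obj i)

/-- The action of the internalization of a `V`-functor on morphisms. -/
def intMapMor : intMor V I ⟶ intMor V C :=
  Limits.Sigma.desc fun p => G.map p.1 p.2 ≫ inM V (G.obj p.1) (G.obj p.2)

lemma inO_map (i : I) {T : V} (e : T ⟶ 𝟙_ V) :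
    (e ≫ inO V i) ≫ intMapObj G = e ≫ inO V (G.obj i) := by
  rw [Category.assoc]
  congr 1
  exact Limits.Sigma.ι_desc _ _

lemma inM_map (i j : I) {T : V} (a : T ⟶ (i ⟶[V] j)) :
    (a ≫ inM V i j) ≫ intMapMor G = (a ≫ G.map i j) ≫ inM V (G.obj i) (G.obj j) := by
  rw [Category.assoc, Category.assoc]
  congr 1
  exact Limits.Sigma.ι_desc _ _

end

variable [IsExtensive.{w} V] {X W : V}

lemma int_ext (f : X ⟶ intMor V C) {m m' : X ⟶ W}
    (H : ∀ (A B : C) {T : V} (t : T ⟶ X) (a : T ⟶ (A ⟶[V] B)), t ≫ f = a ≫ inM V A B →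
      t ≫ m = t ≫ m') : m = m' :=
  IsExtensive.hom_ext f fun p _ t a h => H p.1 p.2 t a h

variable [MonoidalClosed V]

lemma int_cases {T : V} {A B B' D : C} {a : T ⟶ (A ⟶[V] B)} {b : T ⟶ (B' ⟶[V] D)}
    (h : (a ≫ inM V A B) ≫ intTgt V C = (b ≫ inM V B' D) ≫ intSrc V C) :
    B = B' ∨ Nonempty (IsInitial T) := by
  rw [inM_src, inM_tgt] at h
  by_cases hB : B = B'
  · exact Or.inl hB
  · exact Or.inr (IsExtensive.exists_initial (X := fun _ : C => 𝟙_ V) hB h)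

lemma int_ext₂ {f g : X ⟶ intMor V C} (h : f ≫ intTgt V C = g ≫ intSrc V C) {m m' : X ⟶ W}
    (H : ∀ (A B D : C) {T : V} (t : T ⟶ X) (a : T ⟶ (A ⟶[V] B)) (b : T ⟶ (B ⟶[V] D)),
      t ≫ f = a ≫ inM V A B → t ≫ g = b ≫ inM V B D → t ≫ m = t ≫ m') : m = m' := by
  refine int_ext f fun A B T t a ha => int_ext (t ≫ g) fun B' D S s b hb => ?_
  have hc : ((s ≫ a) ≫ inM V A B) ≫ intTgt V C = (b ≫ inM V B' D) ≫ intSrc V C := by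
    rw [← hb, Category.assoc s, ← ha]
    simp only [Category.assoc, h]
  rcases int_cases hc with rfl | ⟨⟨hT⟩⟩
  · have := H A B D (s ≫ t) (s ≫ a) b (by rw [Category.assoc, ha, Category.assoc])
      (by rw [Category.assoc, hb])
    simpa only [Category.assoc] using this
  · exact hT.hom_ext _ _

lemma int_ext₃ {f g k : X ⟶ intMor V C} (h : f ≫ intTgt V C = g ≫ intSrc V C)
    (h' : g ≫ intTgt V C = k ≫ intSrc V C) {m m' : X ⟶ W}
    (H : ∀ (A B D E : C) {T : V} (t : T ⟶ X) (a : T ⟶ (A ⟶[V] B)) (b : T ⟶ (B ⟶[V] D))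
      (c : T ⟶ (D ⟶[V] E)), t ≫ f = a ≫ inM V A B → t ≫ g = b ≫ inM V B D →
      t ≫ k = c ≫ inM V D E → t ≫ m = t ≫ m') : m = m' := by
  refine int_ext₂ h fun A B D T t a b ha hb => int_ext (t ≫ k) fun D' E S s c hc => ?_
  have hc' : ((s ≫ b) ≫ inM V B D) ≫ intTgt V C = (c ≫ inM V D' E) ≫ intSrc V C := by
    rw [← hc, Category.assoc s, ← hb]
    simp only [Category.assoc, h']
  rcases int_cases hc' with rfl | ⟨⟨hT⟩⟩
  · have := H A B D E (s ≫ t) (s ≫ a) (s ≫ b) c (by rw [Category.assoc, ha, Category.assoc])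
      (by rw [Category.assoc, hb, Category.assoc]) (by rw [Category.assoc, hc])
    simpa only [Category.assoc] using this
  · exact hT.hom_ext _ _

lemma exists_comp {f g : X ⟶ intMor V C} (h : f ≫ intTgt V C = g ≫ intSrc V C) :
    ∃ m : X ⟶ intMor V C, ∀ (A B D : C) {T : V} (t : T ⟶ X) (a : T ⟶ (A ⟶[V] B))
      (b : T ⟶ (B ⟶[V] D)), t ≫ f = a ≫ inM V A B → t ≫ g = b ≫ inM V B D →
        t ≫ m = el a b ≫ inM V A D := by
  classical
  have step (A B : C) {T : V} (t : T ⟶ X) (a : T ⟶ (A ⟶[V] B)) (ha : t ≫ f = a ≫ inM V A B) :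
      ∃ m : T ⟶ intMor V C, ∀ (D : C) {S : V} (s : S ⟶ T) (b : S ⟶ (B ⟶[V] D)),
        s ≫ t ≫ g = b ≫ inM V B D → s ≫ m = el (s ≫ a) b ≫ inM V A D := by
    have init {p : C × C} (hp : ¬ B = p.1) {S : V} {s : S ⟶ T} {b : S ⟶ (p.1 ⟶[V] p.2)}
        (hb : s ≫ t ≫ g = b ≫ inM V p.1 p.2) : Nonempty (IsInitial S) := by
      have hc : ((s ≫ a) ≫ inM V A B) ≫ intTgt V C = (b ≫ inM V p.1 p.2) ≫ intSrc V C := by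
        rw [← hb, Category.assoc s, ← ha]
        simp only [Category.assoc, h]
      exact (int_cases hc).resolve_left hp
    obtain ⟨m, hm⟩ := IsExtensive.exists_glue (W := intMor V C) (t ≫ g) (fun p S s b hb =>
      if hp : B = p.1 then
        el (s ≫ a) (b ≫ eqToHom (by rw [hp]) : S ⟶ (B ⟶[V] p.2)) ≫ inM V A p.2
      else (init hp hb).some.to _) (fun p S S' k s b hb => by
        by_cases hp : B = p.1
        · rw [dif_pos hp, dif_pos hp, ← Category.assoc, comp_el]
          simp only [Category.assoc]
        · rw [dif_neg hp, dif_neg hp]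
          have hb' : (k ≫ s) ≫ t ≫ g = (k ≫ b) ≫ inM V p.1 p.2 :=
            (Category.assoc _ _ _).trans ((congrArg (fun t => k ≫ t) hb).trans
              (Category.assoc _ _ _).symm)
          exact (init hp hb').some.hom_ext _ _)
    refine ⟨m, fun D S s b hb => ?_⟩
    rw [hm (B, D) s b hb, dif_pos rfl]
    simp
  choose n hn using @step
  obtain ⟨m, hm⟩ := IsExtensive.exists_glue (W := intMor V C) f
    (fun p T t a ha => n p.1 p.2 t a ha) (fun p T T' k t a ha => by
      obtain ⟨A, B⟩ := p
      have ha' : (k ≫ t) ≫ f = (k ≫ a) ≫ inM V A B :=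
        (Category.assoc _ _ _).trans ((congrArg (fun t => k ≫ t) ha).trans
          (Category.assoc _ _ _).symm)
      refine int_ext (k ≫ t ≫ g) fun B' D S s b hb => ?_
      have hc : ((s ≫ k ≫ a) ≫ inM V A B) ≫ intTgt V C = (b ≫ inM V B' D) ≫ intSrc V C := by
        rw [← hb, Category.assoc s, ← ha']
        simp only [Category.assoc, h]
      rcases int_cases hc with rfl | ⟨⟨hS⟩⟩
      · have e₁ := hn A B t a ha D (s ≫ k) b (by rw [Category.assoc, hb])
        have e₂ := hn A B (k ≫ t) (k ≫ a) ha' D s b (by rw [Category.assoc, hb])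
        rw [Category.assoc, Category.assoc] at e₁
        exact e₁.trans e₂.symm
      · exact hS.hom_ext _ _)
  refine ⟨m, fun A B D T t a b ha hb => ?_⟩
  rw [hm (A, B) t a ha]
  have := hn A B t a ha D (𝟙 T) b (by rw [Category.id_comp, hb])
  simpa using this

variable [HasPullbacks V]

variable (V C) in
/-- The composition of the internalization, whose restriction to the summand of
`C(A, B) ⊗ C(B, D)` is the composition of `C`. -/
def intComp : pullback (intTgt V C) (intSrc V C) ⟶ intMor V C :=
  (exists_comp (pullback.condition (f := intTgt V C) (g := intSrc V C))).choose

lemma intComp_spec {A B D : C} {T : V} (t : T ⟶ pullback (intTgt V C) (intSrc V C))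
    (a : T ⟶ (A ⟶[V] B)) (b : T ⟶ (B ⟶[V] D)) (ha : t ≫ pullback.fst _ _ = a ≫ inM V A B)
    (hb : t ≫ pullback.snd _ _ = b ≫ inM V B D) : t ≫ intComp V C = el a b ≫ inM V A D :=
  (exists_comp pullback.condition).choose_spec A B D t a b ha hb

lemma intMul_spec {A B D : C} {f g : X ⟶ intMor V C} (h : f ≫ intTgt V C = g ≫ intSrc V C)
    {T : V} (t : T ⟶ X) (a : T ⟶ (A ⟶[V] B)) (b : T ⟶ (B ⟶[V] D))
    (ha : t ≫ f = a ≫ inM V A B) (hb : t ≫ g = b ≫ inM V B D) :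
    t ≫ pullback.lift f g h ≫ intComp V C = el a b ≫ inM V A D := by
  rw [← Category.assoc, intComp_spec _ a b]
  · rw [Category.assoc, pullback.lift_fst, ha]
  · rw [Category.assoc, pullback.lift_snd, hb]

variable (V C) in
/-- The internalization of a `V`-category. -/
abbrev Int : InternalCat V where
  obj := intObj V C
  mor := intMor V C
  src := intSrc V C
  tgt := intTgt V C
  comp := intComp V C
  one := intOne V C
  one_src := by
    refine Limits.Sigma.hom_ext _ _ fun A => ?_
    have e := inO_one A (𝟙 (𝟙_ V))
    rw [Category.id_comp, Category.id_comp] at e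
    rw [← Category.assoc]
    refine (congrArg (fun t => t ≫ intSrc V C) e).trans ?_
    rw [inM_src, toUnit_unique (toUnit (𝟙_ V)) (𝟙 _), Category.id_comp, Category.comp_id, inO]
  one_tgt := by
    refine Limits.Sigma.hom_ext _ _ fun A => ?_
    have e := inO_one A (𝟙 (𝟙_ V))
    rw [Category.id_comp, Category.id_comp] at e
    rw [← Category.assoc]
    refine (congrArg (fun t => t ≫ intTgt V C) e).trans ?_
    rw [inM_tgt, toUnit_unique (toUnit (𝟙_ V)) (𝟙 _), Category.id_comp, Category.comp_id, inO]
  comp_src := by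
    refine int_ext₂ pullback.condition fun A B D T t a b ha hb => ?_
    rw [← Category.assoc, intComp_spec t a b ha hb, inM_src, ← Category.assoc, ha, inM_src]
  comp_tgt := by
    refine int_ext₂ pullback.condition fun A B D T t a b ha hb => ?_
    rw [← Category.assoc, intComp_spec t a b ha hb, inM_tgt, ← Category.assoc, hb, inM_tgt]
  one_comp := by
    refine int_ext (𝟙 _) fun A B T t a ha => ?_
    rw [Category.comp_id] at ha
    rw [← Category.assoc, intComp_spec _ (toUnit T ≫ eId V A) a, el_id_left, Category.comp_id, ha]
    · rw [Category.assoc, pullback.lift_fst, ha, ← Category.assoc, inM_src, inO_one]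
    · rw [Category.assoc, pullback.lift_snd, Category.comp_id, ha]
  comp_one := by
    refine int_ext (𝟙 _) fun A B T t a ha => ?_
    rw [Category.comp_id] at ha
    rw [← Category.assoc, intComp_spec _ a (toUnit T ≫ eId V B), el_id_right, Category.comp_id, ha]
    · rw [Category.assoc, pullback.lift_fst, Category.comp_id, ha]
    · rw [Category.assoc, pullback.lift_snd, ha, ← Category.assoc, inM_tgt, inO_one]
  assoc f g h hfg hgh := by
    refine int_ext₃ hfg hgh fun A B D E T t a b c ha hb hc => ?_
    rw [intMul_spec _ t (el a b) c (intMul_spec hfg t a b ha hb) hc,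
      intMul_spec _ t a (el b c) ha (intMul_spec hgh t b c hb hc), el_assoc]

lemma Int_mul {A B D : C} {f g : X ⟶ intMor V C} (h : f ≫ intTgt V C = g ≫ intSrc V C)
    {T : V} (t : T ⟶ X) (a : T ⟶ (A ⟶[V] B)) (b : T ⟶ (B ⟶[V] D))
    (ha : t ≫ f = a ≫ inM V A B) (hb : t ≫ g = b ≫ inM V B D) :
    t ≫ (Int V C).mul f g h = el a b ≫ inM V A D :=
  intMul_spec h t a b ha hb

section
variable {I : Type w} [EnrichedCategory V I] (G : EnrichedFunctor V I C)

/-- The internalization of a `V`-functor. -/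
def intMap : Int V I ⟶ Int V C :=
  InternalCat.Hom.ofMul (A := Int V I) (B := Int V C) (intMapObj G) (intMapMor G)
    (by
      refine int_ext (𝟙 _) fun i j T t a ha => ?_
      rw [Category.comp_id] at ha
      rw [← Category.assoc t, ← Category.assoc t, ha, inM_map, inM_src, inM_src, inO_map])
    (by
      refine int_ext (𝟙 _) fun i j T t a ha => ?_
      rw [Category.comp_id] at ha
      rw [← Category.assoc t, ← Category.assoc t, ha, inM_map, inM_tgt, inM_tgt, inO_map])
    (by
      refine Limits.Sigma.hom_ext _ _ fun i => ?_
      have e₁ := inO_one (V := V) i (𝟙 (𝟙_ V))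
      have e₂ := inO_map G i (𝟙 (𝟙_ V))
      have e₃ := inO_one (V := V) (G.obj i) (𝟙 (𝟙_ V))
      have e₄ := inM_map G i i (𝟙 (𝟙_ V) ≫ eId V i)
      rw [Category.id_comp] at e₁ e₂
      refine (Category.assoc _ _ _).symm.trans (Eq.trans ?_ (Category.assoc _ _ _))
      refine (congrArg (fun t => t ≫ intMapMor G) e₁).trans (e₄.trans ?_)
      refine Eq.trans ?_ (congrArg (fun t => t ≫ intOne V C) e₂).symm
      rw [e₃, Category.assoc _ (eId V i), G.map_id])
    (fun f g h => by
      refine int_ext₂ h fun i j k T t a b ha hb => ?_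
      rw [← Category.assoc t, Int_mul h t a b ha hb, inM_map, el_map]
      refine (Int_mul _ t _ _ ?_ ?_).symm
      · rw [← Category.assoc, ha, inM_map]
      · rw [← Category.assoc, hb, inM_map])

end

end

/-! ### Enriched natural transformations -/

section
variable {V : Type u} [Category.{v} V] [CartesianMonoidalCategory V]
variable {C : Type w} [EnrichedCategory V C] {D : Type w₂} [EnrichedCategory V D]

/-- A `V`-natural transformation. -/
@[ext]
structure VNatTrans (F G : EnrichedFunctor V C D) where
  app (X : C) : 𝟙_ V ⟶ (F.obj X ⟶[V] G.obj X)
  naturality (X Y : C) :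
    el (F.map X Y) (toUnit _ ≫ app Y) = el (toUnit _ ≫ app X) (G.map X Y)

namespace VNatTrans

lemma nat {F G : EnrichedFunctor V C D} (α : VNatTrans F G) {X Y : C} {T : V}
    (f : T ⟶ (X ⟶[V] Y)) (e : T ⟶ 𝟙_ V) :
    el (f ≫ F.map X Y) (e ≫ α.app Y) = el (e ≫ α.app X) (f ≫ G.map X Y) := by
  have h := f ≫= α.naturality X Y
  rw [comp_el, comp_el, ← Category.assoc, ← Category.assoc, toUnit_unique (f ≫ toUnit _) e] at h
  exact h

/-- The identity `V`-natural transformation. -/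
def id (F : EnrichedFunctor V C D) : VNatTrans F F where
  app X := eId V (F.obj X)
  naturality X Y := by rw [el_id_left, el_id_right]

/-- The composite of two `V`-natural transformations. -/
def comp {F G H : EnrichedFunctor V C D} (α : VNatTrans F G) (β : VNatTrans G H) :
    VNatTrans F H where
  app X := el (α.app X) (β.app X)
  naturality X Y := by
    rw [comp_el, comp_el, ← el_assoc, α.naturality, el_assoc, β.naturality, el_assoc]

/-- A `V`-natural transformation is a `V`-natural isomorphism if it has a `V`-natural inverse. -/
def IsIso {F G : EnrichedFunctor V C D} (α : VNatTrans F G) : Prop :=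
  ∃ β : VNatTrans G F, comp α β = VNatTrans.id F ∧ comp β α = VNatTrans.id G

end VNatTrans

/-- The constant `V`-functor. -/
abbrev constFunctor (C : Type w) [EnrichedCategory V C] (L : D) : EnrichedFunctor V C D where
  obj _ := L
  map _ _ := toUnit _ ≫ eId V L
  map_id X := by
    rw [← Category.assoc, toUnit_unique (eId V X ≫ toUnit _) (𝟙 _), Category.id_comp]
  map_comp X Y Z := by
    have h := el_id_left (V := V) (toUnit ((X ⟶[V] Y) ⊗ (Y ⟶[V] Z))) (toUnit _ ≫ eId V L)
    rw [← Category.assoc, toUnit_unique (eComp V X Y Z ≫ toUnit _) (toUnit _)]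
    refine h.symm.trans ?_
    rw [el]
    congr 1
    apply CartesianMonoidalCategory.hom_ext
    · rw [lift_fst, tensorHom_fst, ← Category.assoc]
      congr 1
      exact toUnit_unique _ _
    · rw [lift_snd, tensorHom_snd, ← Category.assoc]
      congr 1
      exact toUnit_unique _ _

end

/-! ### The hom-objects of enriched functor categories -/

section
variable {V : Type u} [Category.{v} V] [CartesianMonoidalCategory V] [MonoidalClosed V]
  [HasPullbacks V] [HasCoproducts.{w} V] [IsExtensive.{w} V]
variable {I : Type w} [EnrichedCategory V I] {C : Type w₂} [EnrichedCategory V C]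

instance {J : Type w} : HasLimitsOfShape (Discrete J) V := IsExtensive.hasProducts.{w} V J

instance : HasEqualizers V := InternalCat.hasEqualizers V

section
variable (F G : EnrichedFunctor V I C)

/-- The object of families of maps `F i ⟶ G i`. -/
abbrev famHom : V := ∏ᶜ fun i : I => (F.obj i ⟶[V] G.obj i)

/-- The object of families of maps `F i ⟶ G j` indexed by the maps `i ⟶ j`. -/
abbrev famHom₂ : V := ∏ᶜ fun p : I × I => ((p.1 ⟶[V] p.2) ⟶[V] (F.obj p.1 ⟶[V] G.obj p.2))

/-- The transpose of `I(i, j) ⊗ C(F j, G j) ⟶ C(F i, F j) ⊗ C(F j, G j) ⟶ C(F i, G j)`. -/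
def natLeft : famHom F G ⟶ famHom₂ F G :=
  Pi.lift fun p => MonoidalClosed.curry (el (fst _ _ ≫ F.map p.1 p.2) (snd _ _ ≫ Pi.π _ p.2))

/-- The transpose of `C(F i, G i) ⊗ I(i, j) ⟶ C(F i, G i) ⊗ C(G i, G j) ⟶ C(F i, G j)`. -/
def natRight : famHom F G ⟶ famHom₂ F G :=
  Pi.lift fun p => MonoidalClosed.curry (el (snd _ _ ≫ Pi.π _ p.1) (fst _ _ ≫ G.map p.1 p.2))

/-- The hom-object from `F` to `G` in the `V`-category of `V`-functors. -/
abbrev natHom : V := equalizer (natLeft F G) (natRight F G)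

end

variable {F G : EnrichedFunctor V I C}

/-- The components of the elements of the hom-object. -/
def natπ (F G : EnrichedFunctor V I C) (i : I) : natHom F G ⟶ (F.obj i ⟶[V] G.obj i) :=
  equalizer.ι (natLeft F G) (natRight F G) ≫ Pi.π _ i

lemma natHom_ext {T : V} {k l : T ⟶ natHom F G} (h : ∀ i, k ≫ natπ F G i = l ≫ natπ F G i) :
    k = l := by
  apply equalizer.hom_ext
  apply Pi.hom_ext
  intro i
  simpa only [natπ, Category.assoc] using h i

lemma fam_eq_iff {T : V} (a : T ⟶ famHom F G) :
    a ≫ natLeft F G = a ≫ natRight F G ↔ ∀ i j : I,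
      el (fst (i ⟶[V] j) T ≫ F.map i j) (snd _ _ ≫ a ≫ Pi.π _ j) =
        el (snd (i ⟶[V] j) T ≫ a ≫ Pi.π _ i) (fst _ _ ≫ G.map i j) := by
  have h₁ (i j : I) : (a ≫ natLeft F G) ≫ Pi.π _ (i, j) = MonoidalClosed.curry
      (el (fst (i ⟶[V] j) T ≫ F.map i j) (snd _ _ ≫ a ≫ Pi.π _ j)) := by
    rw [natLeft, Category.assoc, Pi.lift_π, ← MonoidalClosed.curry_natural_left, comp_el]
    simp
  have h₂ (i j : I) : (a ≫ natRight F G) ≫ Pi.π _ (i, j) = MonoidalClosed.curry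
      (el (snd (i ⟶[V] j) T ≫ a ≫ Pi.π _ i) (fst _ _ ≫ G.map i j)) := by
    rw [natRight, Category.assoc, Pi.lift_π, ← MonoidalClosed.curry_natural_left, comp_el]
    simp
  constructor
  · intro h i j
    apply MonoidalClosed.curry_injective
    rw [← h₁, ← h₂, h]
  · intro h
    apply Pi.hom_ext
    rintro ⟨i, j⟩
    rw [h₁, h₂, h]

/-- Elements of the hom-object are natural families. -/
def natLift {T : V} (a : ∀ i : I, T ⟶ (F.obj i ⟶[V] G.obj i))
    (h : ∀ i j : I, el (fst (i ⟶[V] j) T ≫ F.map i j) (snd _ _ ≫ a j) =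
      el (snd (i ⟶[V] j) T ≫ a i) (fst _ _ ≫ G.map i j)) : T ⟶ natHom F G :=
  equalizer.lift (Pi.lift a) ((fam_eq_iff _).2 fun i j => by
    rw [Pi.lift_π, Pi.lift_π]
    exact h i j)

lemma natLift_π {T : V} (a : ∀ i : I, T ⟶ (F.obj i ⟶[V] G.obj i))
    (h : ∀ i j : I, el (fst (i ⟶[V] j) T ≫ F.map i j) (snd _ _ ≫ a j) =
      el (snd (i ⟶[V] j) T ≫ a i) (fst _ _ ≫ G.map i j)) (i : I) :
    natLift a h ≫ natπ F G i = a i := by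
  rw [natπ, natLift, ← Category.assoc, equalizer.lift_ι, Pi.lift_π]

lemma natHom_w {T : V} {i j : I} (f : T ⟶ (i ⟶[V] j)) (t : T ⟶ natHom F G) :
    el (f ≫ F.map i j) (t ≫ natπ F G j) = el (t ≫ natπ F G i) (f ≫ G.map i j) := by
  have h := lift f t ≫= (fam_eq_iff (equalizer.ι (natLeft F G) (natRight F G))).1
    (equalizer.condition _ _) i j
  rw [comp_el, comp_el] at h
  simpa [natπ] using h

/-- The element of the hom-object given by a `V`-natural transformation. -/
def natElem (α : VNatTrans F G) : 𝟙_ V ⟶ natHom F G :=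
  natLift α.app fun _ _ => α.nat _ _

end

/-! ### Presheaves -/

section
variable {V : Type u} [Category.{v} V] [CartesianMonoidalCategory V]
variable {C : Type w} [EnrichedCategory V C]

attribute [local instance] BraidedCategory.ofCartesianMonoidalCategory

lemma el_op {X Y Z : C} {T : V} (f : T ⟶ (Y ⟶[V] X)) (g : T ⟶ (Z ⟶[V] Y)) :
    lift f g ≫ eComp V (Opposite.op X) (Opposite.op Y) (Opposite.op Z) = el g f := by
  rw [el, eComp_op_eq]
  have h : lift f g ≫ (β_ _ _).hom = lift g f := by
    apply CartesianMonoidalCategory.hom_ext <;> simp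
  rw [← h, Category.assoc]

lemma lift_op {X Y Z : C} {P : V} :
    snd P ((Y ⟶[V] X) ⊗ (Z ⟶[V] Y)) ≫
      eComp V (Opposite.op X) (Opposite.op Y) (Opposite.op Z) =
    el (snd P ((Y ⟶[V] X) ⊗ (Z ⟶[V] Y)) ≫ snd _ _)
      (snd P ((Y ⟶[V] X) ⊗ (Z ⟶[V] Y)) ≫ fst _ _) := by
  rw [← el_op]
  refine congrArg (fun t => t ≫ eComp V (Opposite.op X) (Opposite.op Y) (Opposite.op Z)) ?_
  apply CartesianMonoidalCategory.hom_ext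
  · exact (lift_fst _ _).symm
  · exact (lift_snd _ _).symm

variable [MonoidalClosed V]

lemma ev_comp {X Y Z T : V} (x : T ⟶ X) (f : T ⟶ (ihom X).obj Y) (g : T ⟶ (ihom Y).obj Z) :
    lift x (lift f g) ≫ MonoidalClosed.compTranspose X Y Z =
      lift (lift x f ≫ (ihom.ev X).app Y) g ≫ (ihom.ev Y).app Z := by
  rw [MonoidalClosed.compTranspose_eq, lift_lift_associator_inv_assoc, lift_whiskerRight_assoc]

lemma ev_curry {X Y Z T : V} (act : X ⊗ Z ⟶ Y) (x : T ⟶ X) (f : T ⟶ Z) :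
    lift x (f ≫ MonoidalClosed.curry act) ≫ (ihom.ev X).app Y = lift x f ≫ act := by
  rw [← lift_whiskerLeft_assoc, MonoidalClosed.whiskerLeft_curry_ihom_ev_app]

lemma curry_id {P M : V} (i : 𝟙_ V ⟶ M) (a : P ⊗ M ⟶ P)
    (h : lift (𝟙 P) (toUnit _ ≫ i) ≫ a = 𝟙 P) :
    i ≫ MonoidalClosed.curry a = MonoidalClosed.id P := by
  rw [MonoidalClosed.id_eq, ← MonoidalClosed.curry_natural_left]
  congr 1
  have h' := (ρ_ P).hom ≫= h
  rw [Category.comp_id] at h'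
  rw [← h', ← Category.assoc]
  congr 1
  apply CartesianMonoidalCategory.hom_ext
  · simp [rightUnitor_hom]
  · rw [whiskerLeft_snd, Category.assoc, lift_snd, ← Category.assoc]
    congr 1
    exact toUnit_unique _ _

lemma curry_comp {P Q R M N K : V} (c : M ⊗ N ⟶ K) (a₁ : P ⊗ M ⟶ Q) (a₂ : Q ⊗ N ⟶ R)
    (a₃ : P ⊗ K ⟶ R)
    (h : lift (fst P (M ⊗ N)) (snd P (M ⊗ N) ≫ c) ≫ a₃ =
      lift (lift (fst P (M ⊗ N)) (snd P (M ⊗ N) ≫ fst M N) ≫ a₁)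
        (snd P (M ⊗ N) ≫ snd M N) ≫ a₂) :
    c ≫ MonoidalClosed.curry a₃ =
      (MonoidalClosed.curry a₁ ⊗ₘ MonoidalClosed.curry a₂) ≫ MonoidalClosed.comp P Q R := by
  rw [MonoidalClosed.comp_eq, ← MonoidalClosed.curry_natural_left,
    ← MonoidalClosed.curry_natural_left]
  congr 1
  have e₁ : P ◁ c = lift (fst P (M ⊗ N)) (snd P (M ⊗ N) ≫ c) := by
    apply CartesianMonoidalCategory.hom_ext <;> simp
  have e₂ : P ◁ (MonoidalClosed.curry a₁ ⊗ₘ MonoidalClosed.curry a₂) =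
      lift (fst P (M ⊗ N)) (lift ((snd P (M ⊗ N) ≫ fst M N) ≫ MonoidalClosed.curry a₁)
        ((snd P (M ⊗ N) ≫ snd M N) ≫ MonoidalClosed.curry a₂)) := by
    apply CartesianMonoidalCategory.hom_ext
    · simp
    · rw [whiskerLeft_snd, lift_snd]
      apply CartesianMonoidalCategory.hom_ext <;> simp
  rw [e₁, e₂, ev_comp, ev_curry]
  exact h.trans (ev_curry _ _ _).symm

lemma curry_ext {P Q M : V} {a b : M ⟶ (ihom P).obj Q}
    (h : lift (fst P M) (snd P M ≫ a) ≫ (ihom.ev P).app Q =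
      lift (fst P M) (snd P M ≫ b) ≫ (ihom.ev P).app Q) : a = b := by
  apply MonoidalClosed.uncurry_injective
  have e (c : M ⟶ (ihom P).obj Q) : P ◁ c = lift (fst P M) (snd P M ≫ c) := by
    apply CartesianMonoidalCategory.hom_ext <;> simp
  rw [MonoidalClosed.uncurry_eq, MonoidalClosed.uncurry_eq, e, e, h]

lemma ev_lift_comp {X Y Z T : V} (x : T ⟶ X) (f : T ⟶ (ihom X).obj Y) (g : T ⟶ (ihom Y).obj Z) :
    lift x (lift f g ≫ MonoidalClosed.comp X Y Z) ≫ (ihom.ev X).app Z =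
      lift (lift x f ≫ (ihom.ev X).app Y) g ≫ (ihom.ev Y).app Z := by
  rw [MonoidalClosed.comp_eq]
  exact (ev_curry _ _ _).trans (ev_comp x f g)

lemma ev_curry_fst {P Q T : V} (φ : P ⟶ Q) (x : T ⟶ P) (e : T ⟶ 𝟙_ V) :
    lift x (e ≫ MonoidalClosed.curry (fst P (𝟙_ V) ≫ φ)) ≫ (ihom.ev P).app Q = x ≫ φ := by
  rw [ev_curry, lift_fst_assoc]

lemma curry_nat {P P' Q Q' M : V} (a : P ⊗ M ⟶ P') (φ : P ⟶ Q) (φ' : P' ⟶ Q')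
    (m : M ⟶ (ihom Q).obj Q')
    (h : a ≫ φ' = lift (fst P M ≫ φ) (snd P M ≫ m) ≫ (ihom.ev Q).app Q') :
    lift (MonoidalClosed.curry a) (toUnit M ≫ MonoidalClosed.curry (fst P' (𝟙_ V) ≫ φ')) ≫
        MonoidalClosed.comp P P' Q' =
      lift (toUnit M ≫ MonoidalClosed.curry (fst P (𝟙_ V) ≫ φ)) m ≫
        MonoidalClosed.comp P Q Q' := by
  apply curry_ext
  rw [← Category.assoc (snd P M), ← Category.assoc (snd P M), comp_lift, comp_lift,
    ev_lift_comp, ev_lift_comp, ev_curry, ← Category.assoc (snd P M) (toUnit M),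
    ← Category.assoc (snd P M) (toUnit M)]
  refine (ev_curry_fst φ' _ _).trans ?_
  rw [ev_curry_fst]
  refine Eq.trans ?_ h
  refine congrArg (fun t => t ≫ φ') ?_
  refine (congrArg (fun t => t ≫ a) ?_).trans (Category.id_comp a)
  apply CartesianMonoidalCategory.hom_ext <;> simp

attribute [local instance] MonoidalClosed.enrichedCategorySelf

variable (V C) in
/-- The `V`-functors from the opposite of `C` to `V`. -/
abbrev VPresheaf := EnrichedFunctor V Cᵒᵖ V

/-- The `V`-functor from the opposite of `C` to `V` that is given on hom-objects by the transposes
of the action maps `act A B`. -/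
def VPresheaf.ofAct (obj : C → V) (act : ∀ A B : C, obj B ⊗ (A ⟶[V] B) ⟶ obj A)
    (act_id : ∀ A, lift (𝟙 (obj A)) (toUnit _ ≫ eId V A) ≫ act A A = 𝟙 (obj A))
    (act_comp : ∀ (A B D : C) {T : V} (x : T ⟶ obj D) (f : T ⟶ (A ⟶[V] B)) (g : T ⟶ (B ⟶[V] D)),
      lift x (el f g) ≫ act A D = lift (lift x g ≫ act B D) f ≫ act A B) : VPresheaf V C where
  obj X := obj X.unop
  map X Y := MonoidalClosed.curry (act Y.unop X.unop)
  map_id X := curry_id (eId V X.unop) (act X.unop X.unop) (act_id X.unop)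
  map_comp X Y Z := curry_comp (eComp V X Y Z) (act Y.unop X.unop) (act Z.unop Y.unop)
    (act Z.unop X.unop)
    ((congrArg (fun t => lift (fst (obj X.unop) _) t ≫ act Z.unop X.unop) lift_op).trans
      (act_comp _ _ _ _ _ _))

/-- The action of a presheaf on generalized elements. -/
def VPresheaf.act (F : VPresheaf V C) {A B : C} {T : V} (x : T ⟶ F.obj (Opposite.op B))
    (f : T ⟶ (A ⟶[V] B)) : T ⟶ F.obj (Opposite.op A) :=
  lift x (f ≫ F.map (Opposite.op B) (Opposite.op A)) ≫
    (ihom.ev (F.obj (Opposite.op B))).app (F.obj (Opposite.op A))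

lemma VPresheaf.comp_act (F : VPresheaf V C) {A B : C} {S T : V} (k : S ⟶ T)
    (x : T ⟶ F.obj (Opposite.op B)) (f : T ⟶ (A ⟶[V] B)) :
    k ≫ F.act x f = F.act (k ≫ x) (k ≫ f) := by
  rw [VPresheaf.act, VPresheaf.act, ← Category.assoc, comp_lift, Category.assoc]

lemma VPresheaf.act_el (F : VPresheaf V C) {A B D : C} {T : V} (x : T ⟶ F.obj (Opposite.op D))
    (f : T ⟶ (A ⟶[V] B)) (g : T ⟶ (B ⟶[V] D)) :
    F.act x (el f g) = F.act (F.act x g) f := by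
  have h := F.map_comp (Opposite.op D) (Opposite.op B) (Opposite.op A)
  have h₁ : el f g ≫ F.map (Opposite.op D) (Opposite.op A) =
      lift (g ≫ F.map (Opposite.op D) (Opposite.op B)) (f ≫ F.map (Opposite.op B) (Opposite.op A))
        ≫ MonoidalClosed.comp _ _ _ := by
    refine (congrArg (fun t => t ≫ F.map (Opposite.op D) (Opposite.op A))
      (el_op (V := V) g f)).symm.trans ?_
    refine (Category.assoc _ _ _).trans ((congrArg (fun t => lift g f ≫ t) h).trans ?_)
    exact lift_map_assoc _ _ _ _ _
  rw [VPresheaf.act, h₁]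
  exact ev_lift_comp _ _ _

/-- `V`-natural transformations of presheaves from their components. -/
def VPresheaf.natOfAct {obj : C → V} {act : ∀ A B : C, obj B ⊗ (A ⟶[V] B) ⟶ obj A}
    {act_id : ∀ A, lift (𝟙 (obj A)) (toUnit _ ≫ eId V A) ≫ act A A = 𝟙 (obj A)}
    {act_comp : ∀ (A B D : C) {T : V} (x : T ⟶ obj D) (f : T ⟶ (A ⟶[V] B))
      (g : T ⟶ (B ⟶[V] D)),
      lift x (el f g) ≫ act A D = lift (lift x g ≫ act B D) f ≫ act A B}
    (F : VPresheaf V C) (φ : ∀ A : C, obj A ⟶ F.obj (Opposite.op A))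
    (h : ∀ A B : C, act A B ≫ φ A = F.act (fst _ _ ≫ φ B) (snd _ _)) :
    VNatTrans (VPresheaf.ofAct obj act act_id act_comp) F where
  app X := MonoidalClosed.curry (fst _ (𝟙_ V) ≫ φ X.unop)
  naturality X Y := curry_nat (act Y.unop X.unop) (φ X.unop) (φ Y.unop) (F.map X Y)
    (h Y.unop X.unop)

/-- The representable `V`-functor `C(-, L)`. -/
def homPresheaf (L : C) : VPresheaf V C :=
  VPresheaf.ofAct (fun A => (A ⟶[V] L)) (fun A B => el (snd _ _) (fst _ _))
    (fun A => by
      rw [comp_el, lift_snd, lift_fst, el_id_left])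
    (fun A B D T x f g => by
      rw [comp_el, comp_el, comp_el, lift_fst, lift_snd, lift_fst, lift_snd, lift_fst, lift_snd,
        el_assoc])

/-- The `V`-natural transformation `C(-, L) ⟶ F` corresponding to an element `x` of `F L`;
on generalized elements it is `f ↦ F(f)(x)`. -/
def yonedaMap (F : VPresheaf V C) (L : C) (x : 𝟙_ V ⟶ F.obj (Opposite.op L)) :
    VNatTrans (homPresheaf L) F :=
  VPresheaf.natOfAct F (fun A => F.act (toUnit (A ⟶[V] L) ≫ x) (𝟙 _)) (fun A B => by
    rw [VPresheaf.comp_act, VPresheaf.comp_act, Category.comp_id, Category.comp_id,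
      VPresheaf.act_el, ← Category.assoc, ← Category.assoc,
      toUnit_unique (el _ _ ≫ toUnit _) (toUnit _), toUnit_unique (fst _ _ ≫ toUnit _) (toUnit _)])

/-- `F` is represented by the object `L` and the element `x` of `F L`. -/
def IsRepresentedBy (F : VPresheaf V C) (L : C) (x : 𝟙_ V ⟶ F.obj (Opposite.op L)) : Prop :=
  (yonedaMap F L x).IsIso

section
variable [HasPullbacks V] [HasCoproducts.{w} V] [IsExtensive.{w} V]
variable {I : Type w} [EnrichedCategory V I] {D : Type w₂} [EnrichedCategory V D]

lemma cone_w {G : EnrichedFunctor V I D} {B : D} {T : V} {i j : I} (f : T ⟶ (i ⟶[V] j))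
    (t : T ⟶ natHom (constFunctor I B) G) :
    el (t ≫ natπ (constFunctor I B) G i) (f ≫ G.map i j) = t ≫ natπ (constFunctor I B) G j := by
  refine (natHom_w f t).symm.trans ?_
  refine Eq.trans ?_ (el_id_left (f ≫ toUnit _) (t ≫ natπ (constFunctor I B) G j))
  exact congrArg (fun k => el k (t ≫ natπ (constFunctor I B) G j)) (Category.assoc _ _ _).symm

/-- The precomposition action `[I, D](ΔB, G) ⊗ D(A, B) ⟶ [I, D](ΔA, G)`. -/
def coneAct (G : EnrichedFunctor V I D) (A B : D) :
    natHom (constFunctor I B) G ⊗ (A ⟶[V] B) ⟶ natHom (constFunctor I A) G :=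
  natLift (fun i => el (snd _ _) (fst _ _ ≫ natπ (constFunctor I B) G i)) (fun i j => by
    rw [comp_el, comp_el, el_assoc]
    have h := cone_w (fst (i ⟶[V] j) (natHom (constFunctor I B) G ⊗ (A ⟶[V] B)))
      (snd (i ⟶[V] j) (natHom (constFunctor I B) G ⊗ (A ⟶[V] B)) ≫ fst _ _)
    rw [Category.assoc] at h
    rw [h]
    have e := el_id_left (V := V) (A := A) (B := G.obj j) (T := (i ⟶[V] j) ⊗
      (natHom (constFunctor I B) G ⊗ (A ⟶[V] B))) (fst _ _ ≫ toUnit _)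
      (el (snd _ _ ≫ snd _ _) ((snd _ _ ≫ fst _ _) ≫ natπ (constFunctor I B) G j))
    simp only [Category.assoc] at e ⊢
    exact e)

lemma coneAct_π (G : EnrichedFunctor V I D) (A B : D) {T : V}
    (x : T ⟶ natHom (constFunctor I B) G) (f : T ⟶ (A ⟶[V] B)) (i : I) :
    (lift x f ≫ coneAct G A B) ≫ natπ (constFunctor I A) G i =
      el f (x ≫ natπ (constFunctor I B) G i) := by
  rw [Category.assoc, coneAct, natLift_π]
  refine (comp_el _ _ _).trans ?_
  rw [lift_snd, lift_fst_assoc]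

/-- The `V`-functor `[I, D](Δ(-), G)`. -/
def conePresheaf (G : EnrichedFunctor V I D) : VPresheaf V D :=
  VPresheaf.ofAct (fun A => natHom (constFunctor I A) G) (coneAct G)
    (fun A => natHom_ext fun i => by
      rw [coneAct_π, Category.id_comp]
      exact el_id_left _ _)
    (fun A B D T x f g => natHom_ext fun i => by
      rw [coneAct_π, coneAct_π, coneAct_π]
      exact el_assoc _ _ _)

/-- `(L, lam)` is a conical `V`-limit of `G`. -/
def IsConicalLimit (G : EnrichedFunctor V I D) (L : D) (lam : VNatTrans (constFunctor I L) G) :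
    Prop :=
  IsRepresentedBy (conePresheaf G) L (natElem lam)

end

end

/-! ### Internalizing `V`-natural transformations -/

section
variable {V : Type u} [Category.{v} V] [CartesianMonoidalCategory V] [MonoidalClosed V]
  [HasPullbacks V] [HasCoproducts.{w} V] [IsExtensive.{w} V]
variable {I : Type w} [EnrichedCategory V I] {C : Type w} [EnrichedCategory V C]

/-- The family of components of a `V`-natural transformation. -/
def intNatObj {F G : EnrichedFunctor V I C} (α : VNatTrans F G) : intObj V I ⟶ intMor V C :=
  Limits.Sigma.desc fun i => α.app i ≫ inM V (F.obj i) (G.obj i)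

lemma inO_natObj {F G : EnrichedFunctor V I C} (α : VNatTrans F G) (i : I) {T : V}
    (e : T ⟶ 𝟙_ V) :
    (e ≫ inO V i) ≫ intNatObj α = (e ≫ α.app i) ≫ inM V (F.obj i) (G.obj i) := by
  rw [Category.assoc, Category.assoc]
  congr 1
  exact Limits.Sigma.ι_desc _ _

lemma intObj_ext {W : V} {m m' : intObj V I ⟶ W}
    (h : ∀ i : I, (𝟙 _ ≫ inO V i) ≫ m = (𝟙 _ ≫ inO V i) ≫ m') : m = m' := by
  refine Limits.Sigma.hom_ext _ _ fun i => ?_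
  have := h i
  rw [Category.id_comp] at this
  exact this

/-- The internalization of a `V`-natural transformation. -/
def intNat {F G : EnrichedFunctor V I C} (α : VNatTrans F G) : Int V I ⟶ (Int V C).arr :=
  InternalCat.mkArr (J := Int V I) (A := Int V C) (intMap F) (intMap G) (intNatObj α)
    (intObj_ext fun i => (Category.assoc _ _ _).symm.trans
      ((congrArg (fun t => t ≫ intSrc V C) (inO_natObj α i (𝟙 _))).trans
        ((inM_src _ _ _).trans ((congrArg (fun t => t ≫ inO V (F.obj i))
          (toUnit_unique _ _)).trans (inO_map F i (𝟙 _)).symm))))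
    (intObj_ext fun i => (Category.assoc _ _ _).symm.trans
      ((congrArg (fun t => t ≫ intTgt V C) (inO_natObj α i (𝟙 _))).trans
        ((inM_tgt _ _ _).trans ((congrArg (fun t => t ≫ inO V (G.obj i))
          (toUnit_unique _ _)).trans (inO_map G i (𝟙 _)).symm))))
    (by
      refine int_ext (𝟙 _) fun i j T t a ha => ?_
      rw [Category.comp_id] at ha
      refine (Int_mul _ t (a ≫ F.map i j) (toUnit T ≫ α.app j) ?_ ?_).trans
        ((congrArg (fun k => k ≫ inM V (F.obj i) (G.obj j)) (α.nat a (toUnit T))).trans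
          (Int_mul _ t (toUnit T ≫ α.app i) (a ≫ G.map i j) ?_ ?_).symm)
      · exact (congrArg (fun k => k ≫ intMapMor F) ha).trans (inM_map F i j a)
      · refine (Category.assoc _ _ _).symm.trans ?_
        refine (congrArg (fun k => (k ≫ intTgt V I) ≫ intNatObj α) ha).trans ?_
        rw [inM_tgt, inO_natObj]
      · refine (Category.assoc _ _ _).symm.trans ?_
        refine (congrArg (fun k => (k ≫ intSrc V I) ≫ intNatObj α) ha).trans ?_
        rw [inM_src, inO_natObj]
      · exact (congrArg (fun k => k ≫ intMapMor G) ha).trans (inM_map G i j a))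

lemma intMap_const (L : C) : intMap (constFunctor I L) =
    InternalCat.toTerminal (Int V I) ≫ (Int V C).ofPoint (inO V L) := by
  apply InternalCat.hom_ext
  · refine intObj_ext fun i => (inO_map (constFunctor I L) i (𝟙 _)).trans ?_
    refine (congrArg (fun t => t ≫ inO V L)
      (toUnit_unique (𝟙 (𝟙_ V)) ((𝟙 _ ≫ inO V i) ≫ toUnit (intObj V I)))).trans
        (Category.assoc _ _ _)
  · refine int_ext (𝟙 _) fun i j T t a ha => ?_
    rw [Category.comp_id] at ha
    refine (congrArg (fun k => k ≫ intMapMor (constFunctor I L)) ha).trans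
      ((inM_map (constFunctor I L) i j a).trans ?_)
    refine Eq.trans ?_ ((inO_one (V := V) L (t ≫ toUnit (intMor V I))).symm.trans
      ((Category.assoc _ _ _).trans ((Category.assoc _ _ _).trans rfl)))
    refine congrArg (fun k => k ≫ inM V L L) ?_
    refine (Category.assoc _ _ _).symm.trans ?_
    exact congrArg (fun k => k ≫ eId V L) (toUnit_unique _ _)

/-- The element of the internal category of cones over the internalization of `G` that corresponds
to an object `L` and a `V`-natural transformation `lam` from the constant `V`-functor at `L`
to `G`. -/
def coneElement (G : EnrichedFunctor V I C) (L : C) (lam : VNatTrans (constFunctor I L) G) :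
    InternalCat.cst (𝟙_ V) ⟶ InternalCat.cones (intMap G) :=
  InternalCat.coneElem (intMap G) (inO V L) (intNat lam)
    ((InternalCat.mkArr_dom _ _ _ _ _ _).trans (intMap_const L)) (InternalCat.mkArr_cod _ _ _ _ _ _)

end

end

end EnrichedInternal

/-!
Both conditions are universal properties, and both can be read on generalized elements, where they
become the same unique-factorization statement.

On the enriched side, a `V`-natural transformation is invertible as soon as its components are, and
a map `f : P ⟶ Q` of `V` is invertible as soon as its name `𝟙_ V ⟶ [P, Q]` is. Hence `(L, lam)` is a
conical limit if and only if, for every object `A` and every stage `T`, each cone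
`T ⟶ natHom (constFunctor I A) G` factors through `lam` by a unique `f : T ⟶ C(A, L)`
(`isConicalLimit_iff`).

On the internal side, an element is internally terminal if and only if every generalized object has
a unique generalized morphism to it (`InternalCat.isInternalTerminal_iff`): the generic such
morphism is the natural transformation out of which the inverse of the slice projection is built.
For the category of cones over `K`, this says that each cone at stage `X`, with apex an arbitrary
`c : X ⟶ B.obj`, factors uniquely through the given one (`InternalCat.isInternalLimit_iff`).

The difference between the two is that an internal cone may have an apex that varies along `X`,
whereas the apex of an enriched cone is a fixed object. If the apex is a fixed object `A`,
extensivity identifies internal cones with enriched ones (`exists_internal_cone`,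
`exists_enriched_cone`) and their factorizations as well (`exists_eq_inM`, `isConeFactor_inM_iff`);
here `Int I ⊗ T` is decomposed into copies of `T` and of the `I(i, j) ⊗ T`. For a general
`c : X ⟶ ∐ 1`, extensivity decomposes `X` into the pieces over the objects `A` of `C`, and the
factorizations over the pieces, being unique, glue (`existsUnique_isConeFactor_of_local`).
-/

namespace EnrichedInternal

/-! ### Conical limits on generalized elements -/

lemma isIso_iff_existsUnique {V : Type u} [Category.{v} V] {P Q : V} (f : P ⟶ Q) :
    IsIso f ↔ ∀ {T : V} (k : T ⟶ Q), ∃! l : T ⟶ P, l ≫ f = k := by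
  constructor
  · intro hf T k
    exact ⟨k ≫ inv f, by simp, fun l hl => by rw [← hl]; simp⟩
  · intro h
    obtain ⟨g, hg, -⟩ := h (𝟙 Q)
    exact ⟨g, (h f).unique (by simp [hg]) (by simp), hg⟩

section
variable {V : Type u} [Category.{v} V] [CartesianMonoidalCategory V]
variable {C : Type w} [EnrichedCategory V C] {D : Type w₂} [EnrichedCategory V D]

/-- A `V`-natural transformation is invertible as soon as its components are: naturality of the
inverse is automatic. -/
lemma VNatTrans.isIso_iff {F G : EnrichedFunctor V C D} (α : VNatTrans F G) :
    α.IsIso ↔ ∀ X, ∃ b : 𝟙_ V ⟶ (G.obj X ⟶[V] F.obj X),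
      el (α.app X) b = eId V (F.obj X) ∧ el b (α.app X) = eId V (G.obj X) := by
  constructor
  · rintro ⟨β, h₁, h₂⟩ X
    exact ⟨β.app X, congrArg (fun γ => VNatTrans.app γ X) h₁,
      congrArg (fun γ => VNatTrans.app γ X) h₂⟩
  · intro h
    choose b h₁ h₂ using h
    refine ⟨⟨b, fun X Y => ?_⟩, VNatTrans.ext (funext h₁), VNatTrans.ext (funext h₂)⟩
    -- `G f ≫ b = b ≫ α ≫ G f ≫ b = b ≫ F f ≫ α ≫ b = b ≫ F f`
    have e₁ := el_id_left (toUnit (X ⟶[V] Y)) (G.map X Y)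
    rw [← h₂ X, comp_el, el_assoc, ← α.naturality X Y] at e₁
    rw [← e₁, el_assoc, el_assoc, ← comp_el, h₁ Y, el_id_right]

variable [MonoidalClosed V]

attribute [local instance] MonoidalClosed.enrichedCategorySelf
  BraidedCategory.ofCartesianMonoidalCategory

/-- Every element of an internal hom is the name of a map. -/
lemma curry_fst_ev {P Q : V} (b : 𝟙_ V ⟶ (ihom P).obj Q) :
    MonoidalClosed.curry (fst P (𝟙_ V) ≫
      lift (𝟙 P) (toUnit P ≫ b) ≫ (ihom.ev P).app Q) = b := by
  apply curry_ext
  rw [ev_curry, lift_fst_assoc, ← Category.assoc (fst P (𝟙_ V)), comp_lift, Category.comp_id,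
    ← Category.assoc (fst P (𝟙_ V)), toUnit_unique (fst P (𝟙_ V) ≫ toUnit P) (snd P (𝟙_ V))]
  rfl

lemma curry_fst_injective {P Q : V} {f g : P ⟶ Q}
    (h : MonoidalClosed.curry (fst P (𝟙_ V) ≫ f) = MonoidalClosed.curry (fst P (𝟙_ V) ≫ g)) :
    f = g := by
  have := lift (𝟙 P) (toUnit P) ≫= MonoidalClosed.curry_injective h
  simpa using this

lemma el_curry_fst {P Q R : V} (f : P ⟶ Q) (g : Q ⟶ R) :
    el (V := V) (C := V) (A := P) (B := Q) (D := R) (MonoidalClosed.curry (fst P (𝟙_ V) ≫ f))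
      (MonoidalClosed.curry (fst Q (𝟙_ V) ≫ g)) =
        MonoidalClosed.curry (fst P (𝟙_ V) ≫ f ≫ g) := by
  apply curry_ext
  refine (congrArg (fun t => lift (fst P (𝟙_ V)) t ≫ (ihom.ev P).app R)
    ((comp_el _ _ _ : snd P (𝟙_ V) ≫ el (V := V) (C := V) _ _ = _))).trans ?_
  refine (ev_lift_comp _ _ _).trans ?_
  rw [ev_curry_fst]
  refine (ev_curry_fst g _ _).trans ?_
  rw [ev_curry_fst]
  simp

lemma eId_eq_curry_fst (P : V) :
    (eId V P : 𝟙_ V ⟶ (ihom P).obj P) = MonoidalClosed.curry (fst P (𝟙_ V) ≫ 𝟙 P) := by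
  have := curry_id (𝟙 (𝟙_ V)) (fst P (𝟙_ V) ≫ 𝟙 P) (by simp)
  rw [Category.id_comp] at this
  exact this.symm

/-- The name of a map is invertible in `V`, as enriched over itself, if and only if the map is. -/
lemma exists_curry_fst_inverse_iff {P Q : V} (f : P ⟶ Q) :
    (∃ b : 𝟙_ V ⟶ (ihom Q).obj P,
      el (V := V) (C := V) (A := P) (B := Q) (D := P) (MonoidalClosed.curry (fst P (𝟙_ V) ≫ f)) b =
        eId V P ∧
      el (V := V) (C := V) (A := Q) (B := P) (D := Q) b (MonoidalClosed.curry (fst P (𝟙_ V) ≫ f)) =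
        eId V Q) ↔ IsIso f := by
  constructor
  · rintro ⟨b, h₁, h₂⟩
    rw [← curry_fst_ev b] at h₁ h₂
    refine ⟨lift (𝟙 Q) (toUnit Q ≫ b) ≫ (ihom.ev Q).app P, curry_fst_injective ?_,
      curry_fst_injective ?_⟩
    · exact (el_curry_fst _ _).symm.trans (h₁.trans (eId_eq_curry_fst P))
    · exact (el_curry_fst _ _).symm.trans (h₂.trans (eId_eq_curry_fst Q))
  · intro hf
    refine ⟨MonoidalClosed.curry (fst Q (𝟙_ V) ≫ inv f), ?_, ?_⟩
    · refine (el_curry_fst _ _).trans (Eq.trans ?_ (eId_eq_curry_fst P).symm)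
      rw [IsIso.hom_inv_id]
    · refine (el_curry_fst _ _).trans (Eq.trans ?_ (eId_eq_curry_fst Q).symm)
      rw [IsIso.inv_hom_id]

lemma isRepresentedBy_iff (F : VPresheaf V C) (L : C) (x : 𝟙_ V ⟶ F.obj (Opposite.op L)) :
    IsRepresentedBy F L x ↔ ∀ A : C, IsIso (F.act (toUnit (A ⟶[V] L) ≫ x) (𝟙 _)) := by
  refine (VNatTrans.isIso_iff _).trans
    ⟨fun h A => (exists_curry_fst_inverse_iff _).1 (h (Opposite.op A)),
      fun h A => (exists_curry_fst_inverse_iff _).2 (h A.unop)⟩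

end

section
variable {V : Type u} [Category.{v} V] [CartesianMonoidalCategory V] [MonoidalClosed V]
  [HasPullbacks V] [HasCoproducts.{w} V] [IsExtensive.{w} V]
variable {I : Type w} [EnrichedCategory V I] {D : Type w₂} [EnrichedCategory V D]

lemma conePresheaf_act_π (G : EnrichedFunctor V I D) {A B : D} {T : V}
    (x : T ⟶ natHom (constFunctor I B) G) (f : T ⟶ (A ⟶[V] B)) (i : I) :
    (conePresheaf G).act (A := A) (B := B) x f ≫ natπ (constFunctor I A) G i =
      el f (x ≫ natπ (constFunctor I B) G i) :=
  (congrArg (fun t => t ≫ natπ (constFunctor I A) G i) (ev_curry (coneAct G A B) x f)).trans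
    (coneAct_π G A B x f i)

/-- The universal property of a conical limit, at every stage `T` and for every apex `A`. -/
theorem isConicalLimit_iff (G : EnrichedFunctor V I D) (L : D)
    (lam : VNatTrans (constFunctor I L) G) :
    IsConicalLimit G L lam ↔ ∀ (A : D) {T : V} (k : T ⟶ natHom (constFunctor I A) G),
      ∃! f : T ⟶ (A ⟶[V] L), ∀ i, el f (toUnit T ≫ lam.app i) = k ≫ natπ _ G i := by
  refine (isRepresentedBy_iff (conePresheaf G) L (natElem lam)).trans (forall_congr' fun A =>
    (isIso_iff_existsUnique _).trans (forall_congr' fun T => forall_congr' fun k =>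
      existsUnique_congr fun f => ?_))
  have e (i : I) : (f ≫ (conePresheaf G).act (A := A) (B := L)
      (toUnit (A ⟶[V] L) ≫ natElem lam) (𝟙 _)) ≫ natπ (constFunctor I A) G i =
        el f (toUnit T ≫ lam.app i) := by
    refine (Category.assoc _ _ _).trans ((congrArg (fun t => f ≫ t)
      (conePresheaf_act_π G (toUnit (A ⟶[V] L) ≫ natElem lam) (𝟙 _) i)).trans ?_)
    rw [comp_el, Category.comp_id, Category.assoc, natElem, natLift_π, ← Category.assoc,
      toUnit_unique (f ≫ toUnit _) (toUnit T)]
  constructor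
  · intro h i
    rw [← e, ← h]
    rfl
  · intro h
    exact natHom_ext fun i => (e i).trans (h i)

end

/-! ### Internal terminal objects on generalized elements -/

namespace InternalCat

section
variable {V : Type u} [Category.{v} V] [HasPullbacks V] [CartesianMonoidalCategory V]

/-- An element is internally terminal if and only if every generalized object has a unique
generalized morphism to it. The inverse of the projection from the slice is assembled from the
generic such morphism. -/
theorem isInternalTerminal_iff (A : InternalCat V) (T : cst (𝟙_ V) ⟶ A) :
    IsInternalTerminal A T ↔ ∀ {X : V} (x : X ⟶ A.obj),
      ∃! p : X ⟶ A.mor, p ≫ A.src = x ∧ p ≫ A.tgt = toUnit X ≫ T.obj := by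
  let q : slice A T ⟶ A.arr := pbSnd (prodLift (𝟙 A) (toTerminal A ≫ T)) (arrEnds A)
  have hw : sliceProj A T ≫ prodLift (𝟙 A) (toTerminal A ≫ T) = q ≫ arrEnds A :=
    pb_isPullback.w
  have hqd : q ≫ A.arrDom = sliceProj A T := by
    have := hw =≫ prodFst A A
    simpa [arrEnds] using this.symm
  have hqc : q ≫ A.arrCod = sliceProj A T ≫ toTerminal A ≫ T := by
    have := hw =≫ prodSnd A A
    simpa [arrEnds] using this.symm
  constructor
  · rintro ⟨s, hs₁, hs₂⟩ X x
    have hd : (s ≫ q) ≫ A.arrDom = 𝟙 A := by rw [Category.assoc, hqd, hs₂]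
    have hc : (s ≫ q) ≫ A.arrCod = toTerminal A ≫ T := by
      rw [Category.assoc, hqc, reassoc_of% hs₂]
    have hd' : (s ≫ q).obj ≫ A.src = 𝟙 A.obj := congrArg Hom.obj hd
    have hc' : (s ≫ q).obj ≫ A.tgt = toUnit _ ≫ T.obj := congrArg Hom.obj hc
    refine ⟨x ≫ (s ≫ q).obj, ⟨by rw [Category.assoc, hd', Category.comp_id], ?_⟩, ?_⟩
    · rw [Category.assoc, hc', ← Category.assoc, toUnit_unique (x ≫ toUnit _) (toUnit X)]
    · rintro p ⟨h₁, h₂⟩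
      have hp : x ≫ (prodLift (𝟙 A) (toTerminal A ≫ T)).obj = p ≫ (arrEnds A).obj := by
        apply prodObj_ext
        · rw [Category.assoc, Category.assoc]
          refine Eq.trans ?_ (h₁.symm.trans (congrArg (fun t => p ≫ t)
            (congrArg Hom.obj (prodLift_fst A.arrDom A.arrCod)).symm))
          exact (congrArg (fun t => x ≫ t) (congrArg Hom.obj (prodLift_fst _ _))).trans
            (Category.comp_id x)
        · rw [Category.assoc, Category.assoc]
          refine Eq.trans ?_ (h₂.symm.trans (congrArg (fun t => p ≫ t)
            (congrArg Hom.obj (prodLift_snd A.arrDom A.arrCod)).symm))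
          refine (congrArg (fun t => x ≫ t) (congrArg Hom.obj (prodLift_snd _ _))).trans ?_
          refine (Category.assoc _ _ _).symm.trans ?_
          exact congrArg (fun t => t ≫ T.obj) (toUnit_unique _ _)
      have e₁ : pbObj x p hp ≫ (sliceProj A T).obj = x := pullback.lift_fst _ _ _
      have e₂ : pbObj x p hp ≫ q.obj = p := pullback.lift_snd _ _ _
      have e₃ : (sliceProj A T).obj ≫ s.obj = 𝟙 _ := congrArg Hom.obj hs₁
      refine e₂.symm.trans (Eq.trans ?_ (congrArg (fun t => t ≫ (s ≫ q).obj) e₁))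
      rw [comp_obj, Category.assoc, reassoc_of% e₃]
  · intro h
    obtain ⟨p, ⟨hs, ht⟩, -⟩ := h (𝟙 A.obj)
    have uniq {X : V} (k l : X ⟶ A.mor) (e : k ≫ A.src = l ≫ A.src)
        (hk : k ≫ A.tgt = toUnit X ≫ T.obj) (hl : l ≫ A.tgt = toUnit X ≫ T.obj) : k = l :=
      (h (k ≫ A.src)).unique ⟨rfl, hk⟩ ⟨e.symm, hl⟩
    have hu {X Y : V} (k : X ⟶ Y) : k ≫ toUnit Y ≫ T.obj = toUnit X ≫ T.obj := by
      rw [← Category.assoc, toUnit_unique (k ≫ toUnit Y) (toUnit X)]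
    let S : A ⟶ A.arr := mkArr (𝟙 A) (toTerminal A ≫ T) p hs ht (by
      apply uniq
      · rw [mul_src, mul_src, Category.assoc, hs, Category.comp_id, id_mor, Category.id_comp]
      · rw [mul_tgt, Category.assoc, ht, hu]
      · rw [mul_tgt, Hom.mor_tgt]
        exact hu A.tgt)
    let s : A ⟶ slice A T := pbLift (𝟙 A) S (by
      apply prod_hom_ext
      · rw [arrEnds, Category.assoc, Category.assoc, prodLift_fst, prodLift_fst]
        exact (Category.id_comp _).trans (mkArr_dom _ _ _ _ _ _).symm
      · rw [arrEnds, Category.assoc, Category.assoc, prodLift_snd, prodLift_snd]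
        exact (Category.id_comp _).trans (mkArr_cod _ _ _ _ _ _).symm)
    have hs₁ : s ≫ sliceProj A T = 𝟙 A := hom_ext (pbObj_fst _ _ _) (pbMor_fst _ _ _)
    have hs₂ : s ≫ q = S := hom_ext (pbObj_snd _ _ _) (pbMor_snd _ _ _)
    have hd : S ≫ A.arrDom = 𝟙 A := mkArr_dom _ _ _ _ _ _
    have hc : S ≫ A.arrCod = toTerminal A ≫ T := mkArr_cod _ _ _ _ _ _
    refine ⟨s, ?_, hs₁⟩
    apply pb_isPullback.hom_ext
    · exact (Category.assoc _ _ _).trans ((congrArg (fun t => sliceProj A T ≫ t) hs₁).trans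
        ((Category.comp_id _).trans (Category.id_comp _).symm))
    · refine (Category.assoc _ _ _).trans ((congrArg (fun t => sliceProj A T ≫ t) hs₂).trans
        (Eq.trans ?_ (Category.id_comp _).symm))
      change sliceProj A T ≫ S = q
      have e₁ : (sliceProj A T ≫ S) ≫ A.arrDom = q ≫ A.arrDom := by
        rw [Category.assoc, hd, hqd, Category.comp_id]
      have e₂ : (sliceProj A T ≫ S) ≫ A.arrCod = q ≫ A.arrCod := by
        rw [Category.assoc, hc, hqc]
      have e₃ : q.obj ≫ A.tgt = toUnit _ ≫ T.obj :=
        (congrArg Hom.obj hqc).trans (hu (sliceProj A T).obj)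
      exact arr_ext (uniq _ _ (congrArg Hom.obj e₁) ((congrArg Hom.obj e₂).trans e₃) e₃) e₁ e₂

end

end InternalCat

/-! ### Internal limits on generalized elements -/

namespace InternalCat

section
variable {V : Type u} [Category.{v} V] [HasPullbacks V] [CartesianMonoidalCategory V]
  {J B : InternalCat V} {X Y : V}

/-- A generalized morphism `f` of `B` is a factorization, through the cone with apex `l` and
components `τ`, of the cone with apex `c` and components `h`: it goes from `c` to `l`, and
composing it with `τ` gives `h`. Both cones are given by the underlying maps only; the composite
is formed at the stage `J.obj ⊗ X`. Composability is quantified over because it is not part of the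
data; it holds automatically when `τ` starts at `l`. -/
def IsConeFactor (l : 𝟙_ V ⟶ B.obj) (τ : J.obj ⟶ B.mor) (c : X ⟶ B.obj)
    (h : J.obj ⊗ X ⟶ B.mor) (f : X ⟶ B.mor) : Prop :=
  f ≫ B.src = c ∧ f ≫ B.tgt = toUnit X ≫ l ∧
    ∀ e : (snd J.obj X ≫ f) ≫ B.tgt = (fst J.obj X ≫ τ) ≫ B.src,
      B.mul (snd J.obj X ≫ f) (fst J.obj X ≫ τ) e = h

lemma IsConeFactor.comp {l : 𝟙_ V ⟶ B.obj} {τ : J.obj ⟶ B.mor} {c : X ⟶ B.obj}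
    {h : J.obj ⊗ X ⟶ B.mor} {f : X ⟶ B.mor} (hf : IsConeFactor l τ c h f)
    (hτ : τ ≫ B.src = toUnit J.obj ≫ l) (t : Y ⟶ X) :
    IsConeFactor l τ (t ≫ c) (J.obj ◁ t ≫ h) (t ≫ f) := by
  obtain ⟨h₁, h₂, h₃⟩ := hf
  refine ⟨by rw [Category.assoc, h₁], ?_, fun e => ?_⟩
  · rw [Category.assoc, h₂, ← Category.assoc, toUnit_unique (t ≫ toUnit X) (toUnit Y)]
  · have e' : (snd J.obj X ≫ f) ≫ B.tgt = (fst J.obj X ≫ τ) ≫ B.src := by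
      rw [Category.assoc, h₂, Category.assoc, hτ, ← Category.assoc, ← Category.assoc,
        toUnit_unique (snd J.obj X ≫ toUnit X) (fst J.obj X ≫ toUnit J.obj)]
    rw [← h₃ e', whisker_mul]
    exact B.mul_congr (by rw [whiskerLeft_snd_assoc]) (by rw [whiskerLeft_fst_assoc]) e

variable [MonoidalClosed V]

lemma untr_diag_obj (c : X ⟶ B.obj) : untr (c ≫ (diag J B).obj) = constFam J c := by
  refine (untr_comp c (transpose (constFam J (𝟙 B.obj)))).trans ?_
  rw [untr_transpose, baseMap_constFam, Category.comp_id]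

lemma untr_diag_mor (f : X ⟶ B.mor) :
    untr (A := B.arr) (f ≫ (diag J B).mor) = constFam (A := B.arr) J f := by
  refine (untr_comp f (transpose (constFam (A := B.arr) J (𝟙 B.mor)))).trans ?_
  rw [untr_transpose, baseMap_constFam]
  exact congrArg (constFam (A := B.arr) J) (Category.comp_id _)

lemma untr_nameObj (F : J ⟶ B) : untr (toUnit X ≫ nameObj F) = prodFst J (cst X) ≫ F := by
  rw [untr_comp, nameObj, untr_transpose, ← Category.assoc, baseMap_fst]

section
variable (K : J ⟶ B)

/-- The functor from the category of cones that forgets the components. -/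
noncomputable abbrev conesApex : cones K ⟶ B := pbFst _ _

/-- The functor from the category of cones that remembers the components only. -/
noncomputable abbrev conesLegs : cones K ⟶ (internalHom J B).arr := pbSnd _ _

lemma conesLegs_dom : conesLegs K ≫ (internalHom J B).arrDom = conesApex K ≫ diag J B := by
  have h : conesApex K ≫ _ = conesLegs K ≫ arrEnds _ := pb_isPullback.w
  have := h =≫ prodFst _ _
  simpa [arrEnds] using this.symm

lemma conesLegs_cod : conesLegs K ≫ (internalHom J B).arrCod = toTerminal _ ≫ name K := by
  have h : conesApex K ≫ _ = conesLegs K ≫ arrEnds _ := pb_isPullback.w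
  have := h =≫ prodSnd _ _
  rw [Category.assoc, Category.assoc, prodLift_snd, arrEnds, prodLift_snd, ← Category.assoc,
    toTerminal_unique (conesApex K ≫ _) (toTerminal _)] at this
  exact this.symm

variable {K}

/-- A cone at stage `X` is a natural transformation at stage `X` from the constant functor at its
apex to `K`. -/
lemma untr_legs (x : X ⟶ (cones K).obj) :
    untr (A := B.arr) (x ≫ (conesLegs K).obj) ≫ B.arrDom = constFam J (x ≫ (conesApex K).obj) ∧
    untr (A := B.arr) (x ≫ (conesLegs K).obj) ≫ B.arrCod = prodFst J (cst X) ≫ K := by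
  constructor
  · rw [← untr_post, ← untr_diag_obj, Category.assoc, Category.assoc]
    exact congrArg (fun t => untr (x ≫ t)) (congrArg Hom.obj (conesLegs_dom K))
  · rw [← untr_post, ← untr_nameObj, Category.assoc]
    refine congrArg untr ((congrArg (fun t => x ≫ t)
      (congrArg Hom.obj (conesLegs_cod K))).trans ?_)
    refine (Category.assoc _ _ _).symm.trans ?_
    exact congrArg (fun t => t ≫ nameObj K) (toUnit_unique _ _)

lemma exists_cone {c : X ⟶ B.obj} {H : prod J (cst X) ⟶ B.arr} (hd : H ≫ B.arrDom = constFam J c)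
    (hc : H ≫ B.arrCod = prodFst J (cst X) ≫ K) : ∃ x : X ⟶ (cones K).obj,
      x ≫ (conesApex K).obj = c ∧ untr (A := B.arr) (x ≫ (conesLegs K).obj) = H := by
  have h₁ : transpose H ≫ post J B.arrDom = c ≫ (diag J B).obj := untr_injective (by
    rw [untr_post, untr_transpose, hd, untr_diag_obj])
  have h₂ : transpose H ≫ post J B.arrCod = toUnit X ≫ nameObj K := untr_injective (by
    rw [untr_post, untr_transpose, hc, untr_nameObj])
  have h : c ≫ (prodLift (diag J B) (toTerminal B ≫ name K)).obj =
      transpose H ≫ (arrEnds (internalHom J B)).obj := by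
    apply CartesianMonoidalCategory.hom_ext
    · refine (Category.assoc _ _ _).trans (Eq.trans ?_ (Category.assoc _ _ _).symm)
      refine (congrArg (fun t => c ≫ t) (lift_fst _ _)).trans (h₁.symm.trans ?_)
      exact congrArg (fun t => transpose H ≫ t) (lift_fst _ _).symm
    · refine (Category.assoc _ _ _).trans (Eq.trans ?_ (Category.assoc _ _ _).symm)
      refine (congrArg (fun t => c ≫ t) (lift_snd _ _)).trans (Eq.trans ?_ (h₂.symm.trans ?_))
      · refine (Category.assoc _ _ _).symm.trans ?_
        exact congrArg (fun t => t ≫ nameObj K) (toUnit_unique _ _)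
      · exact congrArg (fun t => transpose H ≫ t) (lift_snd _ _).symm
  refine ⟨pbObj c (transpose H) h, pbObj_fst _ _ _, ?_⟩
  exact (congrArg (untr (A := B.arr)) (pullback.lift_snd c (transpose H) h)).trans
    (untr_transpose H)

/-- Composition in the internal hom with a constant transformation is computed by composing with
each component. -/
lemma diag_mul_eq_iff {c : X ⟶ B.obj} {f : X ⟶ B.mor} {g h : X ⟶ (internalHom J B).mor}
    (hm : (f ≫ (diag J B).mor) ≫ (internalHom J B).tgt = g ≫ (internalHom J B).src)
    (hf : f ≫ B.src = c) (hd : untr (A := B.arr) h ≫ B.arrDom = constFam J c)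
    (hc : untr (A := B.arr) h ≫ B.arrCod = untr (A := B.arr) g ≫ B.arrCod) :
    (internalHom J B).mul (f ≫ (diag J B).mor) g hm = h ↔
      ∀ e : (snd J.obj X ≫ f) ≫ B.tgt = (untr (A := B.arr) g).obj ≫ B.src,
        B.mul (snd J.obj X ≫ f) (untr (A := B.arr) g).obj e = (untr (A := B.arr) h).obj := by
  have hfd : untr (A := B.arr) (f ≫ (diag J B).mor) ≫ B.arrCod = untr (A := B.arr) g ≫ B.arrDom :=
    untr_compat hm
  rw [internalHom_mul]
  have hv := vcomp_congr (untr_diag_mor (J := J) f) (rfl : untr (A := B.arr) g = _) hfd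
  have hdd : constFam (A := B.arr) J f ≫ B.arrDom = constFam J c :=
    (constFam_comp (A := B.arr) f B.arrDom).trans (congrArg (constFam J) hf)
  constructor
  · intro h' e
    have h₁ := (untr_transpose _).symm.trans (congrArg (untr (A := B.arr)) h')
    exact congrArg Hom.obj (hv.symm.trans h₁)
  · intro h'
    apply untr_injective
    rw [untr_transpose, hv]
    refine arr_ext (h' _) ?_ ?_
    · rw [vcomp_dom, hdd, hd]
    · rw [vcomp_cod, hc]

section
variable {l : 𝟙_ V ⟶ B.obj} {t : J ⟶ B.arr} (hd : t ≫ B.arrDom = toTerminal J ≫ B.ofPoint l)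
    (hc : t ≫ B.arrCod = K)

lemma toUnit_coneElem_apex :
    (toUnit X ≫ (coneElem K l t hd hc).obj) ≫ (conesApex K).obj = toUnit X ≫ l := by
  rw [Category.assoc]
  exact congrArg (fun k => toUnit X ≫ k) (pbObj_fst _ _ _)

lemma toUnit_coneElem_legs :
    (toUnit X ≫ (coneElem K l t hd hc).obj) ≫ (conesLegs K).obj = toUnit X ≫ nameObj t := by
  rw [Category.assoc]
  exact congrArg (fun k => toUnit X ≫ k) (pbObj_snd _ _ _)

/-- A morphism of cones to the given one is the same as a factorization. -/
lemma cone_mor_iff (x : X ⟶ (cones K).obj) (f : X ⟶ B.mor) :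
    (∃ p : X ⟶ (cones K).mor, p ≫ (cones K).src = x ∧
      p ≫ (cones K).tgt = toUnit X ≫ (coneElem K l t hd hc).obj ∧ p ≫ (conesApex K).mor = f) ↔
    IsConeFactor l t.obj (x ≫ (conesApex K).obj) (untr (A := B.arr) (x ≫ (conesLegs K).obj)).obj
      f := by
  -- Over the element `name K`, a morphism of the comma category is a commutative square of the
  -- internal hom with sides `f`, constant, and the identity of `K`; so commutativity of the square
  -- says that the constant transformation at `f` composed with `t` is the cone `x`.
  let E := internalHom J B
  have hg : (untr (A := B.arr) (toUnit X ≫ nameObj t)).obj = fst J.obj X ≫ t.obj :=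
    congrArg Hom.obj (untr_nameObj t)
  have hxc : untr (A := B.arr) (x ≫ (conesLegs K).obj) ≫ B.arrCod =
      untr (A := B.arr) (toUnit X ≫ nameObj t) ≫ B.arrCod := by
    rw [(untr_legs x).2, untr_nameObj, Category.assoc, hc]
  have hone {k : X ⟶ E.mor} (hk : untr (A := B.arr) k ≫ B.arrCod = prodFst J (cst X) ≫ K)
      (e : k ≫ E.tgt = (toUnit X ≫ nameObj K ≫ E.one) ≫ E.src) :
      E.mul k (toUnit X ≫ nameObj K ≫ E.one) e = k := by
    apply E.mul_one
    have : k ≫ E.tgt = toUnit X ≫ nameObj K := untr_injective (by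
      rw [untr_nameObj, ← hk]
      exact untr_post _ _)
    rw [← Category.assoc, ← Category.assoc, this]
  constructor
  · rintro ⟨p, hs, ht, rfl⟩
    have h₁ : (p ≫ (conesApex K).mor) ≫ B.src = x ≫ (conesApex K).obj := by
      rw [Category.assoc, (conesApex K).mor_src, ← hs, Category.assoc]
    have h₂ : (p ≫ (conesApex K).mor) ≫ B.tgt = toUnit X ≫ l := by
      rw [Category.assoc, (conesApex K).mor_tgt, ← Category.assoc, ht, toUnit_coneElem_apex]
    have hU : (p ≫ (conesLegs K).mor) ≫ E.sqU = (p ≫ (conesApex K).mor) ≫ (diag J B).mor := by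
      rw [Category.assoc, Category.assoc]
      exact congrArg (fun k => p ≫ k) (congrArg Hom.mor (conesLegs_dom K))
    have hV : (p ≫ (conesLegs K).mor) ≫ E.sqV = toUnit X ≫ nameObj K ≫ E.one := by
      rw [Category.assoc]
      refine (congrArg (fun k => p ≫ k) (congrArg Hom.mor (conesLegs_cod K))).trans ?_
      refine (Category.assoc _ _ _).symm.trans ?_
      exact congrArg (fun k => k ≫ nameObj K ≫ E.one) (toUnit_unique _ _)
    have hQ : (p ≫ (conesLegs K).mor) ≫ E.sqQ = toUnit X ≫ nameObj t := by
      rw [Category.assoc]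
      refine (congrArg (fun k => p ≫ k) (conesLegs K).mor_tgt).trans ?_
      rw [← Category.assoc, ht, toUnit_coneElem_legs]
    have hP : (p ≫ (conesLegs K).mor) ≫ E.sqP = x ≫ (conesLegs K).obj := by
      rw [Category.assoc]
      refine (congrArg (fun k => p ≫ k) (conesLegs K).mor_src).trans ?_
      rw [← Category.assoc, hs]
    have hsq := sq_comm' (A := E) (p ≫ (conesLegs K).mor)
    have e₁ := E.mul_congr hU hQ (sq_uq' _)
    have e₂ := E.mul_congr hP hV (sq_pv' _)
    have e₃ := e₁.symm.trans (hsq.trans (e₂.trans (hone (untr_legs x).2 _)))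
    refine ⟨h₁, h₂, ?_⟩
    rw [← hg]
    exact (diag_mul_eq_iff _ h₁ (untr_legs x).1 hxc).1 e₃
  · rintro ⟨h₁, h₂, h₃⟩
    rw [← hg] at h₃
    have hm : (f ≫ (diag J B).mor) ≫ E.tgt = (toUnit X ≫ nameObj t) ≫ E.src := by
      apply untr_injective
      refine (untr_post _ _).trans (Eq.trans ?_ (untr_post _ _).symm)
      rw [untr_diag_mor, untr_nameObj, Category.assoc, hd]
      refine (constFam_comp (A := B.arr) f B.arrCod).trans ?_
      refine (congrArg (constFam J) h₂).trans ?_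
      rw [← Category.assoc, constFam, ← cstMap_ofPoint, ← Category.assoc]
      exact congrArg (fun k => k ≫ B.ofPoint l) (toTerminal_unique _ _)
    have hmul := (diag_mul_eq_iff hm h₁ (untr_legs x).1 hxc).2 h₃
    have hpv : (x ≫ (conesLegs K).obj) ≫ E.tgt = (toUnit X ≫ nameObj K ≫ E.one) ≫ E.src := by
      apply untr_injective
      refine (untr_post _ _).trans ?_
      rw [(untr_legs x).2, Category.assoc, Category.assoc, E.one_src, Category.comp_id,
        untr_nameObj]
    let s : X ⟶ E.sq := mkSq (f ≫ (diag J B).mor) (toUnit X ≫ nameObj t) (x ≫ (conesLegs K).obj)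
      (toUnit X ≫ nameObj K ≫ E.one) hm hpv (hmul.trans (hone (untr_legs x).2 hpv).symm)
    have hw : f ≫ (prodLift (diag J B) (toTerminal B ≫ name K)).mor = s ≫ (arrEnds E).mor := by
      apply CartesianMonoidalCategory.hom_ext
      · refine (Category.assoc _ _ _).trans (Eq.trans ?_ (Category.assoc _ _ _).symm)
        refine (congrArg (fun k => f ≫ k) (lift_fst _ _)).trans ((mkSq_u _ _ _ _ _ _ _).symm.trans
          (congrArg (fun k => s ≫ k) (lift_fst _ _).symm))
      · refine (Category.assoc _ _ _).trans (Eq.trans ?_ (Category.assoc _ _ _).symm)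
        refine (congrArg (fun k => f ≫ k) (lift_snd _ _)).trans (Eq.trans ?_
          ((mkSq_v _ _ _ _ _ _ _).symm.trans (congrArg (fun k => s ≫ k) (lift_snd _ _).symm)))
        refine (Category.assoc _ _ _).symm.trans ?_
        exact congrArg (fun k => k ≫ nameObj K ≫ E.one) (toUnit_unique _ _)
    have hf₁ : pbMor f s hw ≫ (conesApex K).mor = f := pbMor_fst _ _ _
    have hf₂ : pbMor f s hw ≫ (conesLegs K).mor = s := pbMor_snd _ _ _
    refine ⟨pbMor f s hw, pbObj_ext ?_ ?_, pbObj_ext ?_ ?_, hf₁⟩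
    · rw [Category.assoc, ← (conesApex K).mor_src, ← Category.assoc, hf₁, h₁]
    · rw [Category.assoc, ← (conesLegs K).mor_src, ← Category.assoc, hf₂]
      exact mkSq_p _ _ _ _ _ _ _
    · rw [Category.assoc, ← (conesApex K).mor_tgt, ← Category.assoc, hf₁, h₂,
        toUnit_coneElem_apex]
    · rw [Category.assoc, ← (conesLegs K).mor_tgt, ← Category.assoc, hf₂, toUnit_coneElem_legs]
      exact mkSq_q _ _ _ _ _ _ _

/-- A morphism of cones is determined by its ends and by the underlying morphism of apexes. -/
lemma cone_mor_ext {p p' : X ⟶ (cones K).mor} (hs : p ≫ (cones K).src = p' ≫ (cones K).src)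
    (ht : p ≫ (cones K).tgt = p' ≫ (cones K).tgt)
    (h : p ≫ (conesApex K).mor = p' ≫ (conesApex K).mor) : p = p' := by
  refine pbMor_ext h (sq_ext ?_ ?_ ?_ ?_)
  · refine (Category.assoc _ _ _).trans (Eq.trans ?_ (Category.assoc _ _ _).symm)
    have e := mor_w (conesLegs_dom K)
    refine (congrArg (fun k => p ≫ k) e).trans
      (Eq.trans ?_ (congrArg (fun k => p' ≫ k) e).symm)
    rw [← Category.assoc, h, Category.assoc]
  · refine (Category.assoc _ _ _).trans (Eq.trans ?_ (Category.assoc _ _ _).symm)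
    have e := (conesLegs K).mor_tgt
    refine (congrArg (fun k => p ≫ k) e).trans
      (Eq.trans ?_ (congrArg (fun k => p' ≫ k) e).symm)
    rw [← Category.assoc, ht, Category.assoc]
  · refine (Category.assoc _ _ _).trans (Eq.trans ?_ (Category.assoc _ _ _).symm)
    have e := (conesLegs K).mor_src
    refine (congrArg (fun k => p ≫ k) e).trans
      (Eq.trans ?_ (congrArg (fun k => p' ≫ k) e).symm)
    rw [← Category.assoc, hs, Category.assoc]
  · refine (Category.assoc _ _ _).trans (Eq.trans ?_ (Category.assoc _ _ _).symm)
    have e := mor_w (conesLegs_cod K)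
    refine (congrArg (fun k => p ≫ k) e).trans
      (Eq.trans ?_ (congrArg (fun k => p' ≫ k) e).symm)
    refine (Category.assoc _ _ _).symm.trans (Eq.trans ?_ (Category.assoc _ _ _))
    exact congrArg (fun k => k ≫ (name K).mor) (toUnit_unique _ _)

/-- The universal property of an internal limit, at every stage `X`. -/
theorem isInternalLimit_iff : IsInternalLimit K (coneElem K l t hd hc) ↔
    ∀ {X : V} (c : X ⟶ B.obj) (H : prod J (cst X) ⟶ B.arr), H ≫ B.arrDom = constFam J c →
      H ≫ B.arrCod = prodFst J (cst X) ≫ K →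
        ∃! f : X ⟶ B.mor, IsConeFactor l t.obj c H.obj f := by
  refine (isInternalTerminal_iff _ _).trans ⟨fun h X c H hHd hHc => ?_, fun h X x => ?_⟩
  · obtain ⟨x, rfl, rfl⟩ := exists_cone hHd hHc
    obtain ⟨p, ⟨h₁, h₂⟩, hp⟩ := h x
    refine ⟨p ≫ (conesApex K).mor, (cone_mor_iff hd hc x _).1 ⟨p, h₁, h₂, rfl⟩, fun f hf => ?_⟩
    obtain ⟨p', h₁', h₂', rfl⟩ := (cone_mor_iff hd hc x f).2 hf
    rw [hp p' ⟨h₁', h₂'⟩]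
  · obtain ⟨f, hf, hf'⟩ := h _ _ (untr_legs x).1 (untr_legs x).2
    obtain ⟨p, h₁, h₂, hp⟩ := (cone_mor_iff hd hc x f).2 hf
    refine ⟨p, ⟨h₁, h₂⟩, ?_⟩
    rintro p' ⟨h₁', h₂'⟩
    refine cone_mor_ext (h₁'.trans h₁.symm) (h₂'.trans h₂.symm) ?_
    rw [hp]
    exact hf' _ ((cone_mor_iff hd hc x _).1 ⟨p', h₁', h₂', rfl⟩)

end

end

end

end InternalCat

/-! ### Generalized elements of the internalization -/

section
variable {V : Type u} [Category.{v} V] [CartesianMonoidalCategory V] [HasCoproducts.{w} V]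
  {I : Type w}

variable (V) in
/-- The inclusion of `T` into `intObj V I ⊗ T`, the coproduct of copies of `T` indexed by `I`. -/
noncomputable def copyIncl (i : I) (T : V) : T ⟶ intObj V I ⊗ T := lift (toUnit T ≫ inO V i) (𝟙 T)

@[simp] lemma copyIncl_fst (i : I) (T : V) :
    copyIncl V i T ≫ fst (intObj V I) T = toUnit T ≫ inO V i := lift_fst _ _

@[simp] lemma copyIncl_snd (i : I) (T : V) : copyIncl V i T ≫ snd (intObj V I) T = 𝟙 T :=
  lift_snd _ _

lemma comp_copyIncl {S T : V} (k : S ⟶ T) (i : I) :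
    k ≫ copyIncl V i T = copyIncl V i S ≫ intObj V I ◁ k := by
  apply CartesianMonoidalCategory.hom_ext
  · rw [Category.assoc, copyIncl_fst, Category.assoc, whiskerLeft_fst, copyIncl_fst,
      ← Category.assoc, toUnit_unique (k ≫ toUnit T) (toUnit S)]
  · rw [Category.assoc, copyIncl_snd, Category.assoc, whiskerLeft_snd, ← Category.assoc,
      copyIncl_snd, Category.comp_id, Category.id_comp]

lemma eq_comp_copyIncl {S T : V} {i : I} {t : S ⟶ intObj V I ⊗ T} {a : S ⟶ 𝟙_ V}
    (h : t ≫ fst (intObj V I) T = a ≫ inO V i) :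
    t = (t ≫ snd (intObj V I) T) ≫ copyIncl V i T := by
  apply CartesianMonoidalCategory.hom_ext
  · rw [Category.assoc, copyIncl_fst, h, ← Category.assoc, toUnit_unique a (_ ≫ toUnit T)]
  · rw [Category.assoc, copyIncl_snd, Category.comp_id]

section
variable [EnrichedCategory V I]

lemma inM_whisker_src (i j : I) (T : V) :
    inM V i j ▷ T ≫ intSrc V I ▷ T = snd (i ⟶[V] j) T ≫ copyIncl V i T := by
  have e := inM_src (V := V) i j (fst (i ⟶[V] j) T)
  apply CartesianMonoidalCategory.hom_ext
  · rw [Category.assoc, whiskerRight_fst, whiskerRight_fst_assoc, Category.assoc, copyIncl_fst,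
      ← Category.assoc, e, ← Category.assoc, toUnit_unique (snd (i ⟶[V] j) T ≫ toUnit T) (toUnit _)]
  · rw [Category.assoc, whiskerRight_snd, whiskerRight_snd, Category.assoc, copyIncl_snd,
      Category.comp_id]

lemma inM_whisker_tgt (i j : I) (T : V) :
    inM V i j ▷ T ≫ intTgt V I ▷ T = snd (i ⟶[V] j) T ≫ copyIncl V j T := by
  have e := inM_tgt (V := V) i j (fst (i ⟶[V] j) T)
  apply CartesianMonoidalCategory.hom_ext
  · rw [Category.assoc, whiskerRight_fst, whiskerRight_fst_assoc, Category.assoc, copyIncl_fst,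
      ← Category.assoc, e, ← Category.assoc, toUnit_unique (snd (i ⟶[V] j) T ≫ toUnit T) (toUnit _)]
  · rw [Category.assoc, whiskerRight_snd, whiskerRight_snd, Category.assoc, copyIncl_snd,
      Category.comp_id]

end

variable [IsExtensive.{w} V]

lemma intObj_tensor_ext {T W : V} {m m' : intObj V I ⊗ T ⟶ W}
    (h : ∀ i : I, copyIncl V i T ≫ m = copyIncl V i T ≫ m') : m = m' := by
  refine IsExtensive.hom_ext (X := fun _ : I => 𝟙_ V) (fst (intObj V I) T) fun i S t a ht => ?_
  rw [eq_comp_copyIncl ht, Category.assoc, h, ← Category.assoc]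

lemma exists_copyIncl_desc {T W : V} (m : I → (T ⟶ W)) :
    ∃ d : intObj V I ⊗ T ⟶ W, ∀ i, copyIncl V i T ≫ d = m i := by
  obtain ⟨d, hd⟩ := IsExtensive.exists_glue (X := fun _ : I => 𝟙_ V) (fst (intObj V I) T)
    (fun i S t _ _ => (t ≫ snd (intObj V I) T) ≫ m i) (fun i S S' k t a h => by
      simp only [Category.assoc])
  refine ⟨d, fun i => (hd i (copyIncl V i T) (toUnit T) (copyIncl_fst i T)).trans ?_⟩
  rw [copyIncl_snd, Category.id_comp]

variable [EnrichedCategory V I]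

lemma inM_injective {A B : I} {T : V} {a b : T ⟶ (A ⟶[V] B)} (h : a ≫ inM V A B = b ≫ inM V A B) :
    a = b :=
  IsExtensive.ι_injective (X := fun p : I × I => (p.1 ⟶[V] p.2)) (k := (A, B)) h

lemma intMor_tensor_ext {T W : V} {m m' : intMor V I ⊗ T ⟶ W}
    (h : ∀ i j : I, inM V i j ▷ T ≫ m = inM V i j ▷ T ≫ m') : m = m' := by
  refine int_ext (fst (intMor V I) T) fun i j S t a ht => ?_
  have e : t = lift a (t ≫ snd (intMor V I) T) ≫ inM V i j ▷ T := by
    apply CartesianMonoidalCategory.hom_ext <;> simp [ht]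
  rw [e, Category.assoc, Category.assoc, h]

end

section
variable {V : Type u} [Category.{v} V] [CartesianMonoidalCategory V] [MonoidalClosed V]
  [HasCoproducts.{w} V] [IsExtensive.{w} V]
variable {I C : Type w} [EnrichedCategory V I] [EnrichedCategory V C]

/-- The hom-object `C(A, B)` is the fibre of the object of morphisms over `(A, B)`: the other
summands meet this fibre in initial objects only. -/
lemma exists_eq_inM {A B : C} {T : V} {f : T ⟶ intMor V C}
    (hs : f ≫ intSrc V C = toUnit T ≫ inO V A) (ht : f ≫ intTgt V C = toUnit T ≫ inO V B) :
    ∃ a : T ⟶ (A ⟶[V] B), a ≫ inM V A B = f := by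
  obtain ⟨a, -, ha⟩ := IsExtensive.exists_factor (X := fun _ : C × C => 𝟙_ V)
    (fun p => Over.mk (toUnit (p.1 ⟶[V] p.2))) (A, B) f (toUnit T) (by
      refine int_ext f fun A' B' S t a ha => ?_
      have hs' := inM_src A' B' a
      have ht' := inM_tgt A' B' a
      rw [← ha, Category.assoc, hs, ← Category.assoc,
        toUnit_unique (t ≫ toUnit T) (toUnit S)] at hs'
      rw [← ha, Category.assoc, ht, ← Category.assoc,
        toUnit_unique (t ≫ toUnit T) (toUnit S)] at ht'
      -- Off the summand of `(A, B)`, two distinct inclusions into `∐ 1` agree on `S`.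
      by_cases hA : A = A'
      · by_cases hB : B = B'
        · subst hA hB
          rw [← Category.assoc, ha, Category.assoc, inM]
          refine (congrArg (fun k => a ≫ k)
            (Limits.Sigma.ι_map (fun p : C × C => toUnit (p.1 ⟶[V] p.2)) (A, B))).trans ?_
          rw [← Category.assoc, ← Category.assoc]
          exact congrArg (fun k => k ≫ Limits.Sigma.ι (fun _ : C × C => 𝟙_ V) (A, B))
            (toUnit_unique _ _)
        · exact (IsExtensive.exists_initial (X := fun _ : C => 𝟙_ V) hB ht').some.hom_ext _ _
      · exact (IsExtensive.exists_initial (X := fun _ : C => 𝟙_ V) hA hs').some.hom_ext _ _)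
  exact ⟨a, ha⟩

variable [HasPullbacks V]

/-! ### Enriched and internal cones -/

section
variable {G : EnrichedFunctor V I C} {A : C} {T : V}

lemma constFam_mor_inM (i j : I) :
    inM V i j ▷ T ≫ (InternalCat.constFam (A := Int V C) (Int V I) (toUnit T ≫ inO V A)).mor =
      (toUnit _ ≫ eId V A) ≫ inM V A A := by
  have e := inO_one (V := V) A (toUnit T)
  have e' : (InternalCat.constFam (A := Int V C) (Int V I) (toUnit T ≫ inO V A)).mor =
      snd (intMor V I) T ≫ (toUnit T ≫ inO V A) ≫ intOne V C := rfl
  rw [e', e, whiskerRight_snd_assoc]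
  simp only [← Category.assoc]
  rw [toUnit_unique (snd (i ⟶[V] j) T ≫ toUnit T) (toUnit _)]

lemma prodFst_intMap_mor_inM (i j : I) :
    inM V i j ▷ T ≫ (InternalCat.prodFst (Int V I) (InternalCat.cst T) ≫ intMap G).mor =
      (fst _ _ ≫ G.map i j) ≫ inM V (G.obj i) (G.obj j) := by
  refine Eq.trans ?_ (inM_map G i j (fst (i ⟶[V] j) T))
  refine (Category.assoc _ _ _).symm.trans ?_
  exact congrArg (fun k => k ≫ intMapMor G) (whiskerRight_fst _ _)

lemma copyIncl_intMapObj (i : I) :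
    copyIncl V i T ≫ (InternalCat.prodFst (Int V I) (InternalCat.cst T) ≫ intMap G).obj =
      toUnit T ≫ inO V (G.obj i) := by
  refine Eq.trans ?_ (inO_map G i (toUnit T))
  refine (Category.assoc _ _ _).symm.trans ?_
  exact congrArg (fun k => k ≫ intMapObj G) (copyIncl_fst i T)

lemma copyIncl_constFam (i : I) (c : T ⟶ intObj V C) :
    copyIncl V i T ≫ (InternalCat.constFam (A := Int V C) (Int V I) c).obj = c := by
  rw [InternalCat.constFam_obj, ← Category.assoc, copyIncl_snd, Category.id_comp]

/-- Every cone of `V`-categories with apex `A` at stage `T` is the family of components of a cone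
of internal categories. -/
lemma exists_internal_cone (k : T ⟶ natHom (constFunctor I A) G) :
    ∃ H : InternalCat.prod (Int V I) (InternalCat.cst T) ⟶ (Int V C).arr,
      H ≫ (Int V C).arrDom = InternalCat.constFam (A := Int V C) (Int V I) (toUnit T ≫ inO V A) ∧
      H ≫ (Int V C).arrCod = InternalCat.prodFst _ _ ≫ intMap G ∧
      ∀ i, copyIncl V i T ≫ H.obj = (k ≫ natπ _ G i) ≫ inM V A (G.obj i) := by
  obtain ⟨d, hd⟩ := exists_copyIncl_desc (T := T)
    (fun i : I => (k ≫ natπ (constFunctor I A) G i) ≫ inM V A (G.obj i))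
  have hs : d ≫ intSrc V C =
      (InternalCat.constFam (A := Int V C) (Int V I) (toUnit T ≫ inO V A)).obj :=
    intObj_tensor_ext fun i => by
      rw [← Category.assoc, hd, inM_src]
      exact (copyIncl_constFam i _).symm
  have ht : d ≫ intTgt V C =
      (InternalCat.prodFst (Int V I) (InternalCat.cst T) ≫ intMap G).obj :=
    intObj_tensor_ext fun i => by
      rw [← Category.assoc, hd, inM_tgt]
      exact (copyIncl_intMapObj i).symm
  refine ⟨InternalCat.mkArr _ _ d hs ht ?_, InternalCat.mkArr_dom _ _ _ _ _ _,
    InternalCat.mkArr_cod _ _ _ _ _ _, hd⟩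
  refine intMor_tensor_ext fun i j => ?_
  refine (Int_mul _ (inM V i j ▷ T) (toUnit _ ≫ eId V A)
    (snd _ _ ≫ k ≫ natπ (constFunctor I A) G j) (constFam_mor_inM i j) ?_).trans
      (Eq.trans ?_ (Int_mul _ (inM V i j ▷ T) (snd _ _ ≫ k ≫ natπ (constFunctor I A) G i)
        (fst _ _ ≫ G.map i j) ?_ (prodFst_intMap_mor_inM i j)).symm)
  · rw [InternalCat.prod_cst_tgt]
    refine (Category.assoc _ _ _).symm.trans ?_
    refine (congrArg (fun t => t ≫ d) (inM_whisker_tgt i j T)).trans ?_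
    rw [Category.assoc, hd, ← Category.assoc]
  · have h := cone_w (fst (i ⟶[V] j) T) (snd (i ⟶[V] j) T ≫ k)
    rw [Category.assoc, Category.assoc] at h
    rw [h, el_id_left]
  · rw [InternalCat.prod_cst_src]
    refine (Category.assoc _ _ _).symm.trans ?_
    refine (congrArg (fun t => t ≫ d) (inM_whisker_src i j T)).trans ?_
    rw [Category.assoc, hd, ← Category.assoc]

/-- Every cone of internal categories whose apex at stage `T` is an object `A` of `C` comes from a
cone of `V`-categories. -/
lemma exists_enriched_cone {H : InternalCat.prod (Int V I) (InternalCat.cst T) ⟶ (Int V C).arr}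
    (hd : H ≫ (Int V C).arrDom =
      InternalCat.constFam (A := Int V C) (Int V I) (toUnit T ≫ inO V A))
    (hc : H ≫ (Int V C).arrCod = InternalCat.prodFst _ _ ≫ intMap G) :
    ∃ k : T ⟶ natHom (constFunctor I A) G,
      ∀ i, copyIncl V i T ≫ H.obj = (k ≫ natπ _ G i) ≫ inM V A (G.obj i) := by
  have hs : H.obj ≫ intSrc V C = _ := congrArg InternalCat.Hom.obj hd
  have ht : H.obj ≫ intTgt V C = _ := congrArg InternalCat.Hom.obj hc
  have ha (i : I) : ∃ a : T ⟶ (A ⟶[V] G.obj i), a ≫ inM V A (G.obj i) = copyIncl V i T ≫ H.obj :=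
    exists_eq_inM
      ((Category.assoc _ _ _).trans ((congrArg (fun t => copyIncl V i T ≫ t) hs).trans
        (copyIncl_constFam i _)))
      ((Category.assoc _ _ _).trans ((congrArg (fun t => copyIncl V i T ≫ t) ht).trans
        (copyIncl_intMapObj i)))
  choose a ha using ha
  refine ⟨natLift a fun i j => ?_, fun i => by rw [natLift_π, ha]⟩
  apply inM_injective
  have hsrc (i j : I) : inM V i j ▷ T ≫ intSrc V I ▷ T ≫ H.obj =
      (snd _ _ ≫ a i) ≫ inM V A (G.obj i) := by
    rw [← Category.assoc, inM_whisker_src, Category.assoc, Category.assoc, ha]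
  have htgt (i j : I) : inM V i j ▷ T ≫ intTgt V I ▷ T ≫ H.obj =
      (snd _ _ ≫ a j) ≫ inM V A (G.obj j) := by
    rw [← Category.assoc, inM_whisker_tgt, Category.assoc, Category.assoc, ha]
  have hdom : inM V i j ▷ T ≫ (H ≫ (Int V C).arrDom).mor = (toUnit _ ≫ eId V A) ≫ inM V A A :=
    (congrArg (fun t => inM V i j ▷ T ≫ t) (congrArg InternalCat.Hom.mor hd)).trans
      (constFam_mor_inM i j)
  have hcod : inM V i j ▷ T ≫ (H ≫ (Int V C).arrCod).mor =
      (fst _ _ ≫ G.map i j) ≫ inM V (G.obj i) (G.obj j) :=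
    (congrArg (fun t => inM V i j ▷ T ≫ t) (congrArg InternalCat.Hom.mor hc)).trans
      (prodFst_intMap_mor_inM i j)
  have c₁ : (H ≫ (Int V C).arrDom).mor ≫ intTgt V C =
      (intTgt V I ▷ T ≫ H.obj) ≫ intSrc V C := by
    refine (InternalCat.Hom.mor_tgt _).trans ?_
    rw [InternalCat.prod_cst_tgt, Category.assoc]
    rfl
  have c₂ : (intSrc V I ▷ T ≫ H.obj) ≫ intTgt V C =
      (H ≫ (Int V C).arrCod).mor ≫ intSrc V C := by
    refine Eq.trans ?_ (H ≫ (Int V C).arrCod).mor_src.symm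
    rw [InternalCat.prod_cst_src, Category.assoc]
    rfl
  have n := InternalCat.arr_nat H (a := intTgt V I ▷ T ≫ H.obj) (b := intSrc V I ▷ T ≫ H.obj)
    (congrArg (fun t => t ≫ H.obj) InternalCat.prod_cst_tgt)
    (congrArg (fun t => t ≫ H.obj) InternalCat.prod_cst_src)
    c₁ c₂
  have e₁ := Int_mul c₁ (inM V i j ▷ T) _ _ hdom (htgt i j)
  have e₂ := Int_mul c₂ (inM V i j ▷ T) _ _ (hsrc i j) hcod
  rw [← Category.assoc (fst (i ⟶[V] j) T) (toUnit (i ⟶[V] j)),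
    toUnit_unique (fst (i ⟶[V] j) T ≫ toUnit _) (toUnit _)]
  exact e₁.symm.trans ((congrArg (fun t => inM V i j ▷ T ≫ t) n).trans e₂)

/-- Factorizations of enriched cones are the same as factorizations of the corresponding internal
cones. -/
lemma isConeFactor_inM_iff {L : C} {lam : VNatTrans (constFunctor I L) G}
    {h : intObj V I ⊗ T ⟶ intMor V C} {k : T ⟶ natHom (constFunctor I A) G}
    (hk : ∀ i, copyIncl V i T ≫ h = (k ≫ natπ _ G i) ≫ inM V A (G.obj i)) (f : T ⟶ (A ⟶[V] L)) :
    InternalCat.IsConeFactor (J := Int V I) (B := Int V C) (inO V L) (intNatObj lam)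
      (toUnit T ≫ inO V A) h (f ≫ inM V A L) ↔
        ∀ i, el f (toUnit T ≫ lam.app i) = k ≫ natπ _ G i := by
  have hf (i : I) : copyIncl V i T ≫ snd (intObj V I) T ≫ f ≫ inM V A L = f ≫ inM V A L := by
    rw [← Category.assoc, copyIncl_snd, Category.id_comp]
  have hl (i : I) : copyIncl V i T ≫ fst (intObj V I) T ≫ intNatObj lam =
      (toUnit T ≫ lam.app i) ≫ inM V L (G.obj i) := by
    rw [← Category.assoc, copyIncl_fst]
    exact inO_natObj lam i (toUnit T)
  have key (i : I) (e) := Int_mul (f := snd (intObj V I) T ≫ f ≫ inM V A L)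
    (g := fst (intObj V I) T ≫ intNatObj lam) e (copyIncl V i T) _ _ (hf i) (hl i)
  have hc : (snd (intObj V I) T ≫ f ≫ inM V A L) ≫ intTgt V C =
      (fst (intObj V I) T ≫ intNatObj lam) ≫ intSrc V C := intObj_tensor_ext fun i => by
    rw [← Category.assoc, hf, ← Category.assoc, hl, inM_src, inM_tgt]
  constructor
  · rintro ⟨-, -, h₃⟩ i
    apply inM_injective
    rw [← hk, ← key i hc]
    exact congrArg (fun t => copyIncl V i T ≫ t) (h₃ hc)
  · intro h'
    refine ⟨inM_src _ _ _, inM_tgt _ _ _, fun e => intObj_tensor_ext fun i => ?_⟩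
    rw [hk, ← h' i]
    exact key i e

end

/-! ### Gluing factorizations -/

/-- Being a factorization is local on the coproduct that the apex lives over. -/
lemma isConeFactor_of_local {L : C} {τ : intObj V I ⟶ intMor V C} {X : V} {c : X ⟶ intObj V C}
    {h : intObj V I ⊗ X ⟶ intMor V C} {f : X ⟶ intMor V C}
    (H : ∀ (A : C) {T : V} (t : T ⟶ X), t ≫ c = toUnit T ≫ inO V A →
      InternalCat.IsConeFactor (J := Int V I) (B := Int V C) (inO V L) τ (t ≫ c)
        (intObj V I ◁ t ≫ h) (t ≫ f)) :
    InternalCat.IsConeFactor (J := Int V I) (B := Int V C) (inO V L) τ c h f := by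
  have ext {W : V} {m m' : X ⟶ W} (e : ∀ (A : C) {T : V} (t : T ⟶ X),
      t ≫ c = toUnit T ≫ inO V A → t ≫ m = t ≫ m') : m = m' :=
    IsExtensive.hom_ext (X := fun _ : C => 𝟙_ V) c fun A T t a ht =>
      e A t (by rw [ht, toUnit_unique a (toUnit T)]; rfl)
  refine ⟨ext fun A T t ht => ?_, ext fun A T t ht => ?_, fun e => intObj_tensor_ext fun i =>
    ext fun A T t ht => ?_⟩
  · exact (Category.assoc _ _ _).symm.trans (H A t ht).1
  · refine (Category.assoc _ _ _).symm.trans ((H A t ht).2.1.trans ?_)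
    rw [← Category.assoc, toUnit_unique (t ≫ toUnit X) (toUnit T)]
  · rw [← Category.assoc, ← Category.assoc, comp_copyIncl, Category.assoc, Category.assoc]
    refine congrArg (fun k => copyIncl V i T ≫ k) ?_
    refine (InternalCat.whisker_mul (Int V C) _ _ _ e).trans ?_
    have e₁ : intObj V I ◁ t ≫ snd (intObj V I) X ≫ f = snd (intObj V I) T ≫ t ≫ f :=
      whiskerLeft_snd_assoc _ _ _
    have e₂ : intObj V I ◁ t ≫ fst (intObj V I) X ≫ τ = fst (intObj V I) T ≫ τ :=
      whiskerLeft_fst_assoc _ _ _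
    exact (InternalCat.mul_congr (Int V C) e₁ e₂ _).trans ((H A t ht).2.2 _)

/-- A cone of internal categories factors uniquely through the given one if it does so locally on
the coproduct that its apex lives over: uniqueness makes the local factorizations agree. -/
lemma existsUnique_isConeFactor_of_local {L : C} {τ : intObj V I ⟶ intMor V C}
    (hτ : τ ≫ intSrc V C = toUnit (intObj V I) ≫ inO V L) {X : V} (c : X ⟶ intObj V C)
    (h : intObj V I ⊗ X ⟶ intMor V C)
    (H : ∀ (A : C) {T : V} (t : T ⟶ X), t ≫ c = toUnit T ≫ inO V A →
      ∃! f, InternalCat.IsConeFactor (J := Int V I) (B := Int V C) (inO V L) τ (t ≫ c)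
        (intObj V I ◁ t ≫ h) f) :
    ∃! f, InternalCat.IsConeFactor (J := Int V I) (B := Int V C) (inO V L) τ c h f := by
  have apex {A : C} {T : V} {t : T ⟶ X} {a : T ⟶ 𝟙_ V}
      (ht : t ≫ c = a ≫ Limits.Sigma.ι (fun _ : C => 𝟙_ V) A) : t ≫ c = toUnit T ≫ inO V A := by
    rw [ht, toUnit_unique a (toUnit T)]
    rfl
  choose g hg hg' using @H
  obtain ⟨f, hf⟩ := IsExtensive.exists_glue (X := fun _ : C => 𝟙_ V) (W := intMor V C) c
    (fun A T t a ht => g A t (apex ht)) (fun A T T' k t a ht => by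
      refine hg' A (k ≫ t) _ _ ?_
      have := (hg A t (apex ht)).comp hτ k
      rw [← Category.assoc, ← Category.assoc] at this
      rwa [MonoidalCategory.whiskerLeft_comp])
  refine ⟨f, isConeFactor_of_local fun A T t ht => ?_, fun f' hf' => ?_⟩
  · rw [hf A t (toUnit T) ht]
    exact hg A t ht
  · refine IsExtensive.hom_ext (X := fun _ : C => 𝟙_ V) c fun A T t a ht => ?_
    rw [hf A t a ht]
    exact hg' A t (apex ht) _ (hf'.comp hτ t)

end

end EnrichedInternal

theorem mainTheorem11 {V : Type u} [Category.{v} V] [CartesianMonoidalCategory V]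
    [MonoidalClosed V] [HasPullbacks V] [HasCoproducts.{w} V] [EnrichedInternal.IsExtensive.{w} V]
    {I C : Type w} [EnrichedCategory V I] [EnrichedCategory V C]
    (G : EnrichedFunctor V I C) (L : C)
    (lam : EnrichedInternal.VNatTrans (EnrichedInternal.constFunctor I L) G) :
    EnrichedInternal.IsConicalLimit G L lam ↔
      EnrichedInternal.InternalCat.IsInternalLimit (EnrichedInternal.intMap G)
        (EnrichedInternal.coneElement G L lam) := by
  open EnrichedInternal in
  have hd : intNat lam ≫ (Int V C).arrDom =
      InternalCat.toTerminal _ ≫ (Int V C).ofPoint (inO V L) :=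
    (InternalCat.mkArr_dom _ _ _ _ _ _).trans (intMap_const L)
  have hc : intNat lam ≫ (Int V C).arrCod = intMap G := InternalCat.mkArr_cod _ _ _ _ _ _
  refine (isConicalLimit_iff G L lam).trans
    (Iff.trans ?_ (InternalCat.isInternalLimit_iff hd hc).symm)
  constructor
  · intro h X c H hHd hHc
    refine existsUnique_isConeFactor_of_local (congrArg InternalCat.Hom.obj hd) c H.obj
      fun A T t ht => ?_
    have hobj : (InternalCat.baseMap (Int V I) t ≫ H).obj = intObj V I ◁ t ≫ H.obj :=
      congrArg (fun k => k ≫ H.obj) (InternalCat.baseMap_obj _ t)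
    obtain ⟨k, hk⟩ := exists_enriched_cone (G := G) (A := A)
      (H := InternalCat.baseMap (Int V I) t ≫ H)
      (by rw [Category.assoc, hHd, InternalCat.baseMap_constFam, ht])
      (by rw [Category.assoc, hHc, ← Category.assoc, InternalCat.baseMap_fst])
    rw [← hobj, ht]
    obtain ⟨f, hf, hf'⟩ := h A k
    refine ⟨f ≫ inM V A L, (isConeFactor_inM_iff hk f).2 hf, fun g hg => ?_⟩
    obtain ⟨f', rfl⟩ := exists_eq_inM hg.1 hg.2.1
    rw [hf' f' ((isConeFactor_inM_iff hk f').1 hg)]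
  · intro h A T k
    obtain ⟨H, hHd, hHc, hk⟩ := exists_internal_cone k
    obtain ⟨g, hg, hg'⟩ := h _ H hHd hHc
    obtain ⟨f, rfl⟩ := exists_eq_inM hg.1 hg.2.1
    exact ⟨f, (isConeFactor_inM_iff hk f).1 hg, fun f' hf' =>
      inM_injective (hg' _ ((isConeFactor_inM_iff hk f').2 hf'))⟩
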